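/- Let $\varepsilon\in\{1,-1\}$. For $i,j\ge 0$ let $H^{i}(\mathbb R)$ be the space of $f:\mathbb R\to\mathbb C$ whose weak derivatives $f,f',\dots,f^{(i)}$ lie in $L^2(\mathbb R)$, and let $H^{i,j}(\mathbb R)=\{f\in H^i(\mathbb R): x^jf\in L^2(\mathbb R)\}$. Let $\rho_1,\rho_2\in H^{1,1}(\mathbb R)$ (identified with their continuous representatives); if $\varepsilon=-1$, assume also that $|\rho_1(\lambda)|^2+|\rho_2(\lambda)|^2<1$ for all $\lambda\in\mathbb R$. For $x,\lambda\in\mathbb R$ put $$V_x(\lambda)=\begin{pmatrix}1+\varepsilon|\rho_1(\lambda)|^2+\varepsilon|\rho_2(\lambda)|^2&\varepsilon e^{-2i\lambda x}\overline{\rho_1(\lambda)}&\varepsilon e^{-2i\lambda x}\overline{\rho_2(\lambda)}\\ e^{2i\lambda x}\rho_1(\lambda)&1&0\\ e^{2i\lambda x}\rho_2(\lambda)&0&1\end{pmatrix}.$$ Then for every $x\in\mathbb R$ there is exactly one $3\times3$ matrix-valued function $M(x,\cdot)$ on $\mathbb C\setminus\mathbb R$ such that (i) $M(x,\cdot)$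 is analytic on $\mathbb C\setminus\mathbb R$; (ii) $M(x,z)\to I$ as $z\to\infty$ in $\mathbb C\setminus\mathbb R$, and, for every $c>0$, $M(x,z)=I+O(z^{-1})$ as $z\to\infty$ with $|\operatorname{Im}z|\ge c|\operatorname{Re}z|$; (iii) $M(x,\cdot)$ extends continuously to $\mathbb R$ from the upper and from the lower half-plane, and the boundary values $M_\pm(x,\lambda)$ satisfy $M_+(x,\lambda)=M_-(x,\lambda)V_x(\lambda)$ for every $\lambda\in\mathbb R$. Moreover, for every $x\in\mathbb R$ the reconstructed potentials $$u(x)=-2i\lim_{z\to\infty}zM(x,z)_{21},\qquad v(x)=-2i\lim_{z\to\infty}zM(x,z)_{31}$$ exist (limits as $z\to\infty$ in the lower half-plane with $|\operatorname{Im}z|\ge c|\operatorname{Re}z|$, for every $c>0$), and $u,v\in H^1(\mathbb R)$. If in addition $\rho_1,\rho_2\in H^{0,2}(\mathbb R)$, then $u,v\in H^2(\mathbb R)$. -/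

import Mathlib

open Complex Filter Topology MeasureTheory Matrix Bornology

/-- `g` is the weak (distributional) derivative of `f` on `ℝ`: both are locally integrable and
`∫ f φ' = - ∫ g φ` for every smooth compactly supported test function `φ`. -/
def HasWeakDeriv (f g : ℝ → ℂ) : Prop :=
  LocallyIntegrable f ∧ LocallyIntegrable g ∧
    ∀ φ : ℝ → ℝ, ContDiff ℝ ((⊤ : ℕ∞) : WithTop ℕ∞) φ → HasCompactSupport φ →
      ∫ x, f x * ((deriv φ x : ℝ) : ℂ) = - ∫ x, g x * ((φ x : ℝ) : ℂ)

/-- The Sobolev space `H^k(ℝ)`: `f` and its weak derivatives up to order `k` are in `L²(ℝ)`. -/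
def MemH : ℕ → (ℝ → ℂ) → Prop
  | 0, f => MemLp f 2
  | k + 1, f => MemLp f 2 ∧ ∃ g, HasWeakDeriv f g ∧ MemH k g

/-- The weighted Sobolev space `H^{i,j}(ℝ)`: `f ∈ H^i(ℝ)` and `x^j f ∈ L²(ℝ)`. -/
def MemWeightedH (i j : ℕ) (f : ℝ → ℂ) : Prop :=
  MemH i f ∧ MemLp (fun x : ℝ => (x : ℂ) ^ j * f x) 2

/-- The conjugation `e^{iλx ad σ} B = e^{iλxσ} B e^{-iλxσ}` with `σ = diag(-1, 1, 1)`, written out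
entrywise: the entries `(1,2), (1,3)` are multiplied by `e^{-2iλx}` and the entries
`(2,1), (3,1)` by `e^{2iλx}`. -/
noncomputable def adConj (x l : ℝ) (B : Matrix (Fin 3) (Fin 3) ℂ) : Matrix (Fin 3) (Fin 3) ℂ :=
  !![B 0 0, exp (-2 * I * l * x) * B 0 1, exp (-2 * I * l * x) * B 0 2;
     exp (2 * I * l * x) * B 1 0, B 1 1, B 1 2;
     exp (2 * I * l * x) * B 2 0, B 2 1, B 2 2]

/-- The jump matrix `V(λ)` built from the values `r₁ = ρ₁(λ)`, `r₂ = ρ₂(λ)`. -/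
noncomputable def jumpV (ε : ℝ) (r₁ r₂ : ℂ) : Matrix (Fin 3) (Fin 3) ℂ :=
  !![1 + (ε : ℂ) * (‖r₁‖ : ℂ) ^ 2 + (ε : ℂ) * (‖r₂‖ : ℂ) ^ 2, ε * star r₁, ε * star r₂;
     r₁, 1, 0;
     r₂, 0, 1]

/-- `z → ∞` inside the part of the set `S` lying in the double sector `|Im z| ≥ c |Re z|`
(non-tangential approach to infinity, relative to the real axis). -/
noncomputable def sectorAtInfty (c : ℝ) (S : Set ℂ) : Filter ℂ :=
  cobounded ℂ ⊓ 𝓟 (S ∩ {z : ℂ | c * |z.re| ≤ |z.im|})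

/-- `M` solves the `3 × 3` Riemann-Hilbert problem with parameter `x` and jump data `ε, ρ₁, ρ₂`
(the values of `M` on the real axis play no role):
* `M` is analytic on `ℂ ∖ ℝ`;
* `M(z) → I` as `z → ∞` in `ℂ ∖ ℝ`, and `M(z) = I + O(1/z)` as `z → ∞` non-tangentially;
* `M` extends continuously to the real line from the upper and from the lower half-plane, and the
  boundary values satisfy `M₊(λ) = M₋(λ) e^{iλx ad σ} V(λ)` for every real `λ`. -/
structure IsRHPSolution (ε : ℝ) (ρ₁ ρ₂ : ℝ → ℂ) (x : ℝ)
    (M : ℂ → Matrix (Fin 3) (Fin 3) ℂ) : Prop where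
  analytic : ∀ i j, DifferentiableOn ℂ (fun z => M z i j) {z : ℂ | z.im ≠ 0}
  tendsto_one : Tendsto M (cobounded ℂ ⊓ 𝓟 {z : ℂ | z.im ≠ 0}) (𝓝 1)
  normalization : ∀ c : ℝ, 0 < c → ∀ i j,
    (fun z => M z i j - (1 : Matrix (Fin 3) (Fin 3) ℂ) i j)
      =O[sectorAtInfty c {z : ℂ | z.im ≠ 0}] (fun z => z⁻¹)
  jump : ∃ Mp Mm : ℝ → Matrix (Fin 3) (Fin 3) ℂ, Continuous Mp ∧ Continuous Mm ∧
    (∀ l : ℝ, Tendsto M (𝓝[{z : ℂ | 0 < z.im}] (l : ℂ)) (𝓝 (Mp l))) ∧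
    (∀ l : ℝ, Tendsto M (𝓝[{z : ℂ | z.im < 0}] (l : ℂ)) (𝓝 (Mm l))) ∧
    ∀ l : ℝ, Mp l = Mm l * adConj x l (jumpV ε (ρ₁ l) (ρ₂ l))

/-- The reconstruction formula `[u, v] = -2i lim_{z → ∞} [z M₋(z)₂₁, z M₋(z)₃₁]`, where `M₋` is `M`
in the lower half-plane and the limit is non-tangential. -/
def IsReconstructed (M : ℂ → Matrix (Fin 3) (Fin 3) ℂ) (u v : ℂ) : Prop :=
  ∀ c : ℝ, 0 < c →
    Tendsto (fun z => -2 * I * (z * M z 1 0)) (sectorAtInfty c {z : ℂ | z.im < 0}) (𝓝 u) ∧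
    Tendsto (fun z => -2 * I * (z * M z 2 0)) (sectorAtInfty c {z : ℂ | z.im < 0}) (𝓝 v)

open scoped FourierTransform ENNReal ComplexInnerProductSpace ComplexConjugate

/-! ### Operators on `L²(ℝ)` -/

/-- The Hilbert space `L²(ℝ; ℂ)`. -/
abbrev L2R : Type := Lp ℂ 2 (volume : Measure ℝ)

/-- Translation `(shift τ f)(s) = f (s + τ)` on `L²(ℝ)`. -/
noncomputable def shift (τ : ℝ) : L2R →L[ℂ] L2R :=
  (Lp.compMeasurePreservingₗᵢ ℂ (fun s : ℝ => s + τ)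
    (measurePreserving_add_right volume τ)).toContinuousLinearMap

theorem coeFn_shift (τ : ℝ) (f : L2R) : shift τ f =ᵐ[volume] fun s => f (s + τ) :=
  Lp.coeFn_compMeasurePreserving f (measurePreserving_add_right volume τ)

theorem norm_shift (τ : ℝ) (f : L2R) : ‖shift τ f‖ = ‖f‖ :=
  Lp.norm_compMeasurePreserving f (measurePreserving_add_right volume τ)

theorem ae_comp_add {p : ℝ → Prop} (τ : ℝ) (h : ∀ᵐ s : ℝ, p s) : ∀ᵐ s : ℝ, p (s + τ) :=
  (measurePreserving_add_right volume τ).quasiMeasurePreserving.ae h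

theorem shift_shift (σ τ : ℝ) (f : L2R) : shift σ (shift τ f) = shift (σ + τ) f := by
  apply Lp.ext
  filter_upwards [coeFn_shift σ (shift τ f), ae_comp_add σ (coeFn_shift τ f),
    coeFn_shift (σ + τ) f] with s h1 h2 h3
  rw [h1, h2, h3, add_assoc]

theorem shift_zero (f : L2R) : shift 0 f = f := by
  apply Lp.ext
  filter_upwards [coeFn_shift 0 f] with s h1
  rw [h1, add_zero]

theorem inner_shift_shift (τ : ℝ) (f g : L2R) : ⟪shift τ f, shift τ g⟫ = ⟪f, g⟫ :=
  (Lp.compMeasurePreservingₗᵢ ℂ (fun s : ℝ => s + τ)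
    (measurePreserving_add_right volume τ)).inner_map_map f g

theorem inner_shift_left (τ : ℝ) (f g : L2R) : ⟪shift τ f, g⟫ = ⟪f, shift (-τ) g⟫ := by
  rw [← inner_shift_shift (-τ), shift_shift, neg_add_cancel, shift_zero]

theorem continuous_shift (f : L2R) : Continuous fun τ => shift τ f := by
  let g : C(ℝ, C(ℝ, ℝ)) :=
    (ContinuousMap.mk (fun a : ℝ × ℝ => a.2 + a.1) (by fun_prop)).curry
  exact (continuous_const (y := f)).compMeasurePreservingLp g.continuous
    (fun τ => measurePreserving_add_right volume τ) (by norm_num)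

/-- Joint continuity of translation. -/
theorem Filter.Tendsto.shift {α : Type*} {l : Filter α} {τ : α → ℝ} {τ₀ : ℝ} {f : α → L2R}
    {f₀ : L2R} (hτ : Tendsto τ l (𝓝 τ₀)) (hf : Tendsto f l (𝓝 f₀)) :
    Tendsto (fun a => shift (τ a) (f a)) l (𝓝 (shift τ₀ f₀)) := by
  have h1 : Tendsto (fun a => _root_.shift (τ a) f₀) l (𝓝 (_root_.shift τ₀ f₀)) :=
    ((continuous_shift f₀).tendsto τ₀).comp hτ
  have h2 : Tendsto (fun a => _root_.shift (τ a) (f a) - _root_.shift (τ a) f₀) l (𝓝 0) := by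
    rw [tendsto_zero_iff_norm_tendsto_zero]
    simp_rw [← map_sub, norm_shift]
    exact tendsto_iff_norm_sub_tendsto_zero.mp hf
  simpa using h2.add h1

/-- Multiplication by a bounded measurable function. -/
noncomputable def mulOp (m : ℝ → ℂ) (hm : AEStronglyMeasurable m volume) (C : ℝ)
    (hC : ∀ s, ‖m s‖ ≤ C) : L2R →L[ℂ] L2R :=
  have key : ∀ f : L2R, MemLp (fun s => m s * f s) 2 volume := fun f =>
    (Lp.memLp f).of_le_mul (c := C) (hm.mul (Lp.aestronglyMeasurable f)) (ae_of_all _ fun s => by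
      rw [norm_mul]
      exact mul_le_mul_of_nonneg_right (hC s) (norm_nonneg _))
  LinearMap.mkContinuous
    { toFun := fun f => (key f).toLp _
      map_add' := fun f g => by
        rw [← MemLp.toLp_add]
        apply MemLp.toLp_congr
        filter_upwards [Lp.coeFn_add f g] with s h
        rw [h]
        simp only [Pi.add_apply, mul_add]
      map_smul' := fun c f => by
        rw [← MemLp.toLp_const_smul]
        apply MemLp.toLp_congr
        filter_upwards [Lp.coeFn_smul c f] with s h
        simp only [h, Pi.smul_apply, smul_eq_mul, RingHom.id_apply]
        ring } C (fun f => by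
      apply Lp.norm_le_mul_norm_of_ae_le_mul
      filter_upwards [(key f).coeFn_toLp] with s h
      simp only [LinearMap.coe_mk, AddHom.coe_mk, h, norm_mul]
      exact mul_le_mul_of_nonneg_right (hC s) (norm_nonneg _))

theorem coeFn_mulOp (m : ℝ → ℂ) (hm : AEStronglyMeasurable m volume) (C : ℝ)
    (hC : ∀ s, ‖m s‖ ≤ C) (f : L2R) : mulOp m hm C hC f =ᵐ[volume] fun s => m s * f s :=
  MemLp.coeFn_toLp (((Lp.memLp f)).of_le_mul (c := C) (hm.mul (Lp.aestronglyMeasurable f))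
    (ae_of_all _ fun s => by
      rw [Pi.mul_apply, norm_mul]
      exact mul_le_mul_of_nonneg_right (hC s) (norm_nonneg _)))

/-- The orthogonal projection of `L²(ℝ)` onto `L²(0, ∞)`. -/
noncomputable def halfProj : L2R →L[ℂ] L2R :=
  mulOp (Set.indicator (Set.Ioi 0) 1)
    ((measurable_const.indicator measurableSet_Ioi).aestronglyMeasurable) 1 (fun s => by
      by_cases h : s ∈ Set.Ioi (0 : ℝ) <;> simp [h])

theorem coeFn_halfProj (f : L2R) :
    halfProj f =ᵐ[volume] (Set.Ioi (0 : ℝ)).indicator f := by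
  filter_upwards [coeFn_mulOp _ _ _ _ f] with s h
  rw [halfProj, h]
  by_cases h : s ∈ Set.Ioi (0 : ℝ) <;> simp [h]

theorem norm_halfProj_le (f : L2R) : ‖halfProj f‖ ≤ ‖f‖ := by
  apply Lp.norm_le_norm_of_ae_le
  filter_upwards [coeFn_halfProj f] with s h
  rw [h]
  by_cases h : s ∈ Set.Ioi (0 : ℝ) <;> simp [h]

theorem halfProj_halfProj (f : L2R) : halfProj (halfProj f) = halfProj f := by
  apply Lp.ext
  filter_upwards [coeFn_halfProj f, coeFn_halfProj (halfProj f)] with s h h'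
  rw [h']
  by_cases hs : s ∈ Set.Ioi (0 : ℝ) <;> simp [hs, h]

theorem inner_halfProj_left (f g : L2R) : ⟪halfProj f, g⟫ = ⟪f, halfProj g⟫ := by
  rw [L2.inner_def, L2.inner_def]
  apply integral_congr_ae
  filter_upwards [coeFn_halfProj f, coeFn_halfProj g] with s h h'
  rw [h, h']
  by_cases hs : s ∈ Set.Ioi (0 : ℝ) <;> simp [hs]

theorem inner_halfProj_halfProj (f g : L2R) : ⟪halfProj f, halfProj g⟫ = ⟪f, halfProj g⟫ := by
  rw [inner_halfProj_left, halfProj_halfProj]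

/-- A left translate restricted to `(0, ∞)` only sees the restriction to `(0, ∞)`. -/
theorem halfProj_shift_halfProj {τ : ℝ} (hτ : 0 ≤ τ) (f : L2R) :
    halfProj (shift τ (halfProj f)) = halfProj (shift τ f) := by
  apply Lp.ext
  filter_upwards [coeFn_halfProj (shift τ f), coeFn_halfProj (shift τ (halfProj f)),
    coeFn_shift τ f, coeFn_shift τ (halfProj f), ae_comp_add τ (coeFn_halfProj f)]
    with s h1 h2 h3 h4 h5
  rw [h1, h2]
  by_cases hs : s ∈ Set.Ioi (0 : ℝ)
  · have : s + τ ∈ Set.Ioi (0 : ℝ) := by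
      simp only [Set.mem_Ioi] at hs ⊢; linarith
    simp [hs, h3, h4, h5, this]
  · simp [hs]

theorem norm_sq_eq_integral (f : L2R) : ‖f‖ ^ 2 = ∫ s, ‖f s‖ ^ 2 := by
  have h : (‖f‖ : ℂ) ^ 2 = ⟪f, f⟫ := (inner_self_eq_norm_sq_to_K (𝕜 := ℂ) f).symm
  rw [L2.inner_def] at h
  have h2 : ∀ s, ⟪f s, f s⟫ = ((‖f s‖ ^ 2 : ℝ) : ℂ) := fun s => by
    rw [inner_self_eq_norm_sq_to_K]; norm_cast
  simp_rw [h2, integral_complex_ofReal] at h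
  exact_mod_cast h

theorem integrable_norm_sq (f : L2R) : Integrable fun s => ‖f s‖ ^ 2 :=
  (memLp_two_iff_integrable_sq_norm (Lp.aestronglyMeasurable f)).mp (Lp.memLp f)

theorem norm_sq_halfProj (f : L2R) : ‖halfProj f‖ ^ 2 = ∫ s in Set.Ioi 0, ‖f s‖ ^ 2 := by
  rw [norm_sq_eq_integral, ← integral_indicator measurableSet_Ioi]
  apply integral_congr_ae
  filter_upwards [coeFn_halfProj f] with s h
  rw [h]
  by_cases hs : s ∈ Set.Ioi (0 : ℝ) <;> simp [hs]

/-- Shifting to the left loses exactly the mass on `(0, h)`. -/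
theorem norm_sq_halfProj_shift {h : ℝ} (hh : 0 ≤ h) (f : L2R) :
    ‖halfProj (shift h f)‖ ^ 2 = ‖halfProj f‖ ^ 2 - ∫ s in (0 : ℝ)..h, ‖f s‖ ^ 2 := by
  have hi := integrable_norm_sq f
  have h1 : ∫ s in Set.Ioi 0, ‖shift h f s‖ ^ 2 = ∫ s in Set.Ioi h, ‖f s‖ ^ 2 := by
    have : ∫ s in Set.Ioi 0, ‖shift h f s‖ ^ 2 = ∫ s in Set.Ioi 0, ‖f (s + h)‖ ^ 2 :=
      setIntegral_congr_ae measurableSet_Ioi (by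
        filter_upwards [coeFn_shift h f] with s hs _
        rw [hs])
    rw [this, ← integral_indicator measurableSet_Ioi, ← integral_indicator measurableSet_Ioi,
      ← integral_add_right_eq_self ((Set.Ioi h).indicator _) h]
    congr 1 with s
    simp [Set.indicator_apply]
  rw [norm_sq_halfProj, norm_sq_halfProj, h1, intervalIntegral.integral_of_le hh,
    ← Set.Ioc_union_Ioi_eq_Ioi hh, setIntegral_union (Set.Ioc_disjoint_Ioi le_rfl)
      measurableSet_Ioi hi.integrableOn hi.integrableOn]
  ring

/-! ### The Fourier transform on `L¹ ∩ L²` -/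

theorem Lp_fourier_ae_eq {h : ℝ → ℂ} (h2 : MemLp h 2) (h1 : Integrable h) :
    (𝓕 (h2.toLp h) : L2R) =ᵐ[volume] 𝓕 h := by
  have hc : Continuous (𝓕 h : ℝ → ℂ) :=
    VectorFourier.fourierIntegral_continuous Real.continuous_fourierChar
      (by exact (innerSL ℝ).continuous₂) h1
  apply ae_eq_of_integral_contDiff_smul_eq
    ((Lp.memLp _).locallyIntegrable (by norm_num)) hc.locallyIntegrable
  intro g hg hgc
  let φ : SchwartzMap ℝ ℂ := HasCompactSupport.toSchwartzMap (f := fun x => (g x : ℂ))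
    (hgc.comp_left (g := fun x : ℝ => (x : ℂ)) (by simp)) (by
      exact Complex.ofRealCLM.contDiff.comp hg)
  have e1 := congrArg (fun T => T φ) (Lp.fourier_toTemperedDistribution_eq (h2.toLp h))
  simp only [TemperedDistribution.fourier_apply, Lp.toTemperedDistribution_apply] at e1
  have e2 : ∫ x, (𝓕 φ : SchwartzMap ℝ ℂ) x • (h2.toLp h) x = ∫ x, (𝓕 (φ : ℝ → ℂ)) x • h x := by
    apply integral_congr_ae
    filter_upwards [h2.coeFn_toLp] with x hx
    rw [hx, SchwartzMap.fourier_coe]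
  have e3 := VectorFourier.integral_fourierIntegral_smul_eq_flip (μ := volume) (ν := volume)
    (L := innerₗ ℝ) (f := (φ : ℝ → ℂ)) (g := h) Real.continuous_fourierChar
    (by exact (innerSL ℝ).continuous₂) φ.integrable h1
  rw [flip_innerₗ] at e3
  rw [e2] at e1
  have e4 := e1.symm.trans e3
  have e5 : ∀ (x : ℝ) (w : ℂ), g x • w = φ x • w := fun x w => by
    change _ = (g x : ℂ) • w
    simp
  simp_rw [e5]
  exact e4

theorem Lp_fourierInv_ae_eq {h : ℝ → ℂ} (h2 : MemLp h 2) (h1 : Integrable h) :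
    (𝓕⁻ (h2.toLp h) : L2R) =ᵐ[volume] 𝓕⁻ h := by
  have hc : Continuous (𝓕⁻ h : ℝ → ℂ) := by
    have : Continuous (𝓕 h : ℝ → ℂ) :=
      VectorFourier.fourierIntegral_continuous Real.continuous_fourierChar
        (by exact (innerSL ℝ).continuous₂) h1
    have h' := this.comp continuous_neg
    refine h'.congr fun x => ?_
    rw [Real.fourierInv_eq_fourier_neg]; rfl
  apply ae_eq_of_integral_contDiff_smul_eq
    ((Lp.memLp _).locallyIntegrable (by norm_num)) hc.locallyIntegrable
  intro g hg hgc
  let φ : SchwartzMap ℝ ℂ := HasCompactSupport.toSchwartzMap (f := fun x => (g x : ℂ))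
    (hgc.comp_left (g := fun x : ℝ => (x : ℂ)) (by simp)) (by
      exact Complex.ofRealCLM.contDiff.comp hg)
  have e1 := congrArg (fun T => T φ) (Lp.fourierInv_toTemperedDistribution_eq (h2.toLp h))
  simp only [TemperedDistribution.fourierInv_apply, Lp.toTemperedDistribution_apply] at e1
  have e2 : ∫ x, (𝓕⁻ φ : SchwartzMap ℝ ℂ) x • (h2.toLp h) x
      = ∫ x, (𝓕 (φ : ℝ → ℂ)) x • h (-x) := by
    refine Eq.trans ?_ (integral_neg_eq_self (fun x => (𝓕 (φ : ℝ → ℂ)) x • h (-x)) volume)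
    apply integral_congr_ae
    filter_upwards [h2.coeFn_toLp] with x hx
    rw [hx, SchwartzMap.fourierInv_coe, Real.fourierInv_eq_fourier_neg, neg_neg]
  have e3 := VectorFourier.integral_fourierIntegral_smul_eq_flip (μ := volume) (ν := volume)
    (L := innerₗ ℝ) (f := (φ : ℝ → ℂ)) (g := fun x => h (-x)) Real.continuous_fourierChar
    (by exact (innerSL ℝ).continuous₂) φ.integrable h1.comp_neg
  rw [flip_innerₗ] at e3
  rw [e2] at e1
  have e4 := e1.symm.trans e3
  have e5 : ∀ (x : ℝ) (w : ℂ), g x • w = φ x • w := fun x w => by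
    change _ = (g x : ℂ) • w
    simp
  simp_rw [e5]
  rw [e4]
  congr 1 with x
  rw [Real.fourierInv_eq_fourier_comp_neg]
  rfl

/-! ### Hankel operators -/

/-- `Γ` is the Hankel operator whose kernel is `conj f (s + t)`:
`(Γ γ)(s) = ∫ conj (f (s + t)) γ t dt`. -/
def IsHankel (f : L2R) (Γ : L2R →L[ℂ] L2R) : Prop :=
  ∀ γ : L2R, Γ γ =ᵐ[volume] fun s => ⟪shift s f, γ⟫

namespace IsHankel

variable {f g : L2R} {Γ : L2R →L[ℂ] L2R}

theorem shift_apply (h : IsHankel f Γ) (τ : ℝ) (γ : L2R) :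
    shift τ (Γ γ) = Γ (shift (-τ) γ) := by
  apply Lp.ext
  filter_upwards [coeFn_shift τ (Γ γ), ae_comp_add τ (h γ), h (shift (-τ) γ)] with s h1 h2 h3
  rw [h1, h2, h3, add_comm, ← shift_shift, inner_shift_left]

theorem norm_inner_le (s : ℝ) (γ : L2R) : ‖⟪shift s f, γ⟫‖ ≤ ‖f‖ * ‖γ‖ := by
  simpa [norm_shift] using norm_inner_le_norm (𝕜 := ℂ) (shift s f) γ

/-- The adjoint acts on integrable functions as a superposition of translates of the kernel. -/
theorem adjoint_apply_eq_integral (h : IsHankel f Γ) {β : L2R} (hβ : Integrable β) :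
    ContinuousLinearMap.adjoint Γ β = ∫ s, β s • shift s f := by
  have hi : Integrable fun s => β s • shift s f := by
    refine Integrable.mono' (hβ.norm.mul_const ‖f‖) ?_ ?_
    · exact (Lp.aestronglyMeasurable β).smul (continuous_shift f).aestronglyMeasurable
    · exact ae_of_all _ fun s => by rw [norm_smul, norm_shift]
  apply ext_inner_left ℂ
  intro γ
  rw [ContinuousLinearMap.adjoint_inner_right, ← integral_inner hi, L2.inner_def]
  apply integral_congr_ae
  filter_upwards [h γ] with s hs
  rw [hs, inner_smul_right, RCLike.inner_apply, inner_conj_symm]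

theorem norm_adjoint_le (h : IsHankel f Γ) {β : L2R} (hβ : Integrable β) {B : ℝ}
    (hB : ∫ s, ‖β s‖ ≤ B) : ‖ContinuousLinearMap.adjoint Γ β‖ ≤ B * ‖f‖ := by
  rw [h.adjoint_apply_eq_integral hβ]
  calc _ ≤ ∫ s, ‖β s • shift s f‖ := norm_integral_le_integral_norm _
    _ = (∫ s, ‖β s‖) * ‖f‖ := by
      simp_rw [norm_smul, norm_shift]
      rw [integral_mul_const]
    _ ≤ B * ‖f‖ := by gcongr

end IsHankel

/-- The mass that a left translation carries across the origin. -/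
noncomputable def crossL (h : ℝ) (a : L2R) : L2R := shift h (halfProj a) - halfProj (shift h a)

/-- The mass that a right translation carries across the origin. -/
noncomputable def crossR (h : ℝ) (a : L2R) : L2R :=
  halfProj (shift (-h) a) - shift (-h) (halfProj a)

theorem coeFn_crossL {h : ℝ} (hh : 0 ≤ h) (a : L2R) :
    crossL h a =ᵐ[volume] (Set.Ioc (-h) 0).indicator fun s => a (s + h) := by
  filter_upwards [Lp.coeFn_sub (shift h (halfProj a)) (halfProj (shift h a)),
    coeFn_shift h (halfProj a), coeFn_halfProj (shift h a), coeFn_shift h a,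
    ae_comp_add h (coeFn_halfProj a)] with s h1 h2 h3 h4 h5
  rw [crossL, h1, Pi.sub_apply, h2, h3, h5]
  simp only [Set.indicator_apply, Set.mem_Ioi, Set.mem_Ioc, h4]
  by_cases c1 : 0 < s
  · simp [c1, show 0 < s + h by linarith, not_le.mpr c1]
  · by_cases c2 : 0 < s + h
    · simp [c1, c2, show -h < s by linarith, not_lt.mp c1]
    · simp [c1, c2, show ¬ -h < s by linarith]

theorem coeFn_crossR {h : ℝ} (hh : 0 ≤ h) (a : L2R) :
    crossR h a =ᵐ[volume] (Set.Ioc 0 h).indicator fun s => a (s - h) := by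
  filter_upwards [Lp.coeFn_sub (halfProj (shift (-h) a)) (shift (-h) (halfProj a)),
    coeFn_shift (-h) (halfProj a), coeFn_halfProj (shift (-h) a), coeFn_shift (-h) a,
    ae_comp_add (-h) (coeFn_halfProj a)] with s h1 h2 h3 h4 h5
  rw [crossR, h1, Pi.sub_apply, h2, h3, h5]
  simp only [Set.indicator_apply, Set.mem_Ioi, Set.mem_Ioc, h4, ← sub_eq_add_neg]
  by_cases c1 : 0 < s
  · by_cases c2 : h < s
    · simp [c1, c2]
    · simp [c1, c2, not_lt.mp c2]
  · simp [c1, show ¬ h < s by linarith]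

/-- The continuous function `a` bounds and represents the crossing mass. -/
theorem integrable_crossL {h : ℝ} (hh : 0 ≤ h) (a : L2R) {a' : ℝ → ℂ} (ha : a =ᵐ[volume] a')
    (hc : Continuous a') :
    Integrable (crossL h a) ∧ ∫ s, ‖crossL h a s‖ = ∫ s in (0 : ℝ)..h, ‖a' s‖ := by
  have e : crossL h a =ᵐ[volume] (Set.Ioc (-h) 0).indicator fun s => a' (s + h) := by
    filter_upwards [coeFn_crossL hh a, ae_comp_add h ha] with s h1 h2
    rw [h1]; simp only [Set.indicator_apply, h2]
  have hc' : Continuous fun s => a' (s + h) := by fun_prop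
  constructor
  · rw [integrable_congr e, integrable_indicator_iff measurableSet_Ioc]
    exact hc'.integrableOn_Ioc
  · have e' : (fun s => ‖crossL h a s‖) =ᵐ[volume]
        (Set.Ioc (-h) 0).indicator fun s => ‖a' (s + h)‖ := by
      filter_upwards [e] with s hs
      rw [hs, norm_indicator_eq_indicator_norm]
    rw [integral_congr_ae e', integral_indicator measurableSet_Ioc,
      ← intervalIntegral.integral_of_le (by linarith),
      intervalIntegral.integral_comp_add_right (fun s => ‖a' s‖)]
    simp

theorem integrable_crossR {h : ℝ} (hh : 0 ≤ h) (a : L2R) {a' : ℝ → ℂ} (ha : a =ᵐ[volume] a')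
    (hc : Continuous a') :
    Integrable (crossR h a) ∧ ∫ s, ‖crossR h a s‖ = ∫ s in (-h : ℝ)..0, ‖a' s‖ := by
  have e : crossR h a =ᵐ[volume] (Set.Ioc 0 h).indicator fun s => a' (s - h) := by
    filter_upwards [coeFn_crossR hh a, ae_comp_add (-h) ha] with s h1 h2
    rw [h1]; simp only [Set.indicator_apply, sub_eq_add_neg, h2]
  have hc' : Continuous fun s => a' (s - h) := by fun_prop
  constructor
  · rw [integrable_congr e, integrable_indicator_iff measurableSet_Ioc]
    exact hc'.integrableOn_Ioc
  · have e' : (fun s => ‖crossR h a s‖) =ᵐ[volume]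
        (Set.Ioc 0 h).indicator fun s => ‖a' (s - h)‖ := by
      filter_upwards [e] with s hs
      rw [hs, norm_indicator_eq_indicator_norm]
    rw [integral_congr_ae e', integral_indicator measurableSet_Ioc,
      ← intervalIntegral.integral_of_le hh,
      intervalIntegral.integral_comp_sub_right (fun s => ‖a' s‖)]
    simp

/-- `Γ^* (crossL h a) = ∫₀ʰ a(s) • shift (s - h) f ds`. -/
theorem IsHankel.adjoint_crossL {f : L2R} {Γ : L2R →L[ℂ] L2R} (hΓ : IsHankel f Γ)
    {h : ℝ} (hh : 0 ≤ h) (a : L2R) {a' : ℝ → ℂ} (ha : a =ᵐ[volume] a') (hc : Continuous a') :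
    shift h (ContinuousLinearMap.adjoint Γ (crossL h a)) = ∫ s in (0 : ℝ)..h, a' s • shift s f := by
  rw [hΓ.adjoint_apply_eq_integral (integrable_crossL hh a ha hc).1]
  have e : (fun s => crossL h a s • shift s f) =ᵐ[volume]
      (Set.Ioc (-h) 0).indicator fun s => a' (s + h) • shift s f := by
    filter_upwards [coeFn_crossL hh a, ae_comp_add h ha] with s h1 h2
    rw [h1]
    by_cases hs : s ∈ Set.Ioc (-h) 0 <;> simp [hs, h2]
  rw [integral_congr_ae e, integral_indicator measurableSet_Ioc,
    ← intervalIntegral.integral_of_le (by linarith)]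
  have hcc : Continuous fun s => a' (s + h) • shift s f :=
    (hc.comp (continuous_add_const h)).smul (continuous_shift f)
  rw [← ContinuousLinearMap.intervalIntegral_comp_comm _ (hcc.intervalIntegrable _ _)]
  have : ∀ s, shift h (a' (s + h) • shift s f) = a' (s + h) • shift (s + h) f := fun s => by
    rw [map_smul, shift_shift, add_comm h s]
  simp_rw [this]
  rw [intervalIntegral.integral_comp_add_right (fun s => a' s • shift s f)]
  simp

/-- Averages of `a(s) • shift s f` over `(0, h)` converge. -/
theorem tendsto_average_shift (f : L2R) {a : ℝ → ℂ} (hc : Continuous a) :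
    Tendsto (fun h : ℝ => (h⁻¹ : ℂ) • ∫ s in (0 : ℝ)..h, a s • shift s f) (𝓝[>] 0)
      (𝓝 (a 0 • f)) := by
  have hcc : Continuous fun s => a s • shift s f := hc.smul (continuous_shift f)
  have := (hcc.integral_hasStrictDerivAt 0 0).hasDerivAt.hasDerivWithinAt (s := Set.Ioi 0)
  rw [hasDerivWithinAt_iff_tendsto_slope' (by simp)] at this
  rw [shift_zero] at this
  refine this.congr' (Eventually.of_forall fun h => ?_)
  rw [slope_def_module, intervalIntegral.integral_same, sub_zero, sub_zero]
  norm_cast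

/-! ### The Gelfand-Levitan-Marchenko system -/

/-- The kernels of a Gelfand-Levitan-Marchenko system with two components: square integrable
functions `f k`, their conjugates `fb k`, and the Hankel operators `Γ k` with kernel `f k (s + t)`;
in the case `ε = -1` the operator `Γ^*` is a strict contraction. -/
structure MarchenkoData where
  ε : ℝ
  m : ℝ
  f : Fin 2 → L2R
  fb : Fin 2 → L2R
  Γ : Fin 2 → L2R →L[ℂ] L2R
  hankel : ∀ k, IsHankel (fb k) (Γ k)
  hankel_adj : ∀ k, IsHankel (f k) (ContinuousLinearMap.adjoint (Γ k))
  bound : ∀ β : L2R, ∑ k, ‖ContinuousLinearMap.adjoint (Γ k) β‖ ^ 2 ≤ m * ‖β‖ ^ 2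
  sign : ε = 1 ∨ (ε = -1 ∧ m < 1)

namespace MarchenkoData

variable (K : MarchenkoData)

/-- The adjoint Hankel operators. -/
noncomputable def Γs (k : Fin 2) : L2R →L[ℂ] L2R := ContinuousLinearMap.adjoint (K.Γ k)

theorem shift_Γ (k : Fin 2) (τ : ℝ) (γ : L2R) :
    shift τ (K.Γ k γ) = K.Γ k (shift (-τ) γ) := (K.hankel k).shift_apply τ γ

theorem shift_Γs (k : Fin 2) (τ : ℝ) (γ : L2R) :
    shift τ (K.Γs k γ) = K.Γs k (shift (-τ) γ) := (K.hankel_adj k).shift_apply τ γ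

theorem adjoint_Γs (k : Fin 2) : ContinuousLinearMap.adjoint (K.Γs k) = K.Γ k :=
  ContinuousLinearMap.adjoint_adjoint _

/-- `A = -(φ + ∑ U_x Γ_k P D_k)`, `D_k = ψ_k + ε U_x Γ_k^* P A`. -/
structure Sol (x : ℝ) (φ : L2R) (ψ : Fin 2 → L2R) (A : L2R) (D : Fin 2 → L2R) : Prop where
  left : A = -(φ + ∑ k, shift x (K.Γ k (halfProj (D k))))
  right : ∀ k, D k = ψ k + (K.ε : ℂ) • shift x (K.Γs k (halfProj A))

variable {K}

namespace Sol

variable {x : ℝ} {φ φ' A A' : L2R} {ψ ψ' D D' : Fin 2 → L2R}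

theorem sub (h : K.Sol x φ ψ A D) (h' : K.Sol x φ' ψ' A' D') :
    K.Sol x (φ - φ') (ψ - ψ') (A - A') (D - D') := by
  constructor
  · simp only [Pi.sub_apply, map_sub, Finset.sum_sub_distrib]
    nth_rewrite 1 [h.left, h'.left]
    abel
  · intro k
    simp only [Pi.sub_apply, map_sub, smul_sub]
    nth_rewrite 1 [h.right k, h'.right k]
    abel

theorem add (h : K.Sol x φ ψ A D) (h' : K.Sol x φ' ψ' A' D') :
    K.Sol x (φ + φ') (ψ + ψ') (A + A') (D + D') := by
  constructor
  · simp only [Pi.add_apply, map_add, Finset.sum_add_distrib]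
    nth_rewrite 1 [h.left, h'.left]
    abel
  · intro k
    simp only [Pi.add_apply, map_add, smul_add]
    nth_rewrite 1 [h.right k, h'.right k]
    abel

theorem smul (h : K.Sol x φ ψ A D) (c : ℂ) : K.Sol x (c • φ) (c • ψ) (c • A) (c • D) := by
  constructor
  · simp only [Pi.smul_apply, map_smul, ← Finset.smul_sum, ← smul_add, ← smul_neg]
    nth_rewrite 1 [h.left]
    rfl
  · intro k
    simp only [Pi.smul_apply, map_smul]
    nth_rewrite 1 [h.right k]
    rw [smul_add, smul_comm c]

end Sol

variable (K)

/-- The coercivity constant of the system. -/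
noncomputable def κ : ℝ := if K.ε = 1 then 1 else 1 - K.m

theorem κ_pos : 0 < K.κ := by
  unfold κ
  rcases K.sign with h | ⟨h, hm⟩
  · simp [h]
  · rw [if_neg (by rw [h]; norm_num)]
    linarith

theorem eps_sq : K.ε * K.ε = 1 := by
  rcases K.sign with h | ⟨h, hm⟩ <;> simp [h]

theorem abs_eps : |K.ε| = 1 := by
  rcases K.sign with h | ⟨h, hm⟩ <;> simp [h]

/-- The truncated operator `P U_x Γ_k^* P`. -/
noncomputable def trunc (x : ℝ) (k : Fin 2) (a : L2R) : L2R :=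
  halfProj (shift x (K.Γs k (halfProj a)))

theorem norm_trunc_le (x : ℝ) (k : Fin 2) (a : L2R) : ‖K.trunc x k a‖ ≤ ‖K.Γs k‖ * ‖a‖ := by
  calc _ ≤ ‖K.Γs k (halfProj a)‖ := by
        rw [trunc]; exact (norm_halfProj_le _).trans (norm_shift _ _).le
    _ ≤ ‖K.Γs k‖ * ‖halfProj a‖ := ContinuousLinearMap.le_opNorm _ _
    _ ≤ _ := by gcongr; exact norm_halfProj_le _

theorem coercive (x : ℝ) (a : L2R) :
    K.κ * ‖a‖ ^ 2 ≤ ‖a‖ ^ 2 + K.ε * ∑ k, ‖K.trunc x k a‖ ^ 2 := by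
  have h0 : 0 ≤ ∑ k, ‖K.trunc x k a‖ ^ 2 := Finset.sum_nonneg fun _ _ => by positivity
  unfold κ
  rcases K.sign with h | ⟨h, hm⟩
  · rw [if_pos h, h]; linarith
  · rw [if_neg (by rw [h]; norm_num), h]
    have h1 : ∑ k, ‖K.trunc x k a‖ ^ 2 ≤ ∑ k, ‖K.Γs k (halfProj a)‖ ^ 2 := by
      gcongr with k
      exact (norm_halfProj_le _).trans (norm_shift _ _).le
    have h2 := K.bound (halfProj a)
    have h3 : ‖halfProj a‖ ^ 2 ≤ ‖a‖ ^ 2 := by gcongr; exact norm_halfProj_le a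
    have h4 : 0 ≤ K.m * ‖halfProj a‖ ^ 2 := le_trans (Finset.sum_nonneg fun _ _ => by positivity) h2
    have h5 : K.m * ‖halfProj a‖ ^ 2 ≤ K.m * ‖a‖ ^ 2 := by
      by_cases hm0 : 0 ≤ K.m
      · gcongr
      · have : ‖halfProj a‖ ^ 2 = 0 := by nlinarith [sq_nonneg ‖halfProj a‖]
        have h6 := K.bound a
        rw [this, mul_zero]
        exact le_trans (Finset.sum_nonneg fun _ _ => by positivity) h6
    have h7 : ∑ k, ‖K.trunc x k a‖ ^ 2 ≤ K.m * ‖a‖ ^ 2 := h1.trans (h2.trans h5)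
    linarith

theorem inner_trunc (x : ℝ) (k : Fin 2) (a b : L2R) :
    ⟪K.trunc x k a, b⟫ = ⟪a, halfProj (shift x (K.Γ k (halfProj b)))⟫ := by
  rw [trunc, inner_halfProj_left, inner_shift_left, Γs, ContinuousLinearMap.adjoint_inner_left,
    inner_halfProj_left, K.shift_Γ]

/-- A constant for the a-priori estimate. -/
noncomputable def aprioriC : ℝ :=
  (1 + ∑ k, ‖K.Γs k‖) + (1 + ∑ k, ‖K.Γs k‖) * ((1 + ∑ k, ‖K.Γs k‖) / K.κ)

theorem aprioriC_pos : 0 < K.aprioriC := by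
  have := K.κ_pos
  have : 0 ≤ ∑ k, ‖K.Γs k‖ := Finset.sum_nonneg fun _ _ => norm_nonneg _
  unfold aprioriC
  positivity

variable {K}

theorem Sol.halfProj_right {x : ℝ} {φ A : L2R} {ψ D : Fin 2 → L2R} (h : K.Sol x φ ψ A D)
    (k : Fin 2) :
    halfProj (D k) = halfProj (ψ k) + (K.ε : ℂ) • K.trunc x k (halfProj A) := by
  rw [h.right k, map_add, map_smul, trunc, halfProj_halfProj]

theorem Sol.energy {x : ℝ} {φ A : L2R} {ψ D : Fin 2 → L2R} (h : K.Sol x φ ψ A D) :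
    ((‖halfProj A‖ ^ 2 + K.ε * ∑ k, ‖K.trunc x k (halfProj A)‖ ^ 2 : ℝ) : ℂ)
      = -(⟪halfProj A, φ⟫ + ∑ k, ⟪K.trunc x k (halfProj A), ψ k⟫) := by
  have e1 : ⟪halfProj A, halfProj A⟫ = ((‖halfProj A‖ ^ 2 : ℝ) : ℂ) := by
    rw [inner_self_eq_norm_sq_to_K]; norm_cast
  have e2 : ⟪halfProj A, halfProj A⟫
      = -(⟪halfProj A, φ⟫ + ∑ k, ⟪halfProj A, halfProj (shift x (K.Γ k (halfProj (D k))))⟫) := by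
    nth_rewrite 2 [h.left]
    simp only [map_neg, map_add, map_sum, inner_neg_right, inner_add_right, inner_sum]
    congr 2
    rw [← inner_halfProj_left, halfProj_halfProj]
  have e3 : ∀ k, ⟪halfProj A, halfProj (shift x (K.Γ k (halfProj (D k))))⟫
      = ⟪K.trunc x k (halfProj A), ψ k⟫
        + K.ε * ((‖K.trunc x k (halfProj A)‖ ^ 2 : ℝ) : ℂ) := by
    intro k
    rw [← inner_trunc]
    have : halfProj (K.trunc x k (halfProj A)) = K.trunc x k (halfProj A) := by
      rw [trunc, halfProj_halfProj]
    rw [← this, inner_halfProj_left, h.halfProj_right k, inner_add_right,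
      ← inner_halfProj_left, this, inner_smul_right, inner_self_eq_norm_sq_to_K]
    push_cast
    rfl
  rw [e1] at e2
  simp_rw [e3] at e2
  push_cast at e2 ⊢
  rw [e2, Finset.sum_add_distrib, Finset.mul_sum]
  ring

theorem Sol.norm_le {x : ℝ} {φ A : L2R} {ψ D : Fin 2 → L2R} (h : K.Sol x φ ψ A D) :
    ‖halfProj A‖ ≤ K.aprioriC * (‖φ‖ + ∑ k, ‖ψ k‖) ∧
    ∀ k, ‖halfProj (D k)‖ ≤ K.aprioriC * (‖φ‖ + ∑ k, ‖ψ k‖) := by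
  have hκ := K.κ_pos
  set G := 1 + ∑ k, ‖K.Γs k‖ with hG
  have hGk : ∀ k, ‖K.Γs k‖ ≤ G := fun k => by
    have := Finset.single_le_sum (f := fun k => ‖K.Γs k‖) (fun i _ => norm_nonneg _)
      (Finset.mem_univ k)
    linarith
  have hG1 : 1 ≤ G := by
    have : 0 ≤ ∑ k, ‖K.Γs k‖ := Finset.sum_nonneg fun _ _ => norm_nonneg _
    linarith
  set N := ‖φ‖ + ∑ k, ‖ψ k‖ with hN
  have hψk : ∀ k, ‖ψ k‖ ≤ N := fun k => by
    have := Finset.single_le_sum (f := fun k => ‖ψ k‖) (fun i _ => norm_nonneg _)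
      (Finset.mem_univ k)
    linarith [norm_nonneg φ]
  have hN0 : 0 ≤ N := (norm_nonneg _).trans (hψk 0)
  have h1 : K.κ * ‖halfProj A‖ ^ 2 ≤ (G * N) * ‖halfProj A‖ := by
    refine (K.coercive x (halfProj A)).trans ?_
    have h2 := congrArg norm h.energy
    rw [norm_neg, Complex.norm_real] at h2
    refine (le_abs_self _).trans (h2.le.trans ?_)
    calc _ ≤ ‖⟪halfProj A, φ⟫‖ + ∑ k, ‖⟪K.trunc x k (halfProj A), ψ k⟫‖ :=
          (norm_add_le _ _).trans (by gcongr; exact norm_sum_le _ _)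
      _ ≤ ‖halfProj A‖ * (G * ‖φ‖) + ∑ k, ‖halfProj A‖ * (G * ‖ψ k‖) := by
          gcongr with k
          · refine (norm_inner_le_norm _ _).trans ?_
            gcongr
            exact le_mul_of_one_le_left (norm_nonneg _) hG1
          · refine (norm_inner_le_norm _ _).trans ?_
            rw [← mul_assoc, mul_comm ‖halfProj A‖ G]
            gcongr
            exact (K.norm_trunc_le x k _).trans (by gcongr; exact hGk k)
      _ = _ := by rw [← Finset.mul_sum, ← Finset.mul_sum]; ring
  have h3 : ‖halfProj A‖ ≤ G / K.κ * N := by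
    rw [div_mul_eq_mul_div, le_div_iff₀ hκ]
    rcases (norm_nonneg (halfProj A)).eq_or_lt with h0 | h0
    · rw [← h0]; nlinarith
    · nlinarith
  have hq : 0 ≤ G / K.κ := by positivity
  constructor
  · refine h3.trans ?_
    gcongr
    change _ ≤ G + G * (G / K.κ)
    nlinarith
  · intro k
    rw [h.halfProj_right k]
    calc _ ≤ ‖ψ k‖ + G * ‖halfProj A‖ := by
          refine (norm_add_le _ _).trans ?_
          gcongr
          · exact norm_halfProj_le _
          · rw [norm_smul, Complex.norm_real, Real.norm_eq_abs, K.abs_eps, one_mul]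
            exact (K.norm_trunc_le x k _).trans (by gcongr; exact hGk k)
      _ ≤ G * N + G * (G / K.κ * N) := by
          gcongr
          nlinarith [hψk k]
      _ = _ := by
          change _ = (G + G * (G / K.κ)) * N
          ring

variable (K)

theorem exists_sol (x : ℝ) (φ : L2R) (ψ : Fin 2 → L2R) : ∃ A D, K.Sol x φ ψ A D := by
  let T : Fin 2 → L2R →L[ℂ] L2R := fun k => halfProj ∘L shift x ∘L K.Γs k ∘L halfProj
  have hT : ∀ k a, T k a = K.trunc x k a := fun k a => rfl
  have hT' : ∀ k a, ContinuousLinearMap.adjoint (T k) a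
      = halfProj (shift x (K.Γ k (halfProj a))) := fun k a => by
    apply ext_inner_left ℂ
    intro b
    rw [ContinuousLinearMap.adjoint_inner_right, hT, inner_trunc]
  let B : L2R →L[ℂ] L2R :=
    1 + (K.ε : ℂ) • ∑ k, ContinuousLinearMap.adjoint (T k) ∘L T k
  have hB : ∀ a, B a = a + (K.ε : ℂ) • ∑ k, halfProj (shift x (K.Γ k (halfProj (K.trunc x k a)))) :=
    fun a => by
      simp only [B, _root_.add_apply, one_apply_eq_self,
        _root_.smul_apply, _root_.sum_apply,
        ContinuousLinearMap.comp_apply, hT', hT]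
  have hU : IsUnit B := by
    apply ContinuousLinearMap.isUnit_of_forall_le_norm_inner_map B (c := K.κ.toNNReal)
      (Real.toNNReal_pos.mpr K.κ_pos)
    intro a
    have e : ⟪B a, a⟫ = ((‖a‖ ^ 2 + K.ε * ∑ k, ‖K.trunc x k a‖ ^ 2 : ℝ) : ℂ) := by
      simp only [B, _root_.add_apply, one_apply_eq_self,
        _root_.smul_apply, _root_.sum_apply,
        ContinuousLinearMap.comp_apply, inner_add_left, inner_smul_left, sum_inner,
        ContinuousLinearMap.adjoint_inner_left, hT, inner_self_eq_norm_sq_to_K]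
      simp
    rw [e, Complex.norm_real, Real.coe_toNNReal _ K.κ_pos.le, mul_comm]
    exact (K.coercive x a).trans (le_abs_self _)
  obtain ⟨α, hα⟩ := (ContinuousLinearMap.isUnit_iff_bijective.mp hU).surjective
    (-(halfProj φ + ∑ k, halfProj (shift x (K.Γ k (halfProj (ψ k))))))
  let D : Fin 2 → L2R := fun k => ψ k + (K.ε : ℂ) • shift x (K.Γs k (halfProj α))
  let A : L2R := -(φ + ∑ k, shift x (K.Γ k (halfProj (D k))))
  have hPA : halfProj A = α := by
    have e : halfProj A = -(halfProj φ + ∑ k, halfProj (shift x (K.Γ k (halfProj (ψ k)))))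
        - (K.ε : ℂ) • ∑ k, halfProj (shift x (K.Γ k (halfProj (K.trunc x k α)))) := by
      have e' : ∀ k, halfProj (D k) = halfProj (ψ k) + (K.ε : ℂ) • halfProj (K.trunc x k α) := by
        intro k
        simp only [D, map_add, map_smul, trunc, halfProj_halfProj]
      simp only [A, map_neg, map_add, map_sum, e', map_smul, Finset.sum_add_distrib,
        Finset.smul_sum]
      abel
    rw [e, ← hα, hB]
    abel
  refine ⟨A, D, rfl, fun k => ?_⟩
  have : halfProj α = halfProj A := by rw [← hPA, halfProj_halfProj]
  simp only [D, this]

variable {K}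

/-- Translates of a solution solve the system with modified data. -/
theorem Sol.shift_sub {x : ℝ} {φ A : L2R} {ψ D : Fin 2 → L2R} (hs : K.Sol x φ ψ A D) (h : ℝ) :
    K.Sol x (shift h φ - φ - ∑ k, shift x (K.Γ k (crossR h (D k))))
      (fun k => shift (-h) (ψ k) - ψ k + (K.ε : ℂ) • shift x (K.Γs k (crossL h A)))
      (shift h A - A) (fun k => shift (-h) (D k) - D k) := by
  constructor
  · nth_rewrite 1 2 [hs.left]
    simp only [crossR, map_neg, map_add, map_sum, map_sub, Finset.sum_sub_distrib]
    have : ∀ k, shift h (shift x (K.Γ k (halfProj (D k))))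
        = shift x (K.Γ k (shift (-h) (halfProj (D k)))) := fun k => by
      rw [shift_shift, add_comm, ← shift_shift, K.shift_Γ]
    simp only [this]
    abel
  · intro k
    have : shift (-h) (shift x (K.Γs k (halfProj A)))
        = shift x (K.Γs k (shift h (halfProj A))) := by
      rw [shift_shift, add_comm, ← shift_shift, K.shift_Γs, neg_neg]
    nth_rewrite 1 2 [hs.right k]
    simp only [crossL, map_add, map_sub, map_smul, this, smul_sub]
    abel

end MarchenkoData

namespace MarchenkoData

variable {K : MarchenkoData}

/-- Reciprocity between two solutions of the system. -/
theorem Sol.reciprocity {x : ℝ} {φ φ' A A' : L2R} {ψ ψ' D D' : Fin 2 → L2R}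
    (h : K.Sol x φ ψ A D) (h' : K.Sol x φ' ψ' A' D') :
    ⟪φ, halfProj A'⟫ - K.ε * ∑ k, ⟪halfProj (D k), ψ' k⟫
      = ⟪halfProj A, φ'⟫ - K.ε * ∑ k, ⟪ψ k, halfProj (D' k)⟫ := by
  have key : ∀ {φ φ' A A' : L2R} {ψ ψ' D D' : Fin 2 → L2R},
      K.Sol x φ ψ A D → K.Sol x φ' ψ' A' D' →
      ⟪φ, halfProj A'⟫ - K.ε * ∑ k, ⟪halfProj (D k), ψ' k⟫
        = -(⟪halfProj A, halfProj A'⟫ + K.ε * ∑ k, ⟪halfProj (D k), halfProj (D' k)⟫) := by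
    intro φ φ' A A' ψ ψ' D D' h h'
    have e1 : ⟪halfProj A, halfProj A'⟫
        = -(⟪φ, halfProj A'⟫ + ∑ k, ⟪halfProj (D k), K.trunc x k (halfProj A')⟫) := by
      rw [inner_halfProj_halfProj]
      nth_rewrite 1 [h.left]
      simp only [inner_neg_left, inner_add_left, sum_inner]
      congr 3 with k
      rw [← inner_halfProj_halfProj, ← inner_conj_symm, ← inner_conj_symm (halfProj (D k)),
        inner_trunc, halfProj_halfProj]
    have e2 : ∀ k, ⟪halfProj (D k), K.trunc x k (halfProj A')⟫
        = K.ε * (⟪halfProj (D k), halfProj (D' k)⟫ - ⟪halfProj (D k), ψ' k⟫) := by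
      intro k
      rw [h'.halfProj_right k, inner_add_right, inner_smul_right,
        inner_halfProj_halfProj, ← inner_halfProj_left, add_sub_cancel_left, ← mul_assoc,
        ← Complex.ofReal_mul, K.eps_sq, Complex.ofReal_one, one_mul]
    simp_rw [e2] at e1
    rw [e1, ← Finset.mul_sum, Finset.sum_sub_distrib]
    ring
  have h1 := key h h'
  have h2 := congrArg conj (key h' h)
  simp only [map_sub, map_mul, map_neg, map_add, map_sum, inner_conj_symm, Complex.conj_ofReal]
    at h2
  rw [h1, ← h2]

/-- A solution at `x`, seen as a solution at `y`. -/
theorem Sol.transfer {x : ℝ} {φ A : L2R} {ψ D : Fin 2 → L2R} (h : K.Sol x φ ψ A D) (y : ℝ) :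
    K.Sol y (φ + ∑ k, (shift x (K.Γ k (halfProj (D k))) - shift y (K.Γ k (halfProj (D k)))))
      (fun k => ψ k + (K.ε : ℂ) • (shift x (K.Γs k (halfProj A)) - shift y (K.Γs k (halfProj A))))
      A D := by
  constructor
  · nth_rewrite 1 [h.left]
    rw [Finset.sum_sub_distrib]
    abel
  · intro k
    nth_rewrite 1 [h.right k]
    rw [smul_sub]
    abel

/-- Solutions whose data tend to zero tend to zero. -/
theorem tendsto_zero_of_data {α : Type*} {l : Filter α} {x : α → ℝ} {φ A : α → L2R}
    {ψ D : α → Fin 2 → L2R} (h : ∀ᶠ t in l, K.Sol (x t) (φ t) (ψ t) (A t) (D t))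
    (hφ : Tendsto φ l (𝓝 0)) (hψ : ∀ k, Tendsto (fun t => ψ t k) l (𝓝 0)) :
    Tendsto (fun t => halfProj (A t)) l (𝓝 0) ∧
      ∀ k, Tendsto (fun t => halfProj (D t k)) l (𝓝 0) := by
  have hN : Tendsto (fun t => K.aprioriC * (‖φ t‖ + ∑ k, ‖ψ t k‖)) l (𝓝 0) := by
    have : Tendsto (fun t => K.aprioriC * (‖φ t‖ + ∑ k, ‖ψ t k‖)) l
        (𝓝 (K.aprioriC * (‖(0 : L2R)‖ + ∑ k : Fin 2, ‖(0 : L2R)‖))) :=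
      (hφ.norm.add (tendsto_finsetSum _ fun k _ => (hψ k).norm)).const_mul _
    simpa using this
  constructor
  · exact squeeze_zero_norm' (h.mono fun t ht => ht.norm_le.1) hN
  · exact fun k => squeeze_zero_norm' (h.mono fun t ht => ht.norm_le.2 k) hN

end MarchenkoData

/-- Marchenko data with continuous bounded kernels, together with Lipschitz bounds for the
translates of the kernels in `L²`. -/
structure KernelData extends MarchenkoData where
  F : Fin 2 → ℝ → ℂ
  cont : ∀ k, Continuous (F k)
  f_ae : ∀ k, f k =ᵐ[volume] F k
  fb_ae : ∀ k, fb k =ᵐ[volume] fun s => conj (F k s)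
  C : ℝ
  bdd : ∀ k y, ‖F k y‖ ≤ C
  norm_f : ∀ k, ‖f k‖ ≤ C
  norm_fb : ∀ k, ‖fb k‖ ≤ C
  lip_f : ∀ k h, ‖shift h (f k) - f k‖ ≤ C * |h|
  lip_fb : ∀ k h, ‖shift h (fb k) - fb k‖ ≤ C * |h|

namespace KernelData

variable (K : KernelData)

theorem C_nonneg : 0 ≤ K.C := (norm_nonneg _).trans (K.norm_f 0)

/-- The data of the row of the Riemann-Hilbert problem with value `(a, c)` at infinity. -/
noncomputable def dataL (c : Fin 2 → ℂ) (x : ℝ) : L2R := ∑ k, c k • shift x (K.f k)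

/-- The data of the row of the Riemann-Hilbert problem with value `(a, c)` at infinity. -/
noncomputable def dataR (a : ℂ) (x : ℝ) (k : Fin 2) : L2R := (K.ε * a) • shift x (K.fb k)

/-- The solution for the row `(a, c)`. -/
noncomputable def A (a : ℂ) (c : Fin 2 → ℂ) (x : ℝ) : L2R :=
  (K.exists_sol x (K.dataL c x) (K.dataR a x)).choose

/-- The solution for the row `(a, c)`. -/
noncomputable def D (a : ℂ) (c : Fin 2 → ℂ) (x : ℝ) : Fin 2 → L2R :=
  (K.exists_sol x (K.dataL c x) (K.dataR a x)).choose_spec.choose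

theorem sol (a : ℂ) (c : Fin 2 → ℂ) (x : ℝ) :
    K.Sol x (K.dataL c x) (K.dataR a x) (K.A a c x) (K.D a c x) :=
  (K.exists_sol x (K.dataL c x) (K.dataR a x)).choose_spec.choose_spec

/-- The continuous representative of `A`. -/
noncomputable def Aval (a : ℂ) (c : Fin 2 → ℂ) (x s : ℝ) : ℂ :=
  -(∑ k, c k * K.F k (x + s) + ∑ k, ⟪shift (x + s) (K.fb k), halfProj (K.D a c x k)⟫)

/-- The continuous representative of `D k`. -/
noncomputable def Dval (a : ℂ) (c : Fin 2 → ℂ) (x : ℝ) (k : Fin 2) (s : ℝ) : ℂ :=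
  K.ε * (a * conj (K.F k (x + s)) + ⟪shift (x + s) (K.f k), halfProj (K.A a c x)⟫)

theorem ae_sum {ι : Type*} {s : Finset ι} (f : ι → L2R) :
    (∑ i ∈ s, f i : L2R) =ᵐ[volume] fun t => ∑ i ∈ s, f i t := by
  filter_upwards [Lp.coeFn_finsetSum s f] with t ht
  rw [ht, Finset.sum_apply]

theorem A_ae (a : ℂ) (c : Fin 2 → ℂ) (x : ℝ) : K.A a c x =ᵐ[volume] K.Aval a c x := by
  have h1 : ∀ k, (c k • shift x (K.f k) : L2R) =ᵐ[volume] fun s => c k * K.F k (x + s) := fun k => by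
    filter_upwards [Lp.coeFn_smul (c k) (shift x (K.f k)), coeFn_shift x (K.f k),
      ae_comp_add x (K.f_ae k)] with s h1 h2 h3
    rw [h1, Pi.smul_apply, h2, h3, smul_eq_mul, add_comm]
  have h2 : ∀ k, (shift x (K.Γ k (halfProj (K.D a c x k))) : L2R) =ᵐ[volume]
      fun s => ⟪shift (x + s) (K.fb k), halfProj (K.D a c x k)⟫ := fun k => by
    filter_upwards [coeFn_shift x (K.Γ k (halfProj (K.D a c x k))),
      ae_comp_add x (K.hankel k (halfProj (K.D a c x k)))] with s h1 h2
    rw [h1, h2, add_comm]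
  rw [(K.sol a c x).left, dataL]
  filter_upwards [Lp.coeFn_neg (∑ k, c k • shift x (K.f k)
      + ∑ k, shift x (K.Γ k (halfProj (K.D a c x k)))),
    Lp.coeFn_add (∑ k, c k • shift x (K.f k)) (∑ k, shift x (K.Γ k (halfProj (K.D a c x k)))),
    ae_sum (s := Finset.univ) fun k => c k • shift x (K.f k),
    ae_sum (s := Finset.univ) fun k => shift x (K.Γ k (halfProj (K.D a c x k))),
    ae_all_iff.mpr h1, ae_all_iff.mpr h2] with s e1 e2 e3 e4 e5 e6
  rw [e1, Pi.neg_apply, e2, Pi.add_apply, e3, e4]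
  simp_rw [e5, e6]
  rfl

theorem D_ae (a : ℂ) (c : Fin 2 → ℂ) (x : ℝ) (k : Fin 2) :
    K.D a c x k =ᵐ[volume] K.Dval a c x k := by
  rw [(K.sol a c x).right k, dataR]
  filter_upwards [Lp.coeFn_add ((K.ε * a) • shift x (K.fb k))
      ((K.ε : ℂ) • shift x (K.Γs k (halfProj (K.A a c x)))),
    Lp.coeFn_smul (K.ε * a) (shift x (K.fb k)), coeFn_shift x (K.fb k),
    ae_comp_add x (K.fb_ae k),
    Lp.coeFn_smul (K.ε : ℂ) (shift x (K.Γs k (halfProj (K.A a c x)))),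
    coeFn_shift x (K.Γs k (halfProj (K.A a c x))),
    ae_comp_add x (K.hankel_adj k (halfProj (K.A a c x)))] with s e1 e2 e3 e4 e5 e6 e7
  rw [e1, Pi.add_apply, e2, Pi.smul_apply, e3, e4, e5, Pi.smul_apply, e6, MarchenkoData.Γs, e7,
    Dval, add_comm x s]
  simp only [smul_eq_mul]
  ring

theorem norm_data_le (a : ℂ) (c : Fin 2 → ℂ) (x : ℝ) :
    ‖K.dataL c x‖ + ∑ k, ‖K.dataR a x k‖ ≤ (‖a‖ + ‖a‖ + ∑ k, ‖c k‖) * K.C := by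
  have h1 : ‖K.dataL c x‖ ≤ (∑ k, ‖c k‖) * K.C := by
    rw [dataL, Finset.sum_mul]
    refine (norm_sum_le _ _).trans (Finset.sum_le_sum fun k _ => ?_)
    rw [norm_smul, norm_shift]
    gcongr
    exact K.norm_f k
  have h2 : ∀ k, ‖K.dataR a x k‖ ≤ ‖a‖ * K.C := fun k => by
    rw [dataR, norm_smul, norm_shift, norm_mul, Complex.norm_real, Real.norm_eq_abs, K.abs_eps,
      one_mul]
    gcongr
    exact K.norm_fb k
  rw [Fin.sum_univ_two]
  linarith [h2 0, h2 1]

/-- A uniform bound for the solution of the row `(a, c)`. -/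
noncomputable def rowC (a : ℂ) (c : Fin 2 → ℂ) : ℝ :=
  K.aprioriC * ((‖a‖ + ‖a‖ + ∑ k, ‖c k‖) * K.C)

theorem norm_A_le (a : ℂ) (c : Fin 2 → ℂ) (x : ℝ) : ‖halfProj (K.A a c x)‖ ≤ K.rowC a c :=
  (K.sol a c x).norm_le.1.trans
    (mul_le_mul_of_nonneg_left (K.norm_data_le a c x) K.aprioriC_pos.le)

theorem norm_D_le (a : ℂ) (c : Fin 2 → ℂ) (x : ℝ) (k : Fin 2) :
    ‖halfProj (K.D a c x k)‖ ≤ K.rowC a c :=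
  ((K.sol a c x).norm_le.2 k).trans
    (mul_le_mul_of_nonneg_left (K.norm_data_le a c x) K.aprioriC_pos.le)

theorem rowC_nonneg (a : ℂ) (c : Fin 2 → ℂ) : 0 ≤ K.rowC a c :=
  (norm_nonneg _).trans (K.norm_A_le a c 0)

theorem norm_inner_fb_le (k : Fin 2) (s : ℝ) (γ : L2R) :
    ‖⟪shift s (K.fb k), γ⟫‖ ≤ K.C * ‖γ‖ :=
  (IsHankel.norm_inner_le s γ).trans (mul_le_mul_of_nonneg_right (K.norm_fb k) (norm_nonneg _))

theorem norm_inner_f_le (k : Fin 2) (s : ℝ) (γ : L2R) :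
    ‖⟪shift s (K.f k), γ⟫‖ ≤ K.C * ‖γ‖ :=
  (IsHankel.norm_inner_le s γ).trans (mul_le_mul_of_nonneg_right (K.norm_f k) (norm_nonneg _))

/-- A uniform pointwise bound for the solution of the row `(a, c)`. -/
noncomputable def valC (a : ℂ) (c : Fin 2 → ℂ) : ℝ :=
  (‖a‖ + ∑ k, ‖c k‖) * K.C + 2 * (K.C * K.rowC a c)

theorem valC_nonneg (a : ℂ) (c : Fin 2 → ℂ) : 0 ≤ K.valC a c := by
  have := K.C_nonneg
  have := K.rowC_nonneg a c
  have : 0 ≤ ∑ k, ‖c k‖ := Finset.sum_nonneg fun _ _ => norm_nonneg _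
  unfold valC
  positivity

theorem norm_Aval_le (a : ℂ) (c : Fin 2 → ℂ) (x s : ℝ) : ‖K.Aval a c x s‖ ≤ K.valC a c := by
  have hC := K.C_nonneg
  have h1 : ‖∑ k, c k * K.F k (x + s)‖ ≤ (∑ k, ‖c k‖) * K.C := by
    rw [Finset.sum_mul]
    refine (norm_sum_le _ _).trans (Finset.sum_le_sum fun k _ => ?_)
    rw [norm_mul]
    gcongr
    exact K.bdd k _
  have h2 : ‖∑ k, ⟪shift (x + s) (K.fb k), halfProj (K.D a c x k)⟫‖ ≤ 2 * (K.C * K.rowC a c) := by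
    rw [Fin.sum_univ_two]
    have : ∀ k, ‖⟪shift (x + s) (K.fb k), halfProj (K.D a c x k)⟫‖ ≤ K.C * K.rowC a c :=
      fun k => (K.norm_inner_fb_le k _ _).trans (by gcongr; exact K.norm_D_le a c x k)
    linarith [norm_add_le (⟪shift (x + s) (K.fb 0), halfProj (K.D a c x 0)⟫ : ℂ)
      ⟪shift (x + s) (K.fb 1), halfProj (K.D a c x 1)⟫, this 0, this 1]
  rw [Aval, norm_neg]
  refine (norm_add_le _ _).trans ?_
  unfold valC
  have : 0 ≤ ‖a‖ * K.C := by positivity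
  linarith

theorem norm_Dval_le (a : ℂ) (c : Fin 2 → ℂ) (x : ℝ) (k : Fin 2) (s : ℝ) :
    ‖K.Dval a c x k s‖ ≤ K.valC a c := by
  have hC := K.C_nonneg
  have hr := K.rowC_nonneg a c
  have h0 : 0 ≤ (∑ k, ‖c k‖) * K.C := mul_nonneg (Finset.sum_nonneg fun _ _ => norm_nonneg _) hC
  rw [Dval, norm_mul, Complex.norm_real, Real.norm_eq_abs, K.abs_eps, one_mul]
  have h1 : ‖a * conj (K.F k (x + s))‖ ≤ ‖a‖ * K.C := by
    rw [norm_mul, RCLike.norm_conj]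
    gcongr
    exact K.bdd k _
  have h2 : ‖⟪shift (x + s) (K.f k), halfProj (K.A a c x)⟫‖ ≤ K.C * K.rowC a c :=
    (K.norm_inner_f_le k _ _).trans (by gcongr; exact K.norm_A_le a c x)
  refine (norm_add_le _ _).trans ?_
  unfold valC
  nlinarith [mul_nonneg hC hr]

/-- The solution depends continuously on `x`. -/
theorem continuous_sol (a : ℂ) (c : Fin 2 → ℂ) :
    Continuous (fun x => halfProj (K.A a c x)) ∧
      ∀ k, Continuous (fun x => halfProj (K.D a c x k)) := by
  have key : ∀ x, Tendsto (fun y => halfProj (K.A a c y - K.A a c x)) (𝓝 x) (𝓝 0) ∧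
      ∀ k, Tendsto (fun y => halfProj ((K.D a c y - K.D a c x) k)) (𝓝 x) (𝓝 0) := by
    intro x
    have hs : ∀ g : L2R, Tendsto (fun y => shift y g) (𝓝 x) (𝓝 (shift x g)) :=
      fun g => (continuous_shift g).tendsto x
    refine MarchenkoData.tendsto_zero_of_data (x := fun y => y)
      (Eventually.of_forall fun y => (K.sol a c y).sub ((K.sol a c x).transfer y)) ?_ ?_
    · have h1 : Tendsto (fun y => K.dataL c y) (𝓝 x) (𝓝 (K.dataL c x)) :=
        tendsto_finsetSum _ fun k _ => (hs _).const_smul _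
      have h2 : Tendsto (fun y => ∑ k, (shift x (K.Γ k (halfProj (K.D a c x k)))
          - shift y (K.Γ k (halfProj (K.D a c x k))))) (𝓝 x) (𝓝 (∑ k : Fin 2, (0 : L2R))) :=
        tendsto_finsetSum _ fun k _ => by
          simpa using (hs (K.Γ k (halfProj (K.D a c x k)))).const_sub
            (shift x (K.Γ k (halfProj (K.D a c x k))))
      have := h1.sub (h2.const_add (K.dataL c x))
      simpa using this
    · intro k
      have h1 : Tendsto (fun y => K.dataR a y k) (𝓝 x) (𝓝 (K.dataR a x k)) :=
        (hs _).const_smul _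
      have h2 : Tendsto (fun y => (K.ε : ℂ) • (shift x (K.Γs k (halfProj (K.A a c x)))
          - shift y (K.Γs k (halfProj (K.A a c x))))) (𝓝 x) (𝓝 ((K.ε : ℂ) • 0)) :=
        Tendsto.const_smul (by
          simpa using (hs (K.Γs k (halfProj (K.A a c x)))).const_sub
            (shift x (K.Γs k (halfProj (K.A a c x))))) _
      have := h1.sub (h2.const_add (K.dataR a x k))
      simpa using this
  constructor
  · rw [continuous_iff_continuousAt]
    intro x
    rw [ContinuousAt, tendsto_iff_norm_sub_tendsto_zero]
    have := (key x).1.norm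
    simpa using this
  · intro k
    rw [continuous_iff_continuousAt]
    intro x
    rw [ContinuousAt, tendsto_iff_norm_sub_tendsto_zero]
    have := ((key x).2 k).norm
    simpa using this

theorem continuous_shift_comp {X : Type*} [TopologicalSpace X] {τ : X → ℝ} {g : X → L2R}
    (hτ : Continuous τ) (hg : Continuous g) : Continuous fun p => shift (τ p) (g p) :=
  continuous_iff_continuousAt.mpr fun p => (hτ.tendsto p).shift (hg.tendsto p)

theorem continuous_Aval_uncurry (a : ℂ) (c : Fin 2 → ℂ) :
    Continuous fun p : ℝ × ℝ => K.Aval a c p.1 p.2 := by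
  unfold Aval
  refine Continuous.neg (Continuous.add ?_ ?_)
  · refine continuous_finsetSum _ fun k _ => continuous_const.mul ((K.cont k).comp ?_)
    fun_prop
  · refine continuous_finsetSum _ fun k _ => Continuous.inner ?_ ?_
    · exact continuous_shift_comp (by fun_prop) continuous_const
    · exact ((K.continuous_sol a c).2 k).comp continuous_fst

theorem continuous_Dval_uncurry (a : ℂ) (c : Fin 2 → ℂ) (k : Fin 2) :
    Continuous fun p : ℝ × ℝ => K.Dval a c p.1 k p.2 := by
  unfold Dval
  refine continuous_const.mul (Continuous.add ?_ ?_)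
  · refine continuous_const.mul (continuous_conj.comp ((K.cont k).comp ?_))
    fun_prop
  · refine Continuous.inner ?_ ?_
    · exact continuous_shift_comp (by fun_prop) continuous_const
    · exact ((K.continuous_sol a c).1).comp continuous_fst

theorem continuous_Aval (a : ℂ) (c : Fin 2 → ℂ) (x : ℝ) : Continuous (K.Aval a c x) := by
  have h : Continuous ((fun p : ℝ × ℝ => K.Aval a c p.1 p.2) ∘ fun s => (x, s)) :=
    (K.continuous_Aval_uncurry a c).comp (Continuous.prodMk_right x)
  exact h

theorem continuous_Dval (a : ℂ) (c : Fin 2 → ℂ) (x : ℝ) (k : Fin 2) :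
    Continuous (K.Dval a c x k) := by
  have h : Continuous ((fun p : ℝ × ℝ => K.Dval a c p.1 k p.2) ∘ fun s => (x, s)) :=
    (K.continuous_Dval_uncurry a c k).comp (Continuous.prodMk_right x)
  exact h

/-! #### Dependence on `x` -/

/-- Increments in `x` of a row with value `(0, c)` at infinity. -/
theorem sol_increment_right (c : Fin 2 → ℂ) (x h : ℝ) :
    K.Sol (x + h) 0 (fun k => -(K.ε : ℂ) • shift (x + h) (K.Γs k (crossL h (K.A 0 c x))))
      (K.A 0 c (x + h) - shift h (K.A 0 c x)) (K.D 0 c (x + h) - K.D 0 c x) := by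
  have h1 := K.sol 0 c (x + h)
  have h0 := K.sol 0 c x
  constructor
  · nth_rewrite 1 [h1.left]
    nth_rewrite 1 [h0.left]
    have e : shift h (K.dataL c x) = K.dataL c (x + h) := by
      simp only [dataL, map_sum, map_smul, shift_shift, add_comm]
    simp only [map_neg, map_add, e, map_sum, Pi.sub_apply, map_sub, Finset.sum_sub_distrib,
      shift_shift, add_comm h x]
    abel
  · intro k
    rw [Pi.sub_apply, h1.right k, h0.right k]
    have e : shift x (K.Γs k (halfProj (K.A 0 c x)))
        = shift (x + h) (K.Γs k (shift h (halfProj (K.A 0 c x)))) := by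
      rw [← shift_shift, K.shift_Γs k h, shift_shift, neg_add_cancel, shift_zero]
    simp only [dataR, mul_zero, zero_smul, e, crossL, map_sub, smul_sub, neg_smul]
    abel

/-- Increments in `x` of a row with value `(a, 0)` at infinity. -/
theorem sol_increment_left (a : ℂ) (x h : ℝ) :
    K.Sol (x + h) (-∑ k, shift (x + h) (K.Γ k (crossL h (K.D a 0 x k)))) 0
      (K.A a 0 (x + h) - K.A a 0 x) (fun k => K.D a 0 (x + h) k - shift h (K.D a 0 x k)) := by
  have h1 := K.sol a 0 (x + h)
  have h0 := K.sol a 0 x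
  constructor
  · nth_rewrite 1 [h1.left]
    nth_rewrite 1 [h0.left]
    have e : ∀ k, shift x (K.Γ k (halfProj (K.D a 0 x k)))
        = shift (x + h) (K.Γ k (shift h (halfProj (K.D a 0 x k)))) := fun k => by
      rw [← shift_shift, K.shift_Γ k h, shift_shift, neg_add_cancel, shift_zero]
    simp only [dataL, Pi.zero_apply, zero_smul, Finset.sum_const_zero, e, crossL, map_sub,
      Finset.sum_sub_distrib]
    abel
  · intro k
    rw [h1.right k, h0.right k]
    have e : shift h (K.dataR a x k) = K.dataR a (x + h) k := by
      simp only [dataR, map_smul, shift_shift, add_comm]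
    simp only [map_add, map_smul, e, map_sub, smul_sub, shift_shift, add_comm h x, Pi.zero_apply]
    abel

end KernelData

namespace KernelData

variable (K : KernelData)

theorem hankel_Γs (k : Fin 2) : IsHankel (K.f k) (K.Γs k) := K.hankel_adj k

theorem norm_Γs_crossL_le (k : Fin 2) (y : ℝ) {h : ℝ} (hh : 0 ≤ h) {g : L2R} {g' : ℝ → ℂ}
    (hg : g =ᵐ[volume] g') (hc : Continuous g') :
    ‖shift y (K.Γs k (crossL h g))‖ ≤ (∫ s in (0 : ℝ)..h, ‖g' s‖) * K.C := by
  obtain ⟨h1, h2⟩ := integrable_crossL hh g hg hc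
  rw [norm_shift]
  refine ((K.hankel k).norm_adjoint_le h1 h2.le).trans ?_
  gcongr
  · exact intervalIntegral.integral_nonneg hh fun _ _ => norm_nonneg _
  · exact K.norm_fb k

theorem norm_Γ_crossR_le (k : Fin 2) (y : ℝ) {h : ℝ} (hh : 0 ≤ h) {g : L2R} {g' : ℝ → ℂ}
    (hg : g =ᵐ[volume] g') (hc : Continuous g') :
    ‖shift y (K.Γ k (crossR h g))‖ ≤ (∫ s in (-h : ℝ)..0, ‖g' s‖) * K.C := by
  obtain ⟨h1, h2⟩ := integrable_crossR hh g hg hc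
  rw [norm_shift, ← K.adjoint_Γs]
  refine ((K.hankel_Γs k).norm_adjoint_le h1 h2.le).trans ?_
  gcongr
  · exact intervalIntegral.integral_nonneg (by linarith) fun _ _ => norm_nonneg _
  · exact K.norm_f k

theorem tendsto_Γs_crossL (k : Fin 2) (x : ℝ) {g : L2R} {g' : ℝ → ℂ}
    (hg : g =ᵐ[volume] g') (hc : Continuous g') :
    Tendsto (fun h : ℝ => (h⁻¹ : ℂ) • shift (x + h) (K.Γs k (crossL h g))) (𝓝[>] 0)
      (𝓝 (g' 0 • shift x (K.fb k))) := by
  have h1 := ((shift x).continuous.tendsto _).comp (tendsto_average_shift (K.fb k) hc)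
  rw [map_smul] at h1
  refine h1.congr' ?_
  filter_upwards [self_mem_nhdsWithin] with h hh
  rw [Function.comp_apply, ← (K.hankel k).adjoint_crossL (le_of_lt hh) g hg hc, map_smul,
    shift_shift]
  rfl

theorem tendsto_Γ_crossL (k : Fin 2) (x : ℝ) {g : L2R} {g' : ℝ → ℂ}
    (hg : g =ᵐ[volume] g') (hc : Continuous g') :
    Tendsto (fun h : ℝ => (h⁻¹ : ℂ) • shift (x + h) (K.Γ k (crossL h g))) (𝓝[>] 0)
      (𝓝 (g' 0 • shift x (K.f k))) := by
  have h1 := ((shift x).continuous.tendsto _).comp (tendsto_average_shift (K.f k) hc)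
  rw [map_smul] at h1
  refine h1.congr' ?_
  filter_upwards [self_mem_nhdsWithin] with h hh
  rw [Function.comp_apply, ← (K.hankel_Γs k).adjoint_crossL (le_of_lt hh) g hg hc, map_smul,
    shift_shift, K.adjoint_Γs]

theorem tendsto_add_nhdsGT (x : ℝ) : Tendsto (fun h : ℝ => x + h) (𝓝[>] 0) (𝓝 x) := by
  have : Tendsto (fun h : ℝ => x + h) (𝓝 0) (𝓝 (x + 0)) := tendsto_const_nhds.add tendsto_id
  rw [add_zero] at this
  exact this.mono_left nhdsWithin_le_nhds

theorem tendsto_shift_add (x : ℝ) (g : L2R) :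
    Tendsto (fun h : ℝ => shift (x + h) g) (𝓝[>] 0) (𝓝 (shift x g)) :=
  ((continuous_shift g).tendsto x).comp (tendsto_add_nhdsGT x)

/-- First order behaviour in `x` of the rows with value `(0, c)` at infinity. -/
theorem tendsto_increment_right (c : Fin 2 → ℂ) (x : ℝ) :
    Tendsto (fun h : ℝ => halfProj ((h⁻¹ : ℂ) • (K.A 0 c (x + h) - shift h (K.A 0 c x))
      - (-K.Aval 0 c x 0) • K.A 1 0 (x + h))) (𝓝[>] 0) (𝓝 0) ∧
    ∀ k, Tendsto (fun h : ℝ => halfProj (((h⁻¹ : ℂ) • (K.D 0 c (x + h) - K.D 0 c x)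
      - (-K.Aval 0 c x 0) • K.D 1 0 (x + h)) k)) (𝓝[>] 0) (𝓝 0) := by
  refine MarchenkoData.tendsto_zero_of_data (Eventually.of_forall fun h =>
    ((K.sol_increment_right c x h).smul (h⁻¹ : ℂ)).sub
      ((K.sol 1 0 (x + h)).smul (-K.Aval 0 c x 0))) ?_ ?_
  · simp [dataL]
  · intro k
    have h1 := (K.tendsto_Γs_crossL k x (K.A_ae 0 c x) (K.continuous_Aval 0 c x)).const_smul
      (-(K.ε : ℂ))
    have h2 := (tendsto_shift_add x (K.fb k)).const_smul (-K.Aval 0 c x 0 * K.ε)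
    have h3 := h1.sub h2
    have e : -(K.ε : ℂ) • K.Aval 0 c x 0 • shift x (K.fb k)
        - (-K.Aval 0 c x 0 * K.ε) • shift x (K.fb k) = 0 := by
      rw [smul_smul, ← sub_smul]
      ring_nf
      simp
    rw [e] at h3
    refine h3.congr fun h => ?_
    simp only [Pi.sub_apply, Pi.smul_apply, dataR, mul_one, smul_smul]
    ring_nf

/-- First order behaviour in `x` of the row with value `(1, 0)` at infinity. -/
theorem tendsto_increment_left (x : ℝ) :
    Tendsto (fun h : ℝ => halfProj ((h⁻¹ : ℂ) • (K.A 1 0 (x + h) - K.A 1 0 x)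
      + K.A 0 (fun k => K.Dval 1 0 x k 0) (x + h))) (𝓝[>] 0) (𝓝 0) := by
  refine (MarchenkoData.tendsto_zero_of_data (Eventually.of_forall fun h =>
    ((K.sol_increment_left 1 x h).smul (h⁻¹ : ℂ)).add
      (K.sol 0 (fun k => K.Dval 1 0 x k 0) (x + h))) ?_ ?_).1
  · have h1 : Tendsto (fun h : ℝ => ∑ k, (K.Dval 1 0 x k 0 • shift (x + h) (K.f k)
        - (h⁻¹ : ℂ) • shift (x + h) (K.Γ k (crossL h (K.D 1 0 x k))))) (𝓝[>] 0)
        (𝓝 (∑ k, (K.Dval 1 0 x k 0 • shift x (K.f k) - K.Dval 1 0 x k 0 • shift x (K.f k)))) :=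
      tendsto_finsetSum _ fun k _ => ((tendsto_shift_add x (K.f k)).const_smul _).sub
        (K.tendsto_Γ_crossL k x (K.D_ae 1 0 x k) (K.continuous_Dval 1 0 x k))
    simp only [sub_self, Finset.sum_const_zero] at h1
    refine h1.congr fun h => ?_
    rw [Finset.sum_sub_distrib, dataL, smul_neg, Finset.smul_sum]
    abel
  · intro k
    simp [dataR]

/-- The rows depend linearly on their value at infinity. -/
theorem halfProj_A_zero_row (c : Fin 2 → ℂ) (x : ℝ) :
    halfProj (K.A 0 c x) = ∑ k, c k • halfProj (K.A 0 (Pi.single k 1) x) := by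
  have h := (K.sol 0 c x).sub (((K.sol 0 (Pi.single 0 1) x).smul (c 0)).add
    ((K.sol 0 (Pi.single 1 1) x).smul (c 1)))
  have e := h.norm_le.1
  have e1 : K.dataL c x - (c 0 • K.dataL (Pi.single 0 1) x + c 1 • K.dataL (Pi.single 1 1) x)
      = 0 := by
    simp [dataL, Fin.sum_univ_two]
  have e2 : ∀ y k, K.dataR 0 y k = 0 := fun y k => by simp [dataR]
  rw [e1] at e
  simp only [Pi.sub_apply, Pi.add_apply, Pi.smul_apply, e2, smul_zero, add_zero, sub_zero,
    norm_zero, Finset.sum_const_zero, mul_zero, norm_le_zero_iff] at e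
  rw [map_sub, map_add, map_smul, map_smul, sub_eq_zero] at e
  rw [e, Fin.sum_univ_two]

/-- The components of the potential. -/
noncomputable def pot (k : Fin 2) (x : ℝ) : ℂ := -K.Aval 0 (Pi.single k 1) x 0

theorem Dval_zero (k : Fin 2) (x : ℝ) : K.Dval 1 0 x k 0 = K.ε * conj (K.pot k x) := by
  have h := (K.sol 0 (Pi.single k 1) x).reciprocity (K.sol 1 0 x)
  have e1 : K.dataL 0 x = 0 := by simp [dataL]
  have e2 : ∀ j, K.dataR 0 x j = 0 := fun j => by simp [dataR]
  have e3 : K.dataL (Pi.single k 1) x = shift x (K.f k) := by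
    simp [dataL, Pi.single_apply]
  have e4 : (K.ε : ℂ) * K.ε = 1 := by exact_mod_cast K.eps_sq
  rw [e1, e3] at h
  simp only [e2, inner_zero_left, inner_zero_right, Finset.sum_const_zero, mul_zero, sub_zero] at h
  simp only [dataR, mul_one, inner_smul_right, ← Finset.mul_sum] at h
  rw [← mul_assoc, e4, one_mul, sub_eq_zero] at h
  simp only [Dval, pot, Aval, one_mul, add_zero, neg_neg, map_add, map_sum, map_mul,
    inner_conj_symm]
  rw [h]
  simp [Pi.single_apply]

/-! #### The energy identity -/

/-- A finite linear combination of translations. -/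
noncomputable def transl {n : ℕ} (w : Fin n → ℂ) (τ : Fin n → ℝ) : L2R →L[ℂ] L2R :=
  ∑ i, w i • shift (τ i)

theorem transl_apply {n : ℕ} (w : Fin n → ℂ) (τ : Fin n → ℝ) (g : L2R) :
    transl w τ g = ∑ i, w i • shift (τ i) g := by
  simp [transl]

theorem transl_shift {n : ℕ} (w : Fin n → ℂ) (τ : Fin n → ℝ) (h : ℝ) (g : L2R) :
    transl w τ (shift h g) = shift h (transl w τ g) := by
  simp only [transl_apply, map_sum, map_smul, shift_shift, add_comm]

theorem halfProj_transl_halfProj {n : ℕ} (w : Fin n → ℂ) {τ : Fin n → ℝ} (hτ : ∀ i, 0 ≤ τ i)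
    (g : L2R) : halfProj (transl w τ (halfProj g)) = halfProj (transl w τ g) := by
  simp only [transl_apply, map_sum, map_smul, halfProj_shift_halfProj (hτ _)]

theorem transl_ae {n : ℕ} (w : Fin n → ℂ) (τ : Fin n → ℝ) {g : L2R} {g' : ℝ → ℂ}
    (hg : g =ᵐ[volume] g') : transl w τ g =ᵐ[volume] fun s => ∑ i, w i * g' (s + τ i) := by
  rw [transl_apply]
  have : ∀ i, (w i • shift (τ i) g : L2R) =ᵐ[volume] fun s => w i * g' (s + τ i) := fun i => by
    filter_upwards [Lp.coeFn_smul (w i) (shift (τ i) g), coeFn_shift (τ i) g,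
      ae_comp_add (τ i) hg] with s e1 e2 e3
    rw [e1, Pi.smul_apply, e2, e3, smul_eq_mul]
  filter_upwards [ae_sum (s := Finset.univ) fun i => w i • shift (τ i) g, ae_all_iff.mpr this]
    with s e1 e2
  rw [e1]
  simp_rw [e2]

variable {n : ℕ} (w : Fin n → ℂ) (τ : Fin n → ℝ)

/-- The energy of a combination of translates of the rows. -/
noncomputable def energy (x : ℝ) : ℝ :=
  ‖halfProj (transl w τ (K.A 1 0 x))‖ ^ 2
    + K.ε * ∑ k, ‖halfProj (transl w τ (K.A 0 (Pi.single k 1) x))‖ ^ 2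

/-- The density of the energy. -/
noncomputable def density (k : Fin 2) (x : ℝ) : ℂ :=
  ∑ i, w i * K.Aval 0 (Pi.single k 1) x (τ i)

theorem continuous_Aval_left (a : ℂ) (c : Fin 2 → ℂ) (s : ℝ) :
    Continuous fun x => K.Aval a c x s := by
  have h : Continuous ((fun p : ℝ × ℝ => K.Aval a c p.1 p.2) ∘ fun x => (x, s)) :=
    (K.continuous_Aval_uncurry a c).comp (Continuous.prodMk_left s)
  exact h

theorem continuous_density (k : Fin 2) : Continuous (K.density w τ k) :=
  continuous_finsetSum _ fun _ _ => continuous_const.mul (K.continuous_Aval_left _ _ _)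

variable {τ}

theorem continuous_transl_A (hτ : ∀ i, 0 ≤ τ i) (a : ℂ) (c : Fin 2 → ℂ) :
    Continuous fun x => halfProj (transl w τ (K.A a c x)) := by
  simp_rw [← halfProj_transl_halfProj w hτ (K.A _ _ _)]
  exact halfProj.continuous.comp ((transl w τ).continuous.comp (K.continuous_sol a c).1)

theorem continuous_energy (hτ : ∀ i, 0 ≤ τ i) : Continuous (K.energy w τ) := by
  unfold energy
  refine ((K.continuous_transl_A w hτ _ _).norm.pow 2).add (continuous_const.mul ?_)
  exact continuous_finsetSum _ fun k _ => (K.continuous_transl_A w hτ _ _).norm.pow 2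

theorem norm_sq_sub_norm_sq (a b : L2R) : ‖a‖ ^ 2 - ‖b‖ ^ 2 = (⟪a - b, a + b⟫ : ℂ).re := by
  have h1 : (⟪a, a⟫ : ℂ).re = ‖a‖ ^ 2 := by rw [inner_self_eq_norm_sq_to_K]; norm_cast
  have h2 : (⟪b, b⟫ : ℂ).re = ‖b‖ ^ 2 := by rw [inner_self_eq_norm_sq_to_K]; norm_cast
  have h3 : (⟪b, a⟫ : ℂ).re = (⟪a, b⟫ : ℂ).re := by rw [← inner_conj_symm, Complex.conj_re]
  rw [inner_sub_left, inner_add_right, inner_add_right]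
  simp only [Complex.sub_re, Complex.add_re, h1, h2, h3]
  ring

/-- The slope of the squared norm along a difference quotient. -/
theorem tendsto_slope_norm_sq {a b : ℝ → L2R} {a₀ d : L2R} (ha : Tendsto a (𝓝[>] 0) (𝓝 a₀))
    (hd : Tendsto (fun h : ℝ => (h⁻¹ : ℂ) • (a h - b h)) (𝓝[>] 0) (𝓝 d)) :
    Tendsto (fun h => h⁻¹ * (‖a h‖ ^ 2 - ‖b h‖ ^ 2)) (𝓝[>] 0) (𝓝 (2 * (⟪d, a₀⟫ : ℂ).re)) := by
  have h0 : Tendsto (fun h : ℝ => (h : ℂ)) (𝓝[>] 0) (𝓝 ((0 : ℝ) : ℂ)) :=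
    (Complex.continuous_ofReal.tendsto 0).mono_left nhdsWithin_le_nhds
  have hs : Tendsto (fun h : ℝ => a h + b h) (𝓝[>] 0) (𝓝 (a₀ + a₀)) := by
    have h1 := (ha.add ha).sub (h0.smul hd)
    rw [Complex.ofReal_zero, zero_smul, sub_zero] at h1
    refine h1.congr' ?_
    filter_upwards [self_mem_nhdsWithin] with h hh
    have : (h : ℂ) ≠ 0 := by exact_mod_cast (ne_of_gt hh)
    rw [smul_smul, mul_inv_cancel₀ this, one_smul]
    abel
  have h2 := (Complex.continuous_re.tendsto _).comp (hd.inner hs (𝕜 := ℂ))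
  have e : (⟪d, a₀ + a₀⟫ : ℂ).re = 2 * (⟪d, a₀⟫ : ℂ).re := by
    rw [inner_add_right, Complex.add_re]; ring
  rw [e] at h2
  refine h2.congr fun h => ?_
  rw [norm_sq_sub_norm_sq, Function.comp_apply, inner_smul_left, ← Complex.ofReal_inv,
    Complex.conj_ofReal, Complex.re_ofReal_mul]

theorem hasDerivWithinAt_energy (hτ : ∀ i, 0 ≤ τ i) (x : ℝ) :
    HasDerivWithinAt (K.energy w τ) (-K.ε * ∑ k, ‖K.density w τ k x‖ ^ 2) (Set.Ioi x) x := by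
  set Q := transl w τ with hQ
  set a : ℝ → L2R := fun y => halfProj (Q (K.A 1 0 y)) with ha
  set b : Fin 2 → ℝ → L2R := fun k y => halfProj (Q (K.A 0 (Pi.single k 1) y)) with hb
  have hac : Tendsto (fun h => a (x + h)) (𝓝[>] 0) (𝓝 (a x)) :=
    ((K.continuous_transl_A w hτ 1 0).tendsto x).comp (tendsto_add_nhdsGT x)
  have hbc : ∀ k, Tendsto (fun h => b k (x + h)) (𝓝[>] 0) (𝓝 (b k x)) := fun k =>
    ((K.continuous_transl_A w hτ 0 (Pi.single k 1)).tendsto x).comp (tendsto_add_nhdsGT x)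
  have hPQ : Continuous fun g => halfProj (Q g) := halfProj.continuous.comp Q.continuous
  have h1 : Tendsto (fun h : ℝ => (h⁻¹ : ℂ) • (a (x + h) - a x)) (𝓝[>] 0)
      (𝓝 (-∑ k, K.Dval 1 0 x k 0 • b k x)) := by
    have e := (hPQ.tendsto _).comp (K.tendsto_increment_left x)
    have e' : Tendsto (fun h : ℝ => ∑ k, K.Dval 1 0 x k 0 • b k (x + h)) (𝓝[>] 0)
        (𝓝 (∑ k, K.Dval 1 0 x k 0 • b k x)) := tendsto_finsetSum _ fun k _ => (hbc k).const_smul _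
    have e'' := e.sub e'
    simp only [map_zero, zero_sub] at e''
    refine e''.congr fun h => ?_
    rw [Function.comp_apply, halfProj_transl_halfProj w hτ]
    have e3 : halfProj (Q (K.A 0 (fun k => K.Dval 1 0 x k 0) (x + h)))
        = ∑ k, K.Dval 1 0 x k 0 • b k (x + h) := by
      rw [hQ, ← halfProj_transl_halfProj w hτ, K.halfProj_A_zero_row]
      simp only [map_sum, map_smul, halfProj_transl_halfProj w hτ, hb, hQ]
    rw [map_add, map_add, e3, map_smul, map_smul, map_sub, map_sub]
    simp only [ha]
    abel
  have h2 : ∀ k, Tendsto (fun h : ℝ => (h⁻¹ : ℂ) • (b k (x + h)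
      - halfProj (Q (shift h (K.A 0 (Pi.single k 1) x))))) (𝓝[>] 0)
      (𝓝 (K.pot k x • a x)) := fun k => by
    have e := (hPQ.tendsto _).comp (K.tendsto_increment_right (Pi.single k 1) x).1
    have e'' := e.add (hac.const_smul (K.pot k x))
    simp only [map_zero, zero_add] at e''
    refine e''.congr fun h => ?_
    rw [Function.comp_apply, halfProj_transl_halfProj w hτ]
    simp only [map_sub, map_smul, ha, hb, pot]
    abel
  have s1 := tendsto_slope_norm_sq (b := fun _ => a x) hac h1
  have s2 : ∀ k, Tendsto (fun h => h⁻¹ * (‖b k (x + h)‖ ^ 2 - ‖b k x‖ ^ 2)) (𝓝[>] 0)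
      (𝓝 (2 * (⟪K.pot k x • a x, b k x⟫ : ℂ).re - ‖K.density w τ k x‖ ^ 2)) := fun k => by
    have e := tendsto_slope_norm_sq (hbc k) (h2 k)
    set q : ℝ → ℂ := fun s => ∑ i, w i * K.Aval 0 (Pi.single k 1) x (s + τ i) with hq
    have hqc : Continuous q := continuous_finsetSum _ fun i _ =>
      continuous_const.mul ((K.continuous_Aval _ _ _).comp (continuous_add_const _))
    have e2 : Tendsto (fun h : ℝ => h⁻¹ * ∫ s in (0 : ℝ)..h, ‖q s‖ ^ 2) (𝓝[>] 0)
        (𝓝 (‖q 0‖ ^ 2)) := by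
      have := ((hqc.norm.pow 2).integral_hasStrictDerivAt 0 0).hasDerivAt.hasDerivWithinAt
        (s := Set.Ioi 0)
      rw [hasDerivWithinAt_iff_tendsto_slope' (by simp)] at this
      refine this.congr fun h => ?_
      simp [slope_def_module]
    have e3 : q 0 = K.density w τ k x := by simp [hq, density]
    rw [e3] at e2
    refine (e.sub e2).congr' ?_
    filter_upwards [self_mem_nhdsWithin] with h hh
    rw [hQ, transl_shift, norm_sq_halfProj_shift (le_of_lt hh), ← hQ]
    have e4 : ∫ s in (0 : ℝ)..h, ‖Q (K.A 0 (Pi.single k 1) x) s‖ ^ 2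
        = ∫ s in (0 : ℝ)..h, ‖q s‖ ^ 2 := by
      apply intervalIntegral.integral_congr_ae
      filter_upwards [transl_ae w τ (K.A_ae 0 (Pi.single k 1) x)] with s hs _
      rw [hQ, hs]
    rw [e4]
    ring
  have s3 := s1.add ((tendsto_finsetSum Finset.univ fun k _ => s2 k).const_mul K.ε)
  rw [hasDerivWithinAt_iff_tendsto_slope' (by simp)]
  have hm : Tendsto (fun y => y - x) (𝓝[>] x) (𝓝[>] 0) := by
    refine tendsto_nhdsWithin_iff.mpr ⟨?_, ?_⟩
    · have : Tendsto (fun y => y - x) (𝓝 x) (𝓝 (x - x)) := tendsto_id.sub_const x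
      rw [sub_self] at this
      exact this.mono_left nhdsWithin_le_nhds
    · filter_upwards [self_mem_nhdsWithin] with y hy
      exact sub_pos.mpr (Set.mem_Ioi.mp hy)
  have s4 := s3.comp hm
  have ev : 2 * (⟪-∑ k, K.Dval 1 0 x k 0 • b k x, a x⟫ : ℂ).re
      + K.ε * ∑ k, (2 * (⟪K.pot k x • a x, b k x⟫ : ℂ).re - ‖K.density w τ k x‖ ^ 2)
      = -K.ε * ∑ k, ‖K.density w τ k x‖ ^ 2 := by
    have e1 : ∀ k, (⟪K.Dval 1 0 x k 0 • b k x, a x⟫ : ℂ).re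
        = K.ε * (⟪K.pot k x • a x, b k x⟫ : ℂ).re := fun k => by
      rw [K.Dval_zero, inner_smul_left, inner_smul_left, ← inner_conj_symm (b k x), map_mul,
        Complex.conj_conj, Complex.conj_ofReal, mul_assoc, Complex.re_ofReal_mul]
      congr 1
      rw [← Complex.conj_re, map_mul, Complex.conj_conj]
    rw [inner_neg_left, sum_inner, Complex.neg_re, Complex.re_sum]
    simp_rw [e1]
    rw [Finset.sum_sub_distrib, ← Finset.mul_sum, ← Finset.mul_sum]
    ring
  rw [ev] at s4
  refine s4.congr fun y => ?_
  simp only [Function.comp_apply, slope_def_field, energy, add_sub_cancel, ha, hb, hQ,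
    Finset.sum_sub_distrib, ← Finset.mul_sum]
  ring

theorem integral_density (hτ : ∀ i, 0 ≤ τ i) {B : ℝ}
    (hB : ∀ x, |K.energy w τ x| ≤ B) (k : Fin 2) :
    Integrable (fun x => ‖K.density w τ k x‖ ^ 2) ∧
      ∫ x, ‖K.density w τ k x‖ ^ 2 ≤ 2 * B := by
  have hc : Continuous fun x => ∑ k, ‖K.density w τ k x‖ ^ 2 :=
    continuous_finsetSum _ fun k _ => (K.continuous_density w τ k).norm.pow 2
  have hk : Continuous fun x => ‖K.density w τ k x‖ ^ 2 := (K.continuous_density w τ k).norm.pow 2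
  have key : ∀ i : ℝ, 0 ≤ i → ∫ x in (-i)..i, ‖K.density w τ k x‖ ^ 2 ≤ 2 * B := by
    intro i hi
    have h1 : ∫ x in (-i)..i, -K.ε * ∑ k, ‖K.density w τ k x‖ ^ 2
        = K.energy w τ i - K.energy w τ (-i) :=
      intervalIntegral.integral_eq_sub_of_hasDeriv_right (K.continuous_energy w hτ).continuousOn
        (fun x _ => K.hasDerivWithinAt_energy w hτ x)
        ((continuous_const.mul hc).intervalIntegrable _ _)
    rw [intervalIntegral.integral_const_mul] at h1
    have h2 : ∫ x in (-i)..i, ∑ k, ‖K.density w τ k x‖ ^ 2 ≤ 2 * B := by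
      have h3 : ∫ x in (-i)..i, ∑ k, ‖K.density w τ k x‖ ^ 2
          = -K.ε * (K.energy w τ i - K.energy w τ (-i)) := by
        rw [← h1]
        linear_combination (-(∫ x in (-i)..i, ∑ k, ‖K.density w τ k x‖ ^ 2)) * K.eps_sq
      rw [h3]
      refine (le_abs_self _).trans ?_
      rw [abs_mul, abs_neg, K.abs_eps, one_mul]
      refine (abs_sub _ _).trans ?_
      linarith [hB i, hB (-i)]
    refine le_trans ?_ h2
    apply intervalIntegral.integral_mono_on (by linarith) (hk.intervalIntegrable _ _)
      (hc.intervalIntegrable _ _)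
    intro x _
    exact Finset.single_le_sum (f := fun k => ‖K.density w τ k x‖ ^ 2)
      (fun _ _ => by positivity) (Finset.mem_univ k)
  have hint : Integrable fun x => ‖K.density w τ k x‖ ^ 2 := by
    refine integrable_of_intervalIntegral_norm_bounded (l := atTop) (2 * B) (a := fun i : ℝ => -i)
      (b := fun i : ℝ => i) (fun i => hk.integrableOn_Ioc) tendsto_neg_atTop_atBot tendsto_id ?_
    filter_upwards [eventually_ge_atTop 0] with i hi
    simpa using key i hi
  refine ⟨hint, ?_⟩
  refine le_of_tendsto (intervalIntegral_tendsto_integral hint tendsto_neg_atTop_atBot tendsto_id) ?_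
  filter_upwards [eventually_ge_atTop 0] with i hi
  exact key i hi

end KernelData

/-! ### Weak derivatives of square integrable functions -/

/-- Weak compactness of bounded families in `L²(ℝ)`. -/
theorem exists_weak_limit {v : ℝ → L2R} {B : ℝ} (hv : ∀ᶠ h in 𝓝[>] 0, ‖v h‖ ≤ B) :
    ∃ G : L2R, (∀ (φ : L2R) (l : ℂ), Tendsto (fun h => ⟪v h, φ⟫) (𝓝[>] 0) (𝓝 l) → ⟪G, φ⟫ = l) ∧
      ∀ δ B' : ℝ, (∀ᶠ h in 𝓝[>] 0, ‖shift δ (v h) - v h‖ ≤ B') → ‖shift δ G - G‖ ≤ B' := by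
  let e : ℝ → WeakDual ℂ L2R := fun h =>
    StrongDual.toWeakDual (InnerProductSpace.toDual ℂ L2R (v h))
  have hc := WeakDual.isCompact_closedBall (0 : StrongDual ℂ L2R) B
  have hf : Tendsto e (𝓝[>] 0) (𝓟 (WeakDual.toStrongDual ⁻¹' Metric.closedBall 0 B)) := by
    rw [tendsto_principal]
    filter_upwards [hv] with h hh
    simpa [e] using hh
  obtain ⟨g, -, hg⟩ := hc.exists_mapClusterPt hf
  let G : L2R := (InnerProductSpace.toDual ℂ L2R).symm (WeakDual.toStrongDual g)
  have hG : ∀ φ, ⟪G, φ⟫ = g φ := fun φ => InnerProductSpace.toDual_symm_apply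
  have hcl : ∀ φ, MapClusterPt ⟪G, φ⟫ (𝓝[>] 0) fun h => ⟪v h, φ⟫ := fun φ => by
    rw [hG]
    exact hg.continuousAt_comp (f := fun ψ : WeakDual ℂ L2R => ψ φ)
      (WeakDual.eval_continuous φ).continuousAt
  refine ⟨G, fun φ l hl => ?_, fun δ B' hB' => ?_⟩
  · have : NeBot (𝓝 ⟪G, φ⟫ ⊓ 𝓝 l) := NeBot.mono (hcl φ) (inf_le_inf le_rfl hl)
    exact eq_of_nhds_neBot this
  · set z := shift δ G - G with hz
    have h1 : MapClusterPt ⟪z, z⟫ (𝓝[>] 0) fun h => ⟪shift δ (v h) - v h, z⟫ := by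
      have := hcl (shift (-δ) z - z)
      simp only [inner_sub_right, ← inner_shift_left] at this
      simpa only [hz, inner_sub_left] using this
    have h2 : ⟪z, z⟫ ∈ Metric.closedBall (0 : ℂ) (B' * ‖z‖) := by
      refine Metric.isClosed_closedBall.mem_of_mapClusterPt h1 ?_
      filter_upwards [hB'] with h hh
      rw [mem_closedBall_zero_iff]
      exact (norm_inner_le_norm _ _).trans (by gcongr)
    rw [mem_closedBall_zero_iff, inner_self_eq_norm_sq_to_K, norm_pow] at h2
    simp only [Complex.coe_algebraMap, Complex.norm_real, norm_norm] at h2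
    rcases (norm_nonneg z).eq_or_lt with h0 | h0
    · obtain ⟨h, hh⟩ := hB'.exists
      rw [← h0]
      exact (norm_nonneg _).trans hh
    · nlinarith

theorem hasWeakDeriv_of_quotients {u p : ℝ → ℂ} {s : ℝ → ℝ → ℂ} {V : ℝ → L2R} {G : L2R} {B : ℝ}
    (hu : LocallyIntegrable u) (hp : LocallyIntegrable p)
    (hs : ∀ h, AEStronglyMeasurable (s h) volume)
    (hV : ∀ h, 0 < h → ∀ᵐ x, V h x = (h⁻¹ : ℂ) * (u (x + h) - u x) + s h x)
    (hsB : ∀ h x, 0 < h → ‖s h x‖ ≤ B)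
    (hsp : ∀ x, Tendsto (fun h => s h x) (𝓝[>] 0) (𝓝 (p x)))
    (hG : ∀ (φ : L2R) (l : ℂ), Tendsto (fun h => ⟪V h, φ⟫) (𝓝[>] 0) (𝓝 l) → ⟪G, φ⟫ = l) :
    HasWeakDeriv u fun x => G x - p x := by
  have hGi : LocallyIntegrable G volume := (Lp.memLp G).locallyIntegrable (by norm_num)
  refine ⟨hu, hGi.sub hp, fun φ hφ hφc => ?_⟩
  have hφcont : Continuous fun x => (φ x : ℂ) := Complex.continuous_ofReal.comp hφ.continuous
  have hφcs : HasCompactSupport fun x => (φ x : ℂ) :=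
    hφc.comp_left (g := fun x : ℝ => (x : ℂ)) (by simp)
  have hφL : MemLp (fun x => (φ x : ℂ)) 2 := hφcont.memLp_of_hasCompactSupport hφcs
  have hφ'c : Continuous (deriv φ) := hφ.continuous_deriv (by simp)
  have hφ'cs : HasCompactSupport (deriv φ) := hφc.deriv
  obtain ⟨M, hM⟩ := hφ'cs.exists_bound_of_continuous hφ'c
  have hM0 : 0 ≤ M := (norm_nonneg _).trans (hM 0)
  obtain ⟨R, hR⟩ := hφc.isCompact.isBounded.subset_closedBall (0 : ℝ)
  have hφ0 : ∀ x, R < |x| → φ x = 0 := fun x hx => by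
    by_contra h0
    have := hR (subset_tsupport φ h0)
    rw [mem_closedBall_zero_iff, Real.norm_eq_abs] at this
    linarith
  -- the translated test functions
  have hdiff : Differentiable ℝ φ := hφ.differentiable (by simp)
  have hlip : ∀ x y, |φ x - φ y| ≤ M * |x - y| := fun x y => by
    have := Convex.norm_image_sub_le_of_norm_deriv_le (f := φ) (C := M) (s := Set.univ)
      (fun x _ => hdiff x) (fun x _ => hM x) convex_univ (Set.mem_univ y) (Set.mem_univ x)
    simpa only [Real.norm_eq_abs] using this
  have huφ : ∀ ψ : ℝ → ℂ, Continuous ψ → HasCompactSupport ψ → Integrable fun x => conj (u x) * ψ x :=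
    fun ψ h1 h2 => by
      have := hu.integrable_smul_right_of_hasCompactSupport (continuous_conj.comp h1)
        (h2.comp_left (g := conj) (map_zero _))
      have h3 := (Complex.conjCLE : ℂ →L[ℝ] ℂ).integrable_comp this
      refine h3.congr (ae_of_all _ fun x => ?_)
      simp
  have hshift : ∀ h : ℝ, Continuous (fun x => (φ (x - h) : ℂ)) ∧
      HasCompactSupport (fun x => (φ (x - h) : ℂ)) := fun h =>
    ⟨hφcont.comp (continuous_sub_right h), hφcs.comp_homeomorph (Homeomorph.subRight h)⟩
  have lim1 : Tendsto (fun h : ℝ => ∫ x, conj (u x) * ((h⁻¹ : ℂ) * (φ (x - h) - φ x))) (𝓝[>] 0)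
      (𝓝 (∫ x, conj (u x) * (-(deriv φ x : ℝ) : ℂ))) := by
    have hb : Integrable ((Set.Icc (-(R + 1)) (R + 1)).indicator fun x => ‖u x‖ * M) := by
      rw [integrable_indicator_iff measurableSet_Icc]
      exact (hu.integrableOn_isCompact isCompact_Icc).norm.mul_const M
    refine tendsto_integral_filter_of_dominated_convergence _ ?_ ?_ hb ?_
    · refine Eventually.of_forall fun h => ?_
      refine (Complex.continuous_conj.comp_aestronglyMeasurable hu.aestronglyMeasurable).mul ?_
      exact (continuous_const.mul ((hshift h).1.sub hφcont)).aestronglyMeasurable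
    · have : ∀ᶠ h : ℝ in 𝓝[>] 0, h ∈ Set.Ioo (0 : ℝ) 1 := Ioo_mem_nhdsGT one_pos
      filter_upwards [this] with h hh
      refine ae_of_all _ fun x => ?_
      by_cases hx : x ∈ Set.Icc (-(R + 1)) (R + 1)
      · rw [Set.indicator_of_mem hx, norm_mul, RCLike.norm_conj]
        gcongr
        rw [← Complex.ofReal_sub, ← Complex.ofReal_inv, ← Complex.ofReal_mul, Complex.norm_real,
          Real.norm_eq_abs, abs_mul, abs_inv, abs_of_pos hh.1, inv_mul_le_iff₀ hh.1]
        have := hlip (x - h) x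
        rw [show x - h - x = -h by ring, abs_neg, abs_of_pos hh.1] at this
        linarith
      · have hx' : R + 1 < |x| := by
          by_contra hc
          exact hx (abs_le.mp (not_lt.mp hc))
        have h2 : R < |x - h| := by
          have := abs_sub_abs_le_abs_sub x h
          rw [abs_of_pos hh.1] at this
          linarith [hh.2]
        rw [Set.indicator_of_notMem hx, hφ0 x (by linarith), hφ0 _ h2]
        simp
    · refine ae_of_all _ fun x => Tendsto.const_mul _ ?_
      have hd : HasDerivAt (fun h : ℝ => φ (x - h)) (-deriv φ x) 0 := by
        have h1 : HasDerivAt φ (deriv φ x) (x - 0) := by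
          rw [sub_zero]; exact (hdiff x).hasDerivAt
        have h2 := h1.comp (0 : ℝ) ((hasDerivAt_id (0 : ℝ)).const_sub x)
        rw [mul_neg, mul_one] at h2
        exact h2
      have := (hasDerivWithinAt_iff_tendsto_slope' (s := Set.Ioi 0) (by simp)).mp
        hd.hasDerivWithinAt
      have h2 := (Complex.continuous_ofReal.tendsto _).comp this
      rw [Complex.ofReal_neg] at h2
      refine h2.congr fun h => ?_
      simp [slope_def_module]
  have lim2 : Tendsto (fun h : ℝ => ∫ x, conj (s h x) * (φ x : ℂ)) (𝓝[>] 0)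
      (𝓝 (∫ x, conj (p x) * (φ x : ℂ))) := by
    refine tendsto_integral_filter_of_dominated_convergence (fun x => B * ‖(φ x : ℂ)‖) ?_ ?_ ?_ ?_
    · exact Eventually.of_forall fun h => (Complex.continuous_conj.comp_aestronglyMeasurable
        (hs h)).mul hφcont.aestronglyMeasurable
    · filter_upwards [self_mem_nhdsWithin] with h hh
      refine ae_of_all _ fun x => ?_
      rw [norm_mul, RCLike.norm_conj]
      gcongr
      exact hsB h x hh
    · exact (hφcont.integrable_of_hasCompactSupport hφcs).norm.const_mul B
    · exact ae_of_all _ fun x => ((Complex.continuous_conj.tendsto _).comp (hsp x)).mul_const _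
  have hsi : ∀ h, 0 < h → Integrable fun x => conj (s h x) * (φ x : ℂ) := fun h hh => by
    refine ((hφcont.integrable_of_hasCompactSupport hφcs).norm.const_mul B).mono'
      ((Complex.continuous_conj.comp_aestronglyMeasurable (hs h)).mul
        hφcont.aestronglyMeasurable) (ae_of_all _ fun x => ?_)
    rw [norm_mul, RCLike.norm_conj]
    gcongr
    exact hsB h x hh
  have hinner : ∀ g : L2R, ⟪g, hφL.toLp _⟫ = ∫ x, conj (g x) * (φ x : ℂ) := fun g => by
    rw [L2.inner_def]
    apply integral_congr_ae
    filter_upwards [hφL.coeFn_toLp] with x hx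
    rw [hx, RCLike.inner_apply, mul_comm]
  have key := hG (hφL.toLp _) _ ((lim1.add lim2).congr' (by
    filter_upwards [self_mem_nhdsWithin] with h hh
    have e1 : ∫ x, conj (V h x) * (φ x : ℂ)
        = ∫ x, (((h⁻¹ : ℂ) * (conj (u (x + h)) * φ x - conj (u x) * φ x))
          + conj (s h x) * φ x) := by
      apply integral_congr_ae
      filter_upwards [hV h hh] with x hx
      rw [hx]
      simp only [map_add, map_mul, map_sub, map_inv₀, Complex.conj_ofReal]
      ring
    have i1 : Integrable fun x => conj (u x) * (φ x : ℂ) := huφ _ hφcont hφcs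
    have i2 : Integrable fun x => conj (u x) * (φ (x - h) : ℂ) := huφ _ (hshift h).1 (hshift h).2
    have i3 : Integrable fun x => conj (u (x + h)) * (φ x : ℂ) := by
      have := i2.comp_add_right h
      simpa using this
    have e2 : ∫ x, conj (u (x + h)) * (φ x : ℂ) = ∫ x, conj (u x) * (φ (x - h) : ℂ) := by
      rw [← integral_add_right_eq_self (fun x => conj (u x) * (φ (x - h) : ℂ)) h]
      simp
    have i4 : Integrable fun x =>
        (h⁻¹ : ℂ) * (conj (u (x + h)) * φ x - conj (u x) * φ x) := (i3.sub i1).const_mul _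
    rw [hinner, e1, integral_add i4 (hsi h hh), integral_const_mul,
      integral_sub i3 i1, e2, ← integral_sub i2 i1, ← integral_const_mul]
    congr 2 with x
    ring))
  rw [hinner] at key
  have iG : Integrable fun x => G x * (φ x : ℂ) := by
    have := hGi.integrable_smul_right_of_hasCompactSupport hφcont hφcs
    simpa only [smul_eq_mul] using this
  have ip : Integrable fun x => p x * (φ x : ℂ) := by
    have := hp.integrable_smul_right_of_hasCompactSupport hφcont hφcs
    simpa only [smul_eq_mul] using this
  have key2 := congrArg conj key
  rw [map_add, ← integral_conj, ← integral_conj, ← integral_conj] at key2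
  simp only [map_mul, Complex.conj_conj, Complex.conj_ofReal, map_neg, mul_neg, integral_neg]
    at key2
  simp_rw [sub_mul]
  rw [integral_sub iG ip, key2]
  ring

/-- A square integrable function whose translates are Lipschitz in `L²` has a weak derivative
in `L²`. -/
theorem memH_one_of_lipschitz {w : L2R} {C : ℝ}
    (hw : ∀ h, 0 < h → ‖shift h w - w‖ ≤ C * h) : MemH 1 w := by
  have hv : ∀ᶠ h : ℝ in 𝓝[>] 0, ‖(h⁻¹ : ℂ) • (shift h w - w)‖ ≤ C := by
    filter_upwards [self_mem_nhdsWithin] with h hh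
    have hh' : (0 : ℝ) < h := hh
    rw [norm_smul, norm_inv, Complex.norm_real, Real.norm_eq_abs, abs_of_pos hh',
      inv_mul_le_iff₀ hh', mul_comm]
    exact hw h hh
  obtain ⟨G, hG, -⟩ := exists_weak_limit hv
  have hwi : LocallyIntegrable w volume := (Lp.memLp w).locallyIntegrable (by norm_num)
  have := hasWeakDeriv_of_quotients (u := w) (p := 0) (s := fun _ _ => 0) (B := 0) hwi
    (locallyIntegrable_zero) (fun _ => aestronglyMeasurable_const) (fun h _ => by
      filter_upwards [Lp.coeFn_smul (h⁻¹ : ℂ) (shift h w - w), Lp.coeFn_sub (shift h w) w,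
        coeFn_shift h w] with x h1 h2 h3
      rw [h1, Pi.smul_apply, h2, Pi.sub_apply, h3, add_zero, smul_eq_mul])
    (fun _ _ _ => by simp) (fun _ => by simp) hG
  exact ⟨Lp.memLp w, G, by simpa using this, Lp.memLp G⟩

theorem IsHankel.norm_shift_adjoint_sub_le {f : L2R} {Γ : L2R →L[ℂ] L2R} (h : IsHankel f Γ)
    (δ : ℝ) {β : L2R} (hβ : Integrable β) {B : ℝ} (hB : ∫ s, ‖β s‖ ≤ B) :
    ‖shift δ (ContinuousLinearMap.adjoint Γ β) - ContinuousLinearMap.adjoint Γ β‖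
      ≤ B * ‖shift δ f - f‖ := by
  have h' : IsHankel (shift δ f - f) (Γ ∘L shift (-δ) - Γ) := fun γ => by
    filter_upwards [Lp.coeFn_sub (Γ (shift (-δ) γ)) (Γ γ), h (shift (-δ) γ), h γ] with s h1 h2 h3
    change (Γ (shift (-δ) γ) - Γ γ : L2R) s = _
    rw [h1, Pi.sub_apply, h2, h3, map_sub, inner_sub_left, shift_shift, add_comm, ← shift_shift,
      inner_shift_left δ]
  have e : ContinuousLinearMap.adjoint (Γ ∘L shift (-δ) - Γ) β
      = shift δ (ContinuousLinearMap.adjoint Γ β) - ContinuousLinearMap.adjoint Γ β := by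
    apply ext_inner_left ℂ
    intro v
    rw [ContinuousLinearMap.adjoint_inner_right]
    change ⟪Γ (shift (-δ) v) - Γ v, β⟫ = _
    rw [inner_sub_left, inner_sub_right, ContinuousLinearMap.adjoint_inner_right]
    congr 1
    rw [← ContinuousLinearMap.adjoint_inner_right, inner_shift_left, neg_neg]
  rw [← e]
  exact h'.norm_adjoint_le hβ hB

theorem sq_intervalIntegral_le {f : ℝ → ℝ} (hf : Continuous f) {δ : ℝ} (hδ : 0 < δ) :
    (∫ s in (0 : ℝ)..δ, f s) ^ 2 ≤ δ * ∫ s in (0 : ℝ)..δ, f s ^ 2 := by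
  set I := ∫ s in (0 : ℝ)..δ, f s
  have h0 : 0 ≤ ∫ s in (0 : ℝ)..δ, (f s - I / δ) ^ 2 :=
    intervalIntegral.integral_nonneg hδ.le fun _ _ => by positivity
  have e : ∫ s in (0 : ℝ)..δ, (f s - I / δ) ^ 2
      = (∫ s in (0 : ℝ)..δ, f s ^ 2) - I ^ 2 / δ := by
    have : ∀ s, (f s - I / δ) ^ 2 = f s ^ 2 - (2 * (I / δ)) * f s + (I / δ) ^ 2 := fun s => by ring
    simp_rw [this]
    rw [intervalIntegral.integral_add, intervalIntegral.integral_sub,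
      intervalIntegral.integral_const_mul, intervalIntegral.integral_const]
    · change (∫ s in (0 : ℝ)..δ, f s ^ 2) - 2 * (I / δ) * I + (δ - 0) • (I / δ) ^ 2 = _
      rw [smul_eq_mul]
      field_simp
      ring
    · exact (hf.pow 2).intervalIntegrable _ _
    · exact (continuous_const.mul hf).intervalIntegrable _ _
    · exact ((hf.pow 2).sub (continuous_const.mul hf)).intervalIntegrable _ _
    · exact intervalIntegrable_const
  rw [e, sub_nonneg, div_le_iff₀ hδ] at h0
  linarith

theorem norm_toLp_le {g : ℝ → ℂ} (hg : MemLp g 2) {B : ℝ} (hB : 0 ≤ B)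
    (h : ∫ x, ‖g x‖ ^ 2 ≤ B ^ 2) : ‖hg.toLp g‖ ≤ B := by
  refine le_of_sq_le_sq ?_ hB
  rw [norm_sq_eq_integral]
  refine le_trans (le_of_eq ?_) h
  apply integral_congr_ae
  filter_upwards [hg.coeFn_toLp] with x hx
  rw [hx]

/-- Minkowski's inequality for averages of a family that is bounded in `L²`. -/
theorem integral_sq_intervalIntegral_le {a : ℝ → ℝ → ℂ} (ha : Continuous fun p : ℝ × ℝ => a p.1 p.2)
    {δ C : ℝ} (hδ : 0 < δ) (hi : ∀ s, 0 ≤ s → Integrable fun x => ‖a x s‖ ^ 2)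
    (hC : ∀ s, 0 ≤ s → ∫ x, ‖a x s‖ ^ 2 ≤ C) :
    Integrable (fun x => (∫ s in (0 : ℝ)..δ, ‖a x s‖) ^ 2) ∧
      ∫ x, (∫ s in (0 : ℝ)..δ, ‖a x s‖) ^ 2 ≤ C * δ ^ 2 := by
  have hx : ∀ x, Continuous fun s => ‖a x s‖ := fun x => by
    have h : Continuous ((fun p : ℝ × ℝ => a p.1 p.2) ∘ fun s => (x, s)) :=
      ha.comp (Continuous.prodMk_right x)
    exact h.norm
  have hm : AEStronglyMeasurable (fun p : ℝ × ℝ => ‖a p.1 p.2‖ ^ 2)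
      ((volume : Measure ℝ).prod (volume.restrict (Set.Ioc 0 δ))) :=
    (ha.norm.pow 2).aestronglyMeasurable
  have hint : Integrable (fun p : ℝ × ℝ => ‖a p.1 p.2‖ ^ 2)
      ((volume : Measure ℝ).prod (volume.restrict (Set.Ioc 0 δ))) := by
    rw [integrable_prod_iff' hm]
    constructor
    · refine (ae_restrict_iff' measurableSet_Ioc).mpr (ae_of_all _ fun s hs => hi s hs.1.le)
    · refine Integrable.of_bound (C := C) ?_ ?_
      · exact hm.norm.prod_swap.integral_prod_right'
      · refine (ae_restrict_iff' measurableSet_Ioc).mpr (ae_of_all _ fun s hs => ?_)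
        have h0 : 0 ≤ ∫ x, ‖‖a x s‖ ^ 2‖ := integral_nonneg fun _ => norm_nonneg _
        rw [Real.norm_of_nonneg h0]
        simpa using hC s hs.1.le
  have hint1 : Integrable fun x => ∫ s in (0 : ℝ)..δ, ‖a x s‖ ^ 2 := by
    have := hint.integral_prod_left
    simpa only [intervalIntegral.integral_of_le hδ.le] using this
  have hcW : Continuous fun x => ∫ s in (0 : ℝ)..δ, ‖a x s‖ :=
    intervalIntegral.continuous_parametric_intervalIntegral_of_continuous' (by exact ha.norm) _ _
  have hle : ∀ x, (∫ s in (0 : ℝ)..δ, ‖a x s‖) ^ 2 ≤ δ * ∫ s in (0 : ℝ)..δ, ‖a x s‖ ^ 2 :=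
    fun x => sq_intervalIntegral_le (hx x) hδ
  have hI : Integrable (fun x => (∫ s in (0 : ℝ)..δ, ‖a x s‖) ^ 2) := by
    refine (hint1.const_mul δ).mono' (hcW.pow 2).aestronglyMeasurable (ae_of_all _ fun x => ?_)
    rw [Real.norm_of_nonneg (by positivity)]
    exact hle x
  refine ⟨hI, (integral_mono hI (hint1.const_mul δ) hle).trans ?_⟩
  rw [integral_const_mul]
  have e : ∫ x, ∫ s in (0 : ℝ)..δ, ‖a x s‖ ^ 2 = ∫ s in (0 : ℝ)..δ, ∫ x, ‖a x s‖ ^ 2 := by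
    simp_rw [intervalIntegral.integral_of_le hδ.le]
    exact integral_integral_swap hint
  have e2 : ∫ s in (0 : ℝ)..δ, ∫ x, ‖a x s‖ ^ 2 ≤ ∫ s in (0 : ℝ)..δ, C := by
    refine intervalIntegral.integral_mono_on hδ.le ?_ intervalIntegrable_const fun s hs => hC s hs.1
    rw [intervalIntegrable_iff_integrableOn_Ioc_of_le hδ.le]
    exact hint.integral_prod_right
  rw [e]
  calc _ ≤ δ * ∫ s in (0 : ℝ)..δ, C := by gcongr
    _ = _ := by simp; ring

namespace KernelData

variable (K : KernelData)

/-- Bounds for the difference of a solution and its translate. -/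
theorem norm_shift_sub_le {x : ℝ} {φ A : L2R} {ψ D : Fin 2 → L2R} (hs : K.Sol x φ ψ A D)
    {A' : ℝ → ℂ} {D' : Fin 2 → ℝ → ℂ} (hA : A =ᵐ[volume] A') (hAc : Continuous A')
    (hD : ∀ k, D k =ᵐ[volume] D' k) (hDc : ∀ k, Continuous (D' k)) {N b h : ℝ} (hh : 0 ≤ h)
    (hAN : ∀ s, ‖A' s‖ ≤ N) (hDN : ∀ k s, ‖D' k s‖ ≤ N) (hφ : ‖shift h φ - φ‖ ≤ b)
    (hψ : ∀ k, ‖shift (-h) (ψ k) - ψ k‖ ≤ b) :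
    ‖halfProj (shift h A - A)‖ ≤ K.aprioriC * (3 * b + 4 * (N * h * K.C)) ∧
      ∀ k, ‖halfProj (shift (-h) (D k) - D k)‖ ≤ K.aprioriC * (3 * b + 4 * (N * h * K.C)) := by
  have hC := K.C_nonneg
  have hI1 : ∫ s in (0 : ℝ)..h, ‖A' s‖ ≤ N * h := by
    calc _ ≤ ∫ s in (0 : ℝ)..h, N := intervalIntegral.integral_mono_on hh
          (hAc.norm.intervalIntegrable _ _) intervalIntegrable_const fun s _ => hAN s
      _ = N * h := by simp [mul_comm]
  have hI2 : ∀ k, ∫ s in (-h : ℝ)..0, ‖D' k s‖ ≤ N * h := fun k => by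
    calc _ ≤ ∫ s in (-h : ℝ)..0, N := intervalIntegral.integral_mono_on (by linarith)
          ((hDc k).norm.intervalIntegrable _ _) intervalIntegrable_const fun s _ => hDN k s
      _ = N * h := by simp [mul_comm]
  have h1 : ∀ k, ‖shift x (K.Γ k (crossR h (D k)))‖ ≤ N * h * K.C := fun k =>
    (K.norm_Γ_crossR_le k x hh (hD k) (hDc k)).trans (by gcongr; exact hI2 k)
  have h2 : ∀ k, ‖shift x (K.Γs k (crossL h A))‖ ≤ N * h * K.C := fun k =>
    (K.norm_Γs_crossL_le k x hh hA hAc).trans (by gcongr)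
  have hN : ‖shift h φ - φ - ∑ k, shift x (K.Γ k (crossR h (D k)))‖
      + ∑ k, ‖shift (-h) (ψ k) - ψ k + (K.ε : ℂ) • shift x (K.Γs k (crossL h A))‖
      ≤ 3 * b + 4 * (N * h * K.C) := by
    have e1 : ‖shift h φ - φ - ∑ k, shift x (K.Γ k (crossR h (D k)))‖ ≤ b + 2 * (N * h * K.C) := by
      refine (norm_sub_le _ _).trans ?_
      rw [Fin.sum_univ_two]
      linarith [norm_add_le (shift x (K.Γ 0 (crossR h (D 0)))) (shift x (K.Γ 1 (crossR h (D 1)))),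
        h1 0, h1 1]
    have e2 : ∀ k, ‖shift (-h) (ψ k) - ψ k + (K.ε : ℂ) • shift x (K.Γs k (crossL h A))‖
        ≤ b + N * h * K.C := fun k => by
      refine (norm_add_le _ _).trans ?_
      rw [norm_smul, Complex.norm_real, Real.norm_eq_abs, K.abs_eps, one_mul]
      exact add_le_add (hψ k) (h2 k)
    have e3 : ∑ k, ‖shift (-h) (ψ k) - ψ k + (K.ε : ℂ) • shift x (K.Γs k (crossL h A))‖
        ≤ 2 * (b + N * h * K.C) := by
      rw [Fin.sum_univ_two]
      linarith [e2 0, e2 1]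
    linarith
  have hs' := (hs.shift_sub h).norm_le
  have hc := K.aprioriC_pos.le
  exact ⟨hs'.1.trans (by gcongr), fun k => (hs'.2 k).trans (by gcongr)⟩

theorem norm_shift_dataL_sub_le (c : Fin 2 → ℂ) (x h : ℝ) :
    ‖shift h (K.dataL c x) - K.dataL c x‖ ≤ (∑ k, ‖c k‖) * (K.C * |h|) := by
  rw [dataL, map_sum, ← Finset.sum_sub_distrib, Finset.sum_mul]
  refine (norm_sum_le _ _).trans (Finset.sum_le_sum fun k _ => ?_)
  rw [map_smul, ← smul_sub, norm_smul, shift_shift, add_comm, ← shift_shift, ← map_sub, norm_shift]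
  gcongr
  exact K.lip_f k h

theorem norm_shift_dataR_sub_le (a : ℂ) (x h : ℝ) (k : Fin 2) :
    ‖shift h (K.dataR a x k) - K.dataR a x k‖ ≤ ‖a‖ * (K.C * |h|) := by
  rw [dataR, map_smul, ← smul_sub, norm_smul, shift_shift, add_comm, ← shift_shift, ← map_sub,
    norm_shift, norm_mul, Complex.norm_real, Real.norm_eq_abs, K.abs_eps, one_mul]
  gcongr
  exact K.lip_fb k h

/-- First differences of the rows are `O(h)`, uniformly in `x`. -/
theorem exists_first_difference (a : ℂ) (c : Fin 2 → ℂ) : ∃ C₁ : ℝ, 0 ≤ C₁ ∧ ∀ x h, 0 ≤ h →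
    ‖halfProj (shift h (K.A a c x) - K.A a c x)‖ ≤ C₁ * h := by
  have hC := K.C_nonneg
  have hc0 : 0 ≤ ∑ k, ‖c k‖ := Finset.sum_nonneg fun _ _ => norm_nonneg _
  have hv := K.valC_nonneg a c
  refine ⟨K.aprioriC * (3 * ((‖a‖ + ∑ k, ‖c k‖) * K.C) + 4 * (K.valC a c * K.C)), ?_, ?_⟩
  · have := K.aprioriC_pos
    positivity
  intro x h hh
  refine (K.norm_shift_sub_le (K.sol a c x) (K.A_ae a c x) (K.continuous_Aval a c x)
    (K.D_ae a c x) (K.continuous_Dval a c x) (b := (‖a‖ + ∑ k, ‖c k‖) * (K.C * h)) hh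
    (K.norm_Aval_le a c x) (K.norm_Dval_le a c x) ?_ ?_).1.trans (le_of_eq (by ring))
  · have := K.norm_shift_dataL_sub_le c x h
    rw [abs_of_nonneg hh] at this
    refine this.trans ?_
    gcongr
    exact le_add_of_nonneg_left (norm_nonneg _)
  · intro k
    have := K.norm_shift_dataR_sub_le a x (-h) k
    rw [abs_neg, abs_of_nonneg hh] at this
    refine this.trans ?_
    gcongr
    exact le_add_of_nonneg_right hc0

/-- Second order regularity of the kernels. -/
structure Smooth (C₂ : ℝ) : Prop where
  nonneg : 0 ≤ C₂
  lip : ∀ k y h, ‖K.F k (y + h) - K.F k y‖ ≤ C₂ * |h|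
  lip_f : ∀ k δ h, ‖shift δ (shift h (K.f k) - K.f k) - (shift h (K.f k) - K.f k)‖ ≤ C₂ * |δ| * |h|
  lip_fb : ∀ k δ h,
    ‖shift δ (shift h (K.fb k) - K.fb k) - (shift h (K.fb k) - K.fb k)‖ ≤ C₂ * |δ| * |h|

variable {K}

theorem Smooth.norm_Aval_sub_le {C₂ : ℝ} (hK : K.Smooth C₂) (a : ℂ) (c : Fin 2 → ℂ) (x s h : ℝ) :
    ‖K.Aval a c x (s + h) - K.Aval a c x s‖
      ≤ ((‖a‖ + ∑ k, ‖c k‖) * C₂ + 2 * (K.C * K.rowC a c)) * |h| := by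
  have h2 := hK.nonneg
  have hC := K.C_nonneg
  have e : K.Aval a c x (s + h) - K.Aval a c x s
      = -(∑ k, (c k * (K.F k (x + s + h) - K.F k (x + s))
        + ⟪shift (x + s) (shift h (K.fb k) - K.fb k), halfProj (K.D a c x k)⟫)) := by
    simp only [Aval, map_sub, shift_shift, inner_sub_left, mul_sub, Finset.sum_add_distrib,
      Finset.sum_sub_distrib, add_assoc]
    ring
  have hk : ∀ k, ‖c k * (K.F k (x + s + h) - K.F k (x + s))
        + ⟪shift (x + s) (shift h (K.fb k) - K.fb k), halfProj (K.D a c x k)⟫‖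
      ≤ ‖c k‖ * (C₂ * |h|) + K.C * |h| * K.rowC a c := fun k => by
    refine (norm_add_le _ _).trans (add_le_add ?_ ?_)
    · rw [norm_mul]
      gcongr
      exact hK.lip k _ _
    · refine (IsHankel.norm_inner_le _ _).trans ?_
      gcongr
      · exact K.lip_fb k h
      · exact K.norm_D_le a c x k
  rw [e, norm_neg]
  refine (norm_sum_le _ _).trans ?_
  rw [Fin.sum_univ_two, Fin.sum_univ_two]
  have : 0 ≤ ‖a‖ * C₂ * |h| := by positivity
  linarith [hk 0, hk 1]

theorem Smooth.norm_Dval_sub_le {C₂ : ℝ} (hK : K.Smooth C₂) (a : ℂ) (c : Fin 2 → ℂ) (x s h : ℝ)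
    (k : Fin 2) : ‖K.Dval a c x k (s + h) - K.Dval a c x k s‖
      ≤ ((‖a‖ + ∑ k, ‖c k‖) * C₂ + 2 * (K.C * K.rowC a c)) * |h| := by
  have h2 := hK.nonneg
  have hC := K.C_nonneg
  have hr := K.rowC_nonneg a c
  have hc0 : 0 ≤ ∑ k, ‖c k‖ := Finset.sum_nonneg fun _ _ => norm_nonneg _
  have e : K.Dval a c x k (s + h) - K.Dval a c x k s
      = K.ε * (a * conj (K.F k (x + s + h) - K.F k (x + s))
        + ⟪shift (x + s) (shift h (K.f k) - K.f k), halfProj (K.A a c x)⟫) := by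
    simp only [Dval, map_sub, shift_shift, inner_sub_left, mul_sub, add_assoc]
    ring
  rw [e, norm_mul, Complex.norm_real, Real.norm_eq_abs, K.abs_eps, one_mul]
  have e1 : ‖a * conj (K.F k (x + s + h) - K.F k (x + s))‖ ≤ ‖a‖ * (C₂ * |h|) := by
    rw [norm_mul, RCLike.norm_conj]
    gcongr
    exact hK.lip k _ _
  have e2 : ‖⟪shift (x + s) (shift h (K.f k) - K.f k), halfProj (K.A a c x)⟫‖
      ≤ K.C * |h| * K.rowC a c := by
    refine (IsHankel.norm_inner_le _ _).trans ?_
    gcongr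
    · exact K.lip_f k h
    · exact K.norm_A_le a c x
  refine (norm_add_le _ _).trans ?_
  have t1 : 0 ≤ (∑ k, ‖c k‖) * C₂ * |h| := by positivity
  have t2 : 0 ≤ K.C * K.rowC a c * |h| := by positivity
  linarith

/-- Second differences of the rows are `O(δ h)`, uniformly in `x`. -/
theorem Smooth.exists_second_difference {C₂ : ℝ} (hK : K.Smooth C₂) (a : ℂ) (c : Fin 2 → ℂ) :
    ∃ C₃ : ℝ, 0 ≤ C₃ ∧ ∀ x δ h, 0 ≤ δ → 0 ≤ h →
      ‖halfProj (shift δ (shift h (K.A a c x) - K.A a c x) - (shift h (K.A a c x) - K.A a c x))‖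
        ≤ C₃ * δ * h := by
  have hC := K.C_nonneg
  have hC2 := hK.nonneg
  have hc0 : 0 ≤ ∑ k, ‖c k‖ := Finset.sum_nonneg fun _ _ => norm_nonneg _
  have hv := K.valC_nonneg a c
  have hr := K.rowC_nonneg a c
  set L := (‖a‖ + ∑ k, ‖c k‖) * C₂ + 2 * (K.C * K.rowC a c) with hL
  set b := (‖a‖ + ∑ k, ‖c k‖) * C₂ + 2 * (K.valC a c * K.C) with hb
  refine ⟨K.aprioriC * (3 * b + 4 * (L * K.C)), ?_, ?_⟩
  · have := K.aprioriC_pos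
    positivity
  intro x δ h hδ hh
  have hA := K.A_ae a c x
  have hAc := K.continuous_Aval a c x
  have hD := K.D_ae a c x
  have hDc := K.continuous_Dval a c x
  have hs := (K.sol a c x).shift_sub h
  have iR : ∀ k, ∫ s, ‖crossR h (K.D a c x k) s‖ ≤ K.valC a c * h := fun k => by
    rw [(integrable_crossR hh _ (hD k) (hDc k)).2]
    calc _ ≤ ∫ s in (-h : ℝ)..0, K.valC a c := intervalIntegral.integral_mono_on (by linarith)
          ((hDc k).norm.intervalIntegrable _ _) intervalIntegrable_const
          fun s _ => K.norm_Dval_le a c x k s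
      _ = K.valC a c * h := by simp [mul_comm]
  have iL : ∫ s, ‖crossL h (K.A a c x) s‖ ≤ K.valC a c * h := by
    rw [(integrable_crossL hh _ hA hAc).2]
    calc _ ≤ ∫ s in (0 : ℝ)..h, K.valC a c := intervalIntegral.integral_mono_on hh
          (hAc.norm.intervalIntegrable _ _) intervalIntegrable_const
          fun s _ => K.norm_Aval_le a c x s
      _ = K.valC a c * h := by simp [mul_comm]
  have comm : ∀ (σ : ℝ) (g : L2R), shift σ (shift x g) - shift x g = shift x (shift σ g - g) :=
    fun σ g => by rw [map_sub, shift_shift, shift_shift, add_comm]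
  have hφ : ‖shift δ (shift h (K.dataL c x) - K.dataL c x
        - ∑ k, shift x (K.Γ k (crossR h (K.D a c x k))))
      - (shift h (K.dataL c x) - K.dataL c x - ∑ k, shift x (K.Γ k (crossR h (K.D a c x k))))‖
      ≤ b * δ * h := by
    have e : shift δ (shift h (K.dataL c x) - K.dataL c x
        - ∑ k, shift x (K.Γ k (crossR h (K.D a c x k))))
      - (shift h (K.dataL c x) - K.dataL c x - ∑ k, shift x (K.Γ k (crossR h (K.D a c x k))))
      = ∑ k, (c k • shift x (shift δ (shift h (K.f k) - K.f k) - (shift h (K.f k) - K.f k))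
        - shift x (shift δ (K.Γ k (crossR h (K.D a c x k))) - K.Γ k (crossR h (K.D a c x k)))) := by
      simp only [dataL, map_sub, map_sum, map_smul, smul_sub, Finset.sum_sub_distrib, shift_shift,
        add_comm x, add_assoc]
      abel
    have hk : ∀ k, ‖c k • shift x (shift δ (shift h (K.f k) - K.f k) - (shift h (K.f k) - K.f k))
        - shift x (shift δ (K.Γ k (crossR h (K.D a c x k))) - K.Γ k (crossR h (K.D a c x k)))‖
        ≤ ‖c k‖ * (C₂ * δ * h) + K.valC a c * h * (K.C * δ) := fun k => by
      refine (norm_sub_le _ _).trans (add_le_add ?_ ?_)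
      · rw [norm_smul, norm_shift]
        gcongr
        have := hK.lip_f k δ h
        rwa [abs_of_nonneg hδ, abs_of_nonneg hh] at this
      · rw [norm_shift, ← K.adjoint_Γs]
        refine ((K.hankel_Γs k).norm_shift_adjoint_sub_le δ
          (integrable_crossR hh _ (hD k) (hDc k)).1 (iR k)).trans ?_
        gcongr
        have := K.lip_f k δ
        rwa [abs_of_nonneg hδ] at this
    rw [e]
    refine (norm_sum_le _ _).trans ?_
    have t : 0 ≤ ‖a‖ * C₂ * δ * h := by positivity
    rw [hb, Fin.sum_univ_two, Fin.sum_univ_two]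
    linarith [hk 0, hk 1]
  have hψ : ∀ k, ‖shift (-δ) (shift (-h) (K.dataR a x k) - K.dataR a x k
        + (K.ε : ℂ) • shift x (K.Γs k (crossL h (K.A a c x))))
      - (shift (-h) (K.dataR a x k) - K.dataR a x k
        + (K.ε : ℂ) • shift x (K.Γs k (crossL h (K.A a c x))))‖ ≤ b * δ * h := fun k => by
    have e : shift (-δ) (shift (-h) (K.dataR a x k) - K.dataR a x k
        + (K.ε : ℂ) • shift x (K.Γs k (crossL h (K.A a c x))))
      - (shift (-h) (K.dataR a x k) - K.dataR a x k
        + (K.ε : ℂ) • shift x (K.Γs k (crossL h (K.A a c x))))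
      = (K.ε * a) • shift x (shift (-δ) (shift (-h) (K.fb k) - K.fb k)
          - (shift (-h) (K.fb k) - K.fb k))
        + (K.ε : ℂ) • shift x (shift (-δ) (K.Γs k (crossL h (K.A a c x)))
          - K.Γs k (crossL h (K.A a c x))) := by
      simp only [dataR, map_sub, map_add, map_smul, smul_sub, shift_shift, add_comm x, add_assoc]
      abel
    rw [e]
    refine (norm_add_le _ _).trans ?_
    have e1 : ‖(K.ε * a) • shift x (shift (-δ) (shift (-h) (K.fb k) - K.fb k)
          - (shift (-h) (K.fb k) - K.fb k))‖ ≤ ‖a‖ * (C₂ * δ * h) := by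
      rw [norm_smul, norm_shift, norm_mul, Complex.norm_real, Real.norm_eq_abs, K.abs_eps, one_mul]
      gcongr
      have := hK.lip_fb k (-δ) (-h)
      rwa [abs_neg, abs_neg, abs_of_nonneg hδ, abs_of_nonneg hh] at this
    have e2 : ‖(K.ε : ℂ) • shift x (shift (-δ) (K.Γs k (crossL h (K.A a c x)))
          - K.Γs k (crossL h (K.A a c x)))‖ ≤ K.valC a c * h * (K.C * δ) := by
      rw [norm_smul, norm_shift, Complex.norm_real, Real.norm_eq_abs, K.abs_eps, one_mul]
      refine ((K.hankel k).norm_shift_adjoint_sub_le (-δ)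
          (integrable_crossL hh _ hA hAc).1 iL).trans ?_
      gcongr
      have := K.lip_fb k (-δ)
      rwa [abs_neg, abs_of_nonneg hδ] at this
    have t : 0 ≤ (∑ k, ‖c k‖) * C₂ * δ * h := by positivity
    have t2 : 0 ≤ K.valC a c * K.C * δ * h := by positivity
    rw [hb]
    linarith
  have hA1 : (shift h (K.A a c x) - K.A a c x : L2R) =ᵐ[volume]
      fun s => K.Aval a c x (s + h) - K.Aval a c x s := by
    filter_upwards [Lp.coeFn_sub (shift h (K.A a c x)) (K.A a c x), coeFn_shift h (K.A a c x), hA,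
      ae_comp_add h hA] with s h1 h2 h3 h4
    rw [h1, Pi.sub_apply, h2, h3, h4]
  have hD1 : ∀ k, (shift (-h) (K.D a c x k) - K.D a c x k : L2R) =ᵐ[volume]
      fun s => K.Dval a c x k (s + -h) - K.Dval a c x k s := fun k => by
    filter_upwards [Lp.coeFn_sub (shift (-h) (K.D a c x k)) (K.D a c x k),
      coeFn_shift (-h) (K.D a c x k), hD k, ae_comp_add (-h) (hD k)] with s h1 h2 h3 h4
    rw [h1, Pi.sub_apply, h2, h3, h4]
  refine (K.norm_shift_sub_le hs hA1 ((hAc.comp (continuous_add_const h)).sub hAc) hD1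
    (fun k => ((hDc k).comp (continuous_add_const (-h))).sub (hDc k)) hδ (N := L * h)
    (fun s => ?_) (fun k s => ?_) hφ hψ).1.trans (le_of_eq (by ring))
  · have := hK.norm_Aval_sub_le a c x s h
    rwa [abs_of_nonneg hh] at this
  · have := hK.norm_Dval_sub_le a c x s (-h) k
    rwa [abs_neg, abs_of_nonneg hh] at this

end KernelData

namespace KernelData

variable (K : KernelData)

theorem abs_energy_le {n : ℕ} (w : Fin n → ℂ) (τ : Fin n → ℝ) {b : ℝ} (x : ℝ)
    (h1 : ‖halfProj (transl w τ (K.A 1 0 x))‖ ≤ b)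
    (h2 : ∀ k, ‖halfProj (transl w τ (K.A 0 (Pi.single k 1) x))‖ ≤ b) :
    |K.energy w τ x| ≤ 3 * b ^ 2 := by
  rw [energy]
  refine (abs_add_le _ _).trans ?_
  have hs : 0 ≤ ∑ k, ‖halfProj (transl w τ (K.A 0 (Pi.single k 1) x))‖ ^ 2 :=
    Finset.sum_nonneg fun _ _ => by positivity
  rw [abs_mul, K.abs_eps, one_mul, abs_of_nonneg hs, abs_of_nonneg (by positivity),
    Fin.sum_univ_two]
  have e1 : ‖halfProj (transl w τ (K.A 1 0 x))‖ ^ 2 ≤ b ^ 2 := by gcongr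
  have e2 : ∀ k, ‖halfProj (transl w τ (K.A 0 (Pi.single k 1) x))‖ ^ 2 ≤ b ^ 2 := fun k => by
    gcongr; exact h2 k
  linarith [e2 0, e2 1]

/-- A bound for all three rows. -/
theorem exists_row_bound {p : ℂ → (Fin 2 → ℂ) → ℝ → Prop}
    (hp : ∀ a c, ∃ C : ℝ, 0 ≤ C ∧ p a c C) (hmono : ∀ a c C C', C ≤ C' → p a c C → p a c C') :
    ∃ C : ℝ, 0 ≤ C ∧ p 1 0 C ∧ ∀ k : Fin 2, p 0 (Pi.single k 1) C := by
  obtain ⟨C0, h0, hp0⟩ := hp 1 0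
  choose C1 h1 hp1 using fun k : Fin 2 => hp 0 (Pi.single k 1)
  refine ⟨C0 + ∑ k, C1 k, by have := Finset.sum_nonneg fun k (_ : k ∈ Finset.univ) => h1 k; linarith,
    hmono _ _ _ _ ?_ hp0, fun k => hmono _ _ _ _ ?_ (hp1 k)⟩
  · have := Finset.sum_nonneg fun k (_ : k ∈ Finset.univ) => h1 k
    linarith
  · have := Finset.single_le_sum (f := C1) (fun i _ => h1 i) (Finset.mem_univ k)
    linarith

theorem exists_L2_Aval : ∃ C : ℝ, 0 ≤ C ∧ ∀ (k : Fin 2) (s : ℝ), 0 ≤ s →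
    Integrable (fun x => ‖K.Aval 0 (Pi.single k 1) x s‖ ^ 2) ∧
      ∫ x, ‖K.Aval 0 (Pi.single k 1) x s‖ ^ 2 ≤ C := by
  obtain ⟨b, hb, h1, h2⟩ := exists_row_bound (p := fun a c b => ∀ x, ‖halfProj (K.A a c x)‖ ≤ b)
    (fun a c => ⟨K.rowC a c, K.rowC_nonneg a c, K.norm_A_le a c⟩)
    (fun a c C C' hC h x => (h x).trans hC)
  refine ⟨2 * (3 * b ^ 2), by positivity, fun k s hs => ?_⟩
  have hτ : ∀ i, 0 ≤ (![s] : Fin 1 → ℝ) i := fun i => by simpa using hs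
  have hle : ∀ g : L2R, ‖halfProj (transl ![1] ![s] g)‖ ≤ ‖halfProj g‖ := fun g => by
    rw [← halfProj_transl_halfProj _ hτ]
    refine (norm_halfProj_le _).trans (le_of_eq ?_)
    simp [transl_apply, norm_shift]
  have := K.integral_density ![1] hτ (B := 3 * b ^ 2) (fun x => K.abs_energy_le _ _ x
    ((hle _).trans (h1 x)) fun k => (hle _).trans (h2 k x)) k
  simpa [density] using this

theorem exists_L2_difference : ∃ C : ℝ, 0 ≤ C ∧ ∀ (k : Fin 2) (h : ℝ), 0 ≤ h →
    Integrable (fun x => ‖K.Aval 0 (Pi.single k 1) x h - K.Aval 0 (Pi.single k 1) x 0‖ ^ 2) ∧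
      ∫ x, ‖K.Aval 0 (Pi.single k 1) x h - K.Aval 0 (Pi.single k 1) x 0‖ ^ 2 ≤ (C * h) ^ 2 := by
  obtain ⟨b, hb, h1, h2⟩ := exists_row_bound K.exists_first_difference
    (fun a c C C' hC h x t ht => (h x t ht).trans (by gcongr))
  refine ⟨3 * b, by positivity, fun k h hh => ?_⟩
  have hτ : ∀ i, 0 ≤ (![h, 0] : Fin 2 → ℝ) i := fun i => by
    fin_cases i <;> simp [hh]
  have hle : ∀ g : L2R, halfProj (transl ![1, -1] ![h, 0] g) = halfProj (shift h g - g) := fun g => by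
    simp [transl_apply, Fin.sum_univ_two, shift_zero, sub_eq_add_neg]
  obtain ⟨e1, e2⟩ := K.integral_density ![1, -1] hτ (B := 3 * (b * h) ^ 2)
    (fun x => K.abs_energy_le _ _ x (by rw [hle]; exact h1 x h hh)
      fun k => by rw [hle]; exact h2 k x h hh) k
  have e : ∀ x, K.density ![1, -1] ![h, 0] k x
      = K.Aval 0 (Pi.single k 1) x h - K.Aval 0 (Pi.single k 1) x 0 := fun x => by
    simp [density, Fin.sum_univ_two, sub_eq_add_neg]
  simp only [e] at e1 e2
  refine ⟨e1, e2.trans ?_⟩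
  nlinarith [sq_nonneg (b * h)]

variable {K}

theorem Smooth.exists_L2_second_difference {C₂ : ℝ} (hK : K.Smooth C₂) : ∃ C : ℝ, 0 ≤ C ∧
    ∀ (k : Fin 2) (δ h : ℝ), 0 ≤ δ → 0 ≤ h →
    Integrable (fun x => ‖K.Aval 0 (Pi.single k 1) x (h + δ) - K.Aval 0 (Pi.single k 1) x h
      - K.Aval 0 (Pi.single k 1) x δ + K.Aval 0 (Pi.single k 1) x 0‖ ^ 2) ∧
      ∫ x, ‖K.Aval 0 (Pi.single k 1) x (h + δ) - K.Aval 0 (Pi.single k 1) x h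
      - K.Aval 0 (Pi.single k 1) x δ + K.Aval 0 (Pi.single k 1) x 0‖ ^ 2 ≤ (C * δ * h) ^ 2 := by
  obtain ⟨b, hb, h1, h2⟩ := exists_row_bound hK.exists_second_difference
    (fun a c C C' hC h x δ t hδ ht => (h x δ t hδ ht).trans (by gcongr))
  refine ⟨3 * b, by positivity, fun k δ h hδ hh => ?_⟩
  have hτ : ∀ i, 0 ≤ (![h + δ, h, δ, 0] : Fin 4 → ℝ) i := fun i => by
    fin_cases i <;> simp [hh, hδ, add_nonneg]
  have hle : ∀ g : L2R, halfProj (transl ![1, -1, -1, 1] ![h + δ, h, δ, 0] g)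
      = halfProj (shift δ (shift h g - g) - (shift h g - g)) := fun g => by
    congr 1
    simp [transl_apply, Fin.sum_univ_four, shift_zero, shift_shift, add_comm δ h]
    abel
  obtain ⟨e1, e2⟩ := K.integral_density ![1, -1, -1, 1] hτ (B := 3 * (b * δ * h) ^ 2)
    (fun x => K.abs_energy_le _ _ x (by rw [hle]; exact h1 x δ h hδ hh)
      fun k => by rw [hle]; exact h2 k x δ h hδ hh) k
  have e : ∀ x, K.density ![1, -1, -1, 1] ![h + δ, h, δ, 0] k x
      = K.Aval 0 (Pi.single k 1) x (h + δ) - K.Aval 0 (Pi.single k 1) x h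
      - K.Aval 0 (Pi.single k 1) x δ + K.Aval 0 (Pi.single k 1) x 0 := fun x => by
    simp [density, Fin.sum_univ_four, sub_eq_add_neg]
  simp only [e] at e1 e2
  refine ⟨e1, e2.trans ?_⟩
  nlinarith [sq_nonneg (b * δ * h)]

variable (K)

/-- Transport of pointwise values in `x`. -/
theorem Aval_increment (c : Fin 2 → ℂ) (x h s : ℝ) :
    K.Aval 0 c (x + h) s - K.Aval 0 c x (s + h)
      = -∑ k, ⟪shift (x + h + s) (K.fb k), halfProj ((K.D 0 c (x + h) - K.D 0 c x) k)⟫ := by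
  have e : x + (s + h) = x + h + s := by ring
  simp only [Aval, e, Pi.sub_apply, map_sub, inner_sub_right, Finset.sum_sub_distrib]
  ring

/-- A bound for the increments in `x`. -/
theorem norm_halfProj_increment_le (c : Fin 2 → ℂ) (x : ℝ) {h : ℝ} (hh : 0 ≤ h) (k : Fin 2) :
    ‖halfProj ((K.D 0 c (x + h) - K.D 0 c x) k)‖
      ≤ K.aprioriC * (2 * K.C) * ∫ s in (0 : ℝ)..h, ‖K.Aval 0 c x s‖ := by
  refine ((K.sol_increment_right c x h).norm_le.2 k).trans ?_
  rw [mul_assoc]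
  refine mul_le_mul_of_nonneg_left ?_ K.aprioriC_pos.le
  have h1 : ∀ k, ‖-(K.ε : ℂ) • shift (x + h) (K.Γs k (crossL h (K.A 0 c x)))‖
      ≤ (∫ s in (0 : ℝ)..h, ‖K.Aval 0 c x s‖) * K.C := fun k => by
    rw [norm_smul, norm_neg, Complex.norm_real, Real.norm_eq_abs, K.abs_eps, one_mul]
    exact K.norm_Γs_crossL_le k _ hh (K.A_ae 0 c x) (K.continuous_Aval 0 c x)
  rw [norm_zero, zero_add, Fin.sum_univ_two]
  linarith [h1 0, h1 1]

/-- The error in `u (x + h) = -A_x(h) + …`. -/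
noncomputable def err (k : Fin 2) (h x : ℝ) : ℂ :=
  K.Aval 0 (Pi.single k 1) (x + h) 0 - K.Aval 0 (Pi.single k 1) x h

theorem err_eq (k : Fin 2) (h x : ℝ) : K.err k h x
    = -∑ j, ⟪shift (x + h) (K.fb j),
        halfProj ((K.D 0 (Pi.single k 1) (x + h) - K.D 0 (Pi.single k 1) x) j)⟫ := by
  have := K.Aval_increment (Pi.single k 1) x h 0
  rw [zero_add, add_zero] at this
  exact this

/-- A constant for the error. -/
noncomputable def errC : ℝ := 2 * (K.C * (K.aprioriC * (2 * K.C)))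

theorem errC_nonneg : 0 ≤ K.errC := by
  have := K.C_nonneg
  have := K.aprioriC_pos
  unfold errC
  positivity

theorem norm_err_le (k : Fin 2) (x : ℝ) {h : ℝ} (hh : 0 ≤ h) :
    ‖K.err k h x‖ ≤ K.errC * ∫ s in (0 : ℝ)..h, ‖K.Aval 0 (Pi.single k 1) x s‖ := by
  have hC := K.C_nonneg
  rw [err_eq, norm_neg]
  refine (norm_sum_le _ _).trans ?_
  have h1 : ∀ j, ‖⟪shift (x + h) (K.fb j),
        halfProj ((K.D 0 (Pi.single k 1) (x + h) - K.D 0 (Pi.single k 1) x) j)⟫‖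
      ≤ K.C * (K.aprioriC * (2 * K.C) * ∫ s in (0 : ℝ)..h, ‖K.Aval 0 (Pi.single k 1) x s‖) :=
    fun j => (K.norm_inner_fb_le j _ _).trans
      (by gcongr; exact K.norm_halfProj_increment_le _ x hh j)
  rw [Fin.sum_univ_two, errC]
  linarith [h1 0, h1 1]

theorem integral_norm_Aval_le (a : ℂ) (c : Fin 2 → ℂ) (x : ℝ) {h : ℝ} (hh : 0 ≤ h) :
    ∫ s in (0 : ℝ)..h, ‖K.Aval a c x s‖ ≤ K.valC a c * h := by
  calc _ ≤ ∫ s in (0 : ℝ)..h, K.valC a c := intervalIntegral.integral_mono_on hh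
        ((K.continuous_Aval a c x).norm.intervalIntegrable _ _) intervalIntegrable_const
        fun s _ => K.norm_Aval_le a c x s
    _ = K.valC a c * h := by simp [mul_comm]

/-- The limit of the error. -/
noncomputable def errLim (k : Fin 2) (x : ℝ) : ℂ := K.pot k x * K.Aval 1 0 x 0

theorem tendsto_err (k : Fin 2) (x : ℝ) :
    Tendsto (fun h : ℝ => (h⁻¹ : ℂ) * K.err k h x) (𝓝[>] 0) (𝓝 (K.errLim k x)) := by
  have h1 : ∀ j, Tendsto (fun h : ℝ => ⟪shift (x + h) (K.fb j),
      halfProj (((h⁻¹ : ℂ) • (K.D 0 (Pi.single k 1) (x + h) - K.D 0 (Pi.single k 1) x)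
        - (-K.Aval 0 (Pi.single k 1) x 0) • K.D 1 0 (x + h)) j)⟫) (𝓝[>] 0) (𝓝 (0 : ℂ)) := fun j => by
    have := (tendsto_shift_add x (K.fb j)).inner
      ((K.tendsto_increment_right (Pi.single k 1) x).2 j) (𝕜 := ℂ)
    rwa [inner_zero_right] at this
  have h2 : ∀ j, Tendsto (fun h : ℝ => ⟪shift (x + h) (K.fb j), halfProj (K.D 1 0 (x + h) j)⟫)
      (𝓝[>] 0) (𝓝 (⟪shift x (K.fb j), halfProj (K.D 1 0 x j)⟫ : ℂ)) := fun j =>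
    (tendsto_shift_add x (K.fb j)).inner
      ((((K.continuous_sol 1 0).2 j).tendsto x).comp (tendsto_add_nhdsGT x))
  have h3 := (tendsto_finsetSum Finset.univ fun j _ =>
    (h1 j).add ((h2 j).const_mul (K.pot k x))).neg
  have e : -∑ j, (0 + K.pot k x * ⟪shift x (K.fb j), halfProj (K.D 1 0 x j)⟫) = K.errLim k x := by
    simp only [errLim, Aval, Pi.zero_apply, zero_mul, Finset.sum_const_zero, zero_add, add_zero,
      mul_neg, Finset.mul_sum]
  rw [e] at h3
  refine h3.congr fun h => ?_
  rw [err_eq, mul_neg, Finset.mul_sum]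
  congr 2 with j
  simp only [Pi.sub_apply, Pi.smul_apply, map_sub, map_smul, inner_sub_right, inner_smul_right,
    pot]
  ring

theorem continuous_pot (k : Fin 2) : Continuous (K.pot k) := (K.continuous_Aval_left _ _ 0).neg

theorem continuous_err (k : Fin 2) (h : ℝ) : Continuous (K.err k h) :=
  ((K.continuous_Aval_left 0 (Pi.single k 1) 0).comp (continuous_add_const h)).sub
    (K.continuous_Aval_left 0 (Pi.single k 1) h)

theorem continuous_errLim (k : Fin 2) : Continuous (K.errLim k) :=
  (K.continuous_pot k).mul (K.continuous_Aval_left _ _ 0)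

theorem memLp_pot (k : Fin 2) : MemLp (K.pot k) 2 := by
  obtain ⟨C, -, hC⟩ := K.exists_L2_Aval
  rw [memLp_two_iff_integrable_sq_norm (K.continuous_pot k).aestronglyMeasurable]
  simpa [pot] using (hC k 0 le_rfl).1

theorem memLp_errLim (k : Fin 2) : MemLp (K.errLim k) 2 := by
  refine (K.memLp_pot k).of_le_mul (c := K.valC 1 0)
    (K.continuous_errLim k).aestronglyMeasurable (ae_of_all _ fun x => ?_)
  rw [errLim, norm_mul, mul_comm]
  gcongr
  exact K.norm_Aval_le _ _ _ _

/-- The difference quotients in `s` at `s = 0`, as functions of `x`. -/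
noncomputable def quot (k : Fin 2) (h x : ℝ) : ℂ :=
  -(h⁻¹ : ℂ) * (K.Aval 0 (Pi.single k 1) x |h| - K.Aval 0 (Pi.single k 1) x 0)

theorem memLp_quot (k : Fin 2) (h : ℝ) : MemLp (K.quot k h) 2 := by
  obtain ⟨C, -, hC⟩ := K.exists_L2_difference
  refine MemLp.const_mul ?_ _
  exact (memLp_two_iff_integrable_sq_norm ((K.continuous_Aval_left _ _ _).sub
    (K.continuous_Aval_left _ _ _)).aestronglyMeasurable).mpr (hC k |h| (abs_nonneg h)).1

/-- The weak derivative of the potential. -/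
theorem exists_weakDeriv_pot (k : Fin 2) : ∃ G : L2R,
    (HasWeakDeriv (K.pot k) fun x => G x - K.errLim k x) ∧
    ∀ δ B : ℝ, (∀ᶠ h in 𝓝[>] 0, ‖shift δ ((K.memLp_quot k h).toLp _)
      - (K.memLp_quot k h).toLp _‖ ≤ B) → ‖shift δ G - G‖ ≤ B := by
  obtain ⟨C, hC0, hC⟩ := K.exists_L2_difference
  have hv : ∀ᶠ h in 𝓝[>] (0 : ℝ), ‖(K.memLp_quot k h).toLp _‖ ≤ C := by
    filter_upwards [self_mem_nhdsWithin] with h hh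
    have hh' : (0 : ℝ) < h := hh
    apply norm_toLp_le _ hC0
    have e : ∀ x, ‖K.quot k h x‖ ^ 2
        = h⁻¹ ^ 2 * ‖K.Aval 0 (Pi.single k 1) x h - K.Aval 0 (Pi.single k 1) x 0‖ ^ 2 := fun x => by
      rw [quot, norm_mul, norm_neg, norm_inv, Complex.norm_real, Real.norm_eq_abs, abs_of_pos hh',
        mul_pow]
    simp_rw [e]
    rw [integral_const_mul]
    calc _ ≤ h⁻¹ ^ 2 * (C * h) ^ 2 := by gcongr; exact (hC k h hh'.le).2
      _ = C ^ 2 := by field_simp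
  obtain ⟨G, hG1, hG2⟩ := exists_weak_limit hv
  refine ⟨G, ?_, hG2⟩
  refine hasWeakDeriv_of_quotients (s := fun h x => (h⁻¹ : ℂ) * K.err k h x)
    (B := K.errC * K.valC 0 (Pi.single k 1)) (K.continuous_pot k).locallyIntegrable
    (K.continuous_errLim k).locallyIntegrable
    (fun h => (continuous_const.mul (K.continuous_err k h)).aestronglyMeasurable) ?_ ?_
    (K.tendsto_err k) hG1
  · intro h hh
    filter_upwards [(K.memLp_quot k h).coeFn_toLp] with x hx
    rw [hx, quot, err, pot, pot, abs_of_pos hh]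
    ring
  · intro h x hh
    rw [norm_mul, norm_inv, Complex.norm_real, Real.norm_eq_abs, abs_of_pos hh,
      inv_mul_le_iff₀ hh]
    refine (K.norm_err_le k x hh.le).trans ?_
    calc _ ≤ K.errC * (K.valC 0 (Pi.single k 1) * h) := by
          have := K.errC_nonneg
          gcongr
          exact K.integral_norm_Aval_le _ _ x hh.le
      _ = _ := by ring

theorem memH_one_pot (k : Fin 2) : MemH 1 (K.pot k) := by
  obtain ⟨G, hG, -⟩ := K.exists_weakDeriv_pot k
  exact ⟨K.memLp_pot k, _, hG, (Lp.memLp G).sub (K.memLp_errLim k)⟩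

/-! #### Second order regularity -/

/-- The row `(1, 0)` at `s = 0` is Lipschitz in `x`. -/
theorem exists_lipschitz_diag : ∃ C : ℝ, 0 ≤ C ∧ ∀ x h, 0 ≤ h →
    ‖K.Aval 1 0 (x + h) 0 - K.Aval 1 0 x 0‖ ≤ C * h := by
  have hC := K.C_nonneg
  have hv := K.valC_nonneg 1 0
  have hP := K.aprioriC_pos
  set N := K.valC 1 0 with hN
  have hcross : ∀ x h, 0 ≤ h → ∀ k, ∫ s, ‖crossL h (K.D 1 0 x k) s‖ ≤ N * h := fun x h hh k => by
    rw [(integrable_crossL hh _ (K.D_ae 1 0 x k) (K.continuous_Dval 1 0 x k)).2]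
    calc _ ≤ ∫ s in (0 : ℝ)..h, N := intervalIntegral.integral_mono_on hh
          ((K.continuous_Dval 1 0 x k).norm.intervalIntegrable _ _) intervalIntegrable_const
          fun s _ => K.norm_Dval_le 1 0 x k s
      _ = N * h := by simp [mul_comm]
  refine ⟨2 * (K.C * (K.aprioriC * (2 * (N * K.C))) + K.C * N), by positivity, fun x h hh => ?_⟩
  have e : ∀ k, ⟪shift (x + h) (K.fb k), halfProj (K.D 1 0 (x + h) k)⟫
      - ⟪shift x (K.fb k), halfProj (K.D 1 0 x k)⟫
      = ⟪shift (x + h) (K.fb k), halfProj (K.D 1 0 (x + h) k - shift h (K.D 1 0 x k))⟫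
        - ⟪shift (x + h) (K.fb k), crossL h (K.D 1 0 x k)⟫ := fun k => by
    have : ⟪shift x (K.fb k), halfProj (K.D 1 0 x k)⟫
        = ⟪shift (x + h) (K.fb k), shift h (halfProj (K.D 1 0 x k))⟫ := by
      rw [add_comm x h, ← shift_shift, inner_shift_shift]
    rw [this, crossL, map_sub, inner_sub_right, inner_sub_right]
    ring
  have b1 : ∀ k, ‖⟪shift (x + h) (K.fb k),
      halfProj (K.D 1 0 (x + h) k - shift h (K.D 1 0 x k))⟫‖
      ≤ K.C * (K.aprioriC * (2 * (N * h * K.C))) := fun k => by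
    refine (K.norm_inner_fb_le k _ _).trans ?_
    gcongr
    refine ((K.sol_increment_left 1 x h).norm_le.2 k).trans ?_
    gcongr
    have : ∀ j, ‖shift (x + h) (K.Γ j (crossL h (K.D 1 0 x j)))‖ ≤ N * h * K.C := fun j => by
      rw [norm_shift, ← K.adjoint_Γs]
      refine ((K.hankel_Γs j).norm_adjoint_le (integrable_crossL hh _ (K.D_ae 1 0 x j)
        (K.continuous_Dval 1 0 x j)).1 (hcross x h hh j)).trans ?_
      gcongr
      exact K.norm_f j
    simp only [Pi.zero_apply, norm_zero, Finset.sum_const_zero, add_zero, norm_neg]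
    refine (norm_sum_le _ _).trans ?_
    rw [Fin.sum_univ_two]
    linarith [this 0, this 1]
  have b2 : ∀ k, ‖⟪shift (x + h) (K.fb k), crossL h (K.D 1 0 x k)⟫‖ ≤ K.C * (N * h) := fun k => by
    have hi := (integrable_crossL hh _ (K.D_ae 1 0 x k) (K.continuous_Dval 1 0 x k)).1
    rw [L2.inner_def]
    refine (norm_integral_le_integral_norm _).trans ?_
    calc _ ≤ ∫ s, K.C * ‖crossL h (K.D 1 0 x k) s‖ := by
          refine integral_mono_ae (L2.integrable_inner _ _).norm (hi.norm.const_mul _) ?_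
          filter_upwards [coeFn_shift (x + h) (K.fb k), ae_comp_add (x + h) (K.fb_ae k)]
            with s h1 h2
          refine (norm_inner_le_norm _ _).trans ?_
          rw [h1, h2, RCLike.norm_conj]
          gcongr
          exact K.bdd k _
      _ ≤ _ := by
          rw [integral_const_mul]
          gcongr
          exact hcross x h hh k
  have e' : K.Aval 1 0 (x + h) 0 - K.Aval 1 0 x 0
      = -∑ k, (⟪shift (x + h) (K.fb k), halfProj (K.D 1 0 (x + h) k)⟫
      - ⟪shift x (K.fb k), halfProj (K.D 1 0 x k)⟫) := by
    simp only [Aval, Pi.zero_apply, zero_mul, Finset.sum_const_zero, zero_add, add_zero,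
      Finset.sum_sub_distrib]
    ring
  rw [e', norm_neg]
  refine (norm_sum_le _ _).trans ?_
  simp_rw [e]
  rw [Fin.sum_univ_two]
  have b3 := fun k => (norm_sub_le _ _).trans (add_le_add (b1 k) (b2 k))
  calc _ ≤ _ := add_le_add (b3 0) (b3 1)
    _ = _ := by ring

theorem norm_toLp_le_of_le {f : L2R} {c₁ c₂ : ℝ} {g₁ g₂ : L2R} (h1 : 0 ≤ c₁) (h2 : 0 ≤ c₂)
    (h : ∀ᵐ x, ‖f x‖ ≤ c₁ * ‖g₁ x‖ + c₂ * ‖g₂ x‖) : ‖f‖ ≤ c₁ * ‖g₁‖ + c₂ * ‖g₂‖ := by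
  have m1 : MemLp (fun x => ((‖g₁ x‖ : ℝ) : ℂ)) 2 :=
    ((Lp.memLp g₁).norm).ofReal
  have m2 : MemLp (fun x => ((‖g₂ x‖ : ℝ) : ℂ)) 2 :=
    ((Lp.memLp g₂).norm).ofReal
  have n1 : ‖m1.toLp _‖ ≤ ‖g₁‖ := Lp.norm_le_norm_of_ae_le (by
    filter_upwards [m1.coeFn_toLp] with x hx
    rw [hx, Complex.norm_real, norm_norm])
  have n2 : ‖m2.toLp _‖ ≤ ‖g₂‖ := Lp.norm_le_norm_of_ae_le (by
    filter_upwards [m2.coeFn_toLp] with x hx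
    rw [hx, Complex.norm_real, norm_norm])
  have n3 : ‖f‖ ≤ ‖(c₁ : ℂ) • m1.toLp _ + (c₂ : ℂ) • m2.toLp _‖ := Lp.norm_le_norm_of_ae_le (by
    filter_upwards [h, Lp.coeFn_add ((c₁ : ℂ) • m1.toLp _) ((c₂ : ℂ) • m2.toLp _),
      Lp.coeFn_smul (c₁ : ℂ) (m1.toLp _), Lp.coeFn_smul (c₂ : ℂ) (m2.toLp _), m1.coeFn_toLp,
      m2.coeFn_toLp] with x e1 e2 e3 e4 e5 e6
    rw [e2, Pi.add_apply, e3, e4, Pi.smul_apply, Pi.smul_apply, e5, e6, smul_eq_mul, smul_eq_mul]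
    norm_cast
    rw [Real.norm_of_nonneg (by positivity)]
    exact e1)
  refine n3.trans ((norm_add_le _ _).trans ?_)
  rw [norm_smul, norm_smul, Complex.norm_real, Complex.norm_real, Real.norm_of_nonneg h1,
    Real.norm_of_nonneg h2]
  gcongr

/-- The integrated mass of the row near `s = 0`. -/
noncomputable def mass (k : Fin 2) (δ x : ℝ) : ℂ :=
  ((∫ s in (0 : ℝ)..δ, ‖K.Aval 0 (Pi.single k 1) x s‖ : ℝ) : ℂ)

theorem norm_mass (k : Fin 2) {δ : ℝ} (hδ : 0 ≤ δ) (x : ℝ) :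
    ‖K.mass k δ x‖ = ∫ s in (0 : ℝ)..δ, ‖K.Aval 0 (Pi.single k 1) x s‖ := by
  rw [mass, Complex.norm_real, Real.norm_of_nonneg
    (intervalIntegral.integral_nonneg hδ fun _ _ => norm_nonneg _)]

theorem exists_mass_bound (k : Fin 2) : ∃ C : ℝ, 0 ≤ C ∧ ∀ δ, 0 < δ →
    ∃ h : MemLp (K.mass k δ) 2, ‖h.toLp _‖ ≤ C * δ := by
  obtain ⟨C, hC0, hC⟩ := K.exists_L2_Aval
  refine ⟨√C, Real.sqrt_nonneg _, fun δ hδ => ?_⟩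
  obtain ⟨h1, h2⟩ := integral_sq_intervalIntegral_le
    (K.continuous_Aval_uncurry 0 (Pi.single k 1)) hδ (fun s hs => (hC k s hs).1)
    (fun s hs => (hC k s hs).2)
  have hc : Continuous (K.mass k δ) := by
    refine Complex.continuous_ofReal.comp ?_
    exact intervalIntegral.continuous_parametric_intervalIntegral_of_continuous'
      (by exact (K.continuous_Aval_uncurry 0 (Pi.single k 1)).norm) _ _
  have hm : MemLp (K.mass k δ) 2 := by
    rw [memLp_two_iff_integrable_sq_norm hc.aestronglyMeasurable]
    simp_rw [K.norm_mass k hδ.le]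
    exact h1
  refine ⟨hm, norm_toLp_le _ (by positivity) ?_⟩
  simp_rw [K.norm_mass k hδ.le]
  rw [mul_pow, Real.sq_sqrt hC0]
  exact h2

/-- The limit of the error is Lipschitz under translations. -/
theorem exists_lipschitz_errLim (k : Fin 2) : ∃ C : ℝ, ∀ δ, 0 < δ →
    ‖shift δ ((K.memLp_errLim k).toLp _) - (K.memLp_errLim k).toLp _‖ ≤ C * δ := by
  obtain ⟨C1, hC1, h1⟩ := K.exists_L2_difference
  obtain ⟨C2, hC2, h2⟩ := K.exists_mass_bound k
  obtain ⟨C3, hC3, h3⟩ := K.exists_lipschitz_diag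
  have hv := K.valC_nonneg 1 0
  have hE := K.errC_nonneg
  set U := ‖(K.memLp_pot k).toLp _‖ with hU
  refine ⟨K.valC 1 0 * (C1 + K.errC * C2) + C3 * U, fun δ hδ => ?_⟩
  obtain ⟨hm, hm'⟩ := h2 δ hδ
  have hd : MemLp (fun x => K.Aval 0 (Pi.single k 1) x δ - K.Aval 0 (Pi.single k 1) x 0) 2 := by
    exact (memLp_two_iff_integrable_sq_norm ((K.continuous_Aval_left _ _ _).sub
      (K.continuous_Aval_left _ _ _)).aestronglyMeasurable).mpr (h1 k δ hδ.le).1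
  have hd' : ‖hd.toLp _‖ ≤ C1 * δ := norm_toLp_le _ (by positivity) (h1 k δ hδ.le).2
  have hw : ‖shift δ ((K.memLp_pot k).toLp _) - (K.memLp_pot k).toLp _‖
      ≤ 1 * ‖hd.toLp _‖ + K.errC * ‖hm.toLp _‖ := by
    apply norm_toLp_le_of_le (by norm_num) hE
    filter_upwards [Lp.coeFn_sub (shift δ ((K.memLp_pot k).toLp _)) ((K.memLp_pot k).toLp _),
      coeFn_shift δ ((K.memLp_pot k).toLp _), (K.memLp_pot k).coeFn_toLp,
      ae_comp_add δ (K.memLp_pot k).coeFn_toLp, hd.coeFn_toLp, hm.coeFn_toLp]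
      with x e1 e2 e3 e4 e5 e6
    rw [e1, Pi.sub_apply, e2, e3, e4, e5, e6, K.norm_mass k hδ.le, one_mul]
    have : K.pot k (x + δ) - K.pot k x
        = -(K.Aval 0 (Pi.single k 1) x δ - K.Aval 0 (Pi.single k 1) x 0) - K.err k δ x := by
      rw [pot, pot, err]; ring
    rw [this]
    refine (norm_sub_le _ _).trans ?_
    rw [norm_neg]
    gcongr
    exact K.norm_err_le k x hδ.le
  have hp : ‖shift δ ((K.memLp_errLim k).toLp _) - (K.memLp_errLim k).toLp _‖
      ≤ K.valC 1 0 * ‖shift δ ((K.memLp_pot k).toLp _) - (K.memLp_pot k).toLp _‖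
        + (C3 * δ) * U := by
    apply norm_toLp_le_of_le hv (by positivity)
    filter_upwards [Lp.coeFn_sub (shift δ ((K.memLp_pot k).toLp _)) ((K.memLp_pot k).toLp _),
      coeFn_shift δ ((K.memLp_pot k).toLp _), (K.memLp_pot k).coeFn_toLp,
      ae_comp_add δ (K.memLp_pot k).coeFn_toLp,
      Lp.coeFn_sub (shift δ ((K.memLp_errLim k).toLp _)) ((K.memLp_errLim k).toLp _),
      coeFn_shift δ ((K.memLp_errLim k).toLp _), (K.memLp_errLim k).coeFn_toLp,
      ae_comp_add δ (K.memLp_errLim k).coeFn_toLp] with x e1 e2 e3 e4 e5 e6 e7 e8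
    rw [e1, e5, Pi.sub_apply, Pi.sub_apply, e2, e6, e3, e4, e7, e8, errLim, errLim]
    have : K.pot k (x + δ) * K.Aval 1 0 (x + δ) 0 - K.pot k x * K.Aval 1 0 x 0
        = K.Aval 1 0 (x + δ) 0 * (K.pot k (x + δ) - K.pot k x)
          + (K.Aval 1 0 (x + δ) 0 - K.Aval 1 0 x 0) * K.pot k x := by ring
    rw [this]
    refine (norm_add_le _ _).trans ?_
    rw [norm_mul, norm_mul]
    gcongr
    · exact K.norm_Aval_le _ _ _ _
    · exact h3 x δ hδ.le
  refine hp.trans ?_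
  calc _ ≤ K.valC 1 0 * (1 * (C1 * δ) + K.errC * (C2 * δ)) + (C3 * δ) * U := by
        gcongr
        exact hw.trans (by gcongr)
    _ = _ := by ring

variable {K}

theorem Smooth.exists_lipschitz_quot {C₂ : ℝ} (hK : K.Smooth C₂) (k : Fin 2) :
    ∃ C : ℝ, ∀ δ, 0 < δ → ∀ h, 0 < h →
    ‖shift δ ((K.memLp_quot k h).toLp _) - (K.memLp_quot k h).toLp _‖ ≤ C * δ := by
  obtain ⟨C1, hC1, h1⟩ := hK.exists_L2_second_difference
  obtain ⟨C2, hC2, h2⟩ := K.exists_mass_bound k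
  have hE := K.errC_nonneg
  have hC := K.C_nonneg
  refine ⟨C1 + K.errC * C2, fun δ hδ h hh => ?_⟩
  obtain ⟨hm, hm'⟩ := h2 δ hδ
  have hd : MemLp (fun x => K.Aval 0 (Pi.single k 1) x (h + δ) - K.Aval 0 (Pi.single k 1) x h
      - K.Aval 0 (Pi.single k 1) x δ + K.Aval 0 (Pi.single k 1) x 0) 2 := by
    exact (memLp_two_iff_integrable_sq_norm ((((K.continuous_Aval_left _ _ _).sub
      (K.continuous_Aval_left _ _ _)).sub (K.continuous_Aval_left _ _ _)).add
      (K.continuous_Aval_left _ _ _)).aestronglyMeasurable).mpr (h1 k δ h hδ.le hh.le).1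
  have hd' : ‖hd.toLp _‖ ≤ C1 * δ * h :=
    norm_toLp_le _ (by positivity) (h1 k δ h hδ.le hh.le).2
  have key : ∀ x, ‖(K.Aval 0 (Pi.single k 1) (x + δ) h - K.Aval 0 (Pi.single k 1) x (h + δ))
      - (K.Aval 0 (Pi.single k 1) (x + δ) 0 - K.Aval 0 (Pi.single k 1) x (0 + δ))‖
      ≤ h * K.errC * ∫ s in (0 : ℝ)..δ, ‖K.Aval 0 (Pi.single k 1) x s‖ := fun x => by
    rw [K.Aval_increment, K.Aval_increment, add_zero, sub_neg_eq_add, neg_add_eq_sub,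
      ← Finset.sum_sub_distrib]
    refine (norm_sum_le _ _).trans ?_
    have hj : ∀ j, ‖⟪shift (x + δ) (K.fb j),
          halfProj ((K.D 0 (Pi.single k 1) (x + δ) - K.D 0 (Pi.single k 1) x) j)⟫
        - ⟪shift (x + δ + h) (K.fb j),
          halfProj ((K.D 0 (Pi.single k 1) (x + δ) - K.D 0 (Pi.single k 1) x) j)⟫‖
        ≤ K.C * h * (K.aprioriC * (2 * K.C)
          * ∫ s in (0 : ℝ)..δ, ‖K.Aval 0 (Pi.single k 1) x s‖) := fun j => by
      rw [← inner_sub_left, ← shift_shift (x + δ) h, ← map_sub]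
      refine (IsHankel.norm_inner_le _ _).trans ?_
      gcongr
      · rw [norm_sub_rev]
        have := K.lip_fb j h
        rwa [abs_of_pos hh] at this
      · exact K.norm_halfProj_increment_le _ x hδ.le j
    rw [Fin.sum_univ_two, errC]
    calc _ ≤ _ := add_le_add (hj 0) (hj 1)
      _ = _ := by ring
  have hw : ‖shift δ ((K.memLp_quot k h).toLp _) - (K.memLp_quot k h).toLp _‖
      ≤ h⁻¹ * ‖hd.toLp _‖ + K.errC * ‖hm.toLp _‖ := by
    apply norm_toLp_le_of_le (by positivity) hE
    filter_upwards [Lp.coeFn_sub (shift δ ((K.memLp_quot k h).toLp _)) ((K.memLp_quot k h).toLp _),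
      coeFn_shift δ ((K.memLp_quot k h).toLp _), (K.memLp_quot k h).coeFn_toLp,
      ae_comp_add δ (K.memLp_quot k h).coeFn_toLp, hd.coeFn_toLp, hm.coeFn_toLp]
      with x e1 e2 e3 e4 e5 e6
    rw [e1, Pi.sub_apply, e2, e3, e4, e5, e6, K.norm_mass k hδ.le, quot, quot, abs_of_pos hh]
    have hx := key x
    rw [zero_add] at hx
    have e : -(h⁻¹ : ℂ) * (K.Aval 0 (Pi.single k 1) (x + δ) h - K.Aval 0 (Pi.single k 1) (x + δ) 0)
        - -(h⁻¹ : ℂ) * (K.Aval 0 (Pi.single k 1) x h - K.Aval 0 (Pi.single k 1) x 0)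
        = -((h⁻¹ : ℝ) : ℂ) * ((K.Aval 0 (Pi.single k 1) x (h + δ) - K.Aval 0 (Pi.single k 1) x h
      - K.Aval 0 (Pi.single k 1) x δ + K.Aval 0 (Pi.single k 1) x 0)
        + ((K.Aval 0 (Pi.single k 1) (x + δ) h - K.Aval 0 (Pi.single k 1) x (h + δ))
      - (K.Aval 0 (Pi.single k 1) (x + δ) 0 - K.Aval 0 (Pi.single k 1) x δ))) := by
      push_cast; ring
    rw [e, norm_mul, norm_neg, Complex.norm_real, Real.norm_of_nonneg (by positivity)]
    calc _ ≤ h⁻¹ * (‖K.Aval 0 (Pi.single k 1) x (h + δ) - K.Aval 0 (Pi.single k 1) x h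
      - K.Aval 0 (Pi.single k 1) x δ + K.Aval 0 (Pi.single k 1) x 0‖
          + h * K.errC * ∫ s in (0 : ℝ)..δ, ‖K.Aval 0 (Pi.single k 1) x s‖) := by
          gcongr
          exact (norm_add_le _ _).trans (by gcongr)
      _ = _ := by field_simp
  calc _ ≤ h⁻¹ * (C1 * δ * h) + K.errC * (C2 * δ) := hw.trans (by gcongr)
    _ = _ := by field_simp

theorem Smooth.memH_two_pot {C₂ : ℝ} (hK : K.Smooth C₂) (k : Fin 2) : MemH 2 (K.pot k) := by
  obtain ⟨G, hG, hG2⟩ := K.exists_weakDeriv_pot k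
  obtain ⟨C1, h1⟩ := hK.exists_lipschitz_quot k
  obtain ⟨C2, h2⟩ := K.exists_lipschitz_errLim k
  set P := (K.memLp_errLim k).toLp _ with hP
  refine ⟨K.memLp_pot k, (G - P : L2R), ?_, memH_one_of_lipschitz (C := C1 + C2) fun δ hδ => ?_⟩
  · have e : (G - P : L2R) =ᵐ[volume] fun x => G x - K.errLim k x := by
      filter_upwards [Lp.coeFn_sub G P, (K.memLp_errLim k).coeFn_toLp] with x e1 e2
      rw [e1, Pi.sub_apply, e2]
    refine ⟨hG.1, (Lp.memLp _).locallyIntegrable (by norm_num), fun φ hφ hφc => ?_⟩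
    rw [hG.2.2 φ hφ hφc]
    congr 1
    apply integral_congr_ae
    filter_upwards [e] with x hx
    rw [hx]
  · have hGδ : ‖shift δ G - G‖ ≤ C1 * δ := hG2 δ _ (by
      filter_upwards [self_mem_nhdsWithin] with h hh
      exact h1 δ hδ h hh)
    have e : shift δ (G - P) - (G - P) = (shift δ G - G) - (shift δ P - P) := by
      rw [map_sub]; abel
    rw [e]
    refine (norm_sub_le _ _).trans ?_
    linarith [h2 δ hδ]

end KernelData

/-! ### Fourier transforms of square integrable functions and Hankel operators -/

/-- The plane wave `e^{2πiyξ}`. -/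
noncomputable def wave (y ξ : ℝ) : ℂ := exp (I * ((2 * Real.pi * y * ξ : ℝ) : ℂ))

theorem norm_wave (y ξ : ℝ) : ‖wave y ξ‖ = 1 := by
  rw [wave, mul_comm, norm_exp_ofReal_mul_I]

theorem wave_add (x y ξ : ℝ) : wave (x + y) ξ = wave x ξ * wave y ξ := by
  rw [wave, wave, wave, ← Complex.exp_add]
  push_cast
  ring_nf

theorem conj_wave (y ξ : ℝ) : conj (wave y ξ) = wave (-y) ξ := by
  rw [wave, wave, ← Complex.exp_conj, map_mul, conj_I, conj_ofReal]
  push_cast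
  ring_nf

theorem continuous_wave : Continuous fun p : ℝ × ℝ => wave p.1 p.2 := by
  unfold wave
  fun_prop

theorem continuous_wave_right (y : ℝ) : Continuous (wave y) :=
  continuous_wave.comp (Continuous.prodMk_right y)

theorem norm_wave_sub_one_le (y ξ : ℝ) : ‖wave y ξ - 1‖ ≤ 2 * Real.pi * |y| * |ξ| := by
  refine (Real.norm_exp_I_mul_ofReal_sub_one_le).trans (le_of_eq ?_)
  rw [Real.norm_eq_abs, abs_mul, abs_mul, abs_of_pos (by positivity : (0 : ℝ) < 2 * Real.pi)]

theorem fourierInv_eq_integral_wave (r : ℝ → ℂ) (y : ℝ) :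
    𝓕⁻ r y = ∫ ξ, wave y ξ * r ξ := by
  rw [Real.fourierInv_eq']
  congr 1 with ξ
  rw [wave, smul_eq_mul, mul_comm I]
  congr 4
  simp only [RCLike.inner_apply, conj_trivial]
  ring

theorem fourier_eq_integral_wave (r : ℝ → ℂ) (y : ℝ) :
    𝓕 r y = ∫ ξ, wave (-y) ξ * r ξ := by
  rw [← fourierInv_eq_integral_wave, Real.fourierInv_eq_fourier_neg, neg_neg]

theorem fourier_conj (r : ℝ → ℂ) (y : ℝ) : 𝓕 (fun ξ => conj (r ξ)) y = conj (𝓕⁻ r y) := by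
  rw [fourier_eq_integral_wave, fourierInv_eq_integral_wave, ← integral_conj]
  simp [conj_wave]

theorem memLp_wave_mul {r : ℝ → ℂ} {p : ℝ≥0∞} (h : MemLp r p) (y : ℝ) :
    MemLp (fun ξ => wave y ξ * r ξ) p := by
  refine h.of_le ((continuous_wave_right y).aestronglyMeasurable.mul h.1) (ae_of_all _ fun ξ => ?_)
  rw [norm_mul, norm_wave, one_mul]

theorem integrable_wave_mul {r : ℝ → ℂ} (h : Integrable r) (y : ℝ) :
    Integrable fun ξ => wave y ξ * r ξ :=
  memLp_one_iff_integrable.mp (memLp_wave_mul (memLp_one_iff_integrable.mpr h) y)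

theorem memLp_conj {r : ℝ → ℂ} {p : ℝ≥0∞} (h : MemLp r p) : MemLp (fun ξ => conj (r ξ)) p :=
  h.star

theorem shift_fourierInv_toLp {r : ℝ → ℂ} (h2 : MemLp r 2) (h1 : Integrable r) (h : ℝ)
    (h2' : MemLp (fun ξ => wave h ξ * r ξ) 2) :
    shift h (𝓕⁻ (h2.toLp r) : L2R) = 𝓕⁻ (h2'.toLp _) := by
  apply Lp.ext
  filter_upwards [coeFn_shift h (𝓕⁻ (h2.toLp r) : L2R), ae_comp_add h (Lp_fourierInv_ae_eq h2 h1),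
    Lp_fourierInv_ae_eq h2' (integrable_wave_mul h1 h)] with y e1 e2 e3
  rw [e1, e2, e3, fourierInv_eq_integral_wave, fourierInv_eq_integral_wave]
  congr 1 with ξ
  rw [wave_add, mul_assoc]

theorem shift_fourier_toLp {r : ℝ → ℂ} (h2 : MemLp r 2) (h1 : Integrable r) (h : ℝ)
    (h2' : MemLp (fun ξ => wave (-h) ξ * r ξ) 2) :
    shift h (𝓕 (h2.toLp r) : L2R) = 𝓕 (h2'.toLp _) := by
  apply Lp.ext
  filter_upwards [coeFn_shift h (𝓕 (h2.toLp r) : L2R), ae_comp_add h (Lp_fourier_ae_eq h2 h1),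
    Lp_fourier_ae_eq h2' (integrable_wave_mul h1 (-h))] with y e1 e2 e3
  rw [e1, e2, e3, fourier_eq_integral_wave, fourier_eq_integral_wave]
  congr 1 with ξ
  rw [neg_add, wave_add, mul_assoc]

/-- The inverse Fourier transform on `L²(ℝ)` as a bounded operator. -/
noncomputable def fourierInvOp : L2R →L[ℂ] L2R :=
  (Lp.fourierTransformₗᵢ ℝ ℂ).symm.toContinuousLinearEquiv.toContinuousLinearMap

theorem fourierInvOp_apply (γ : L2R) : fourierInvOp γ = 𝓕⁻ γ := rfl

theorem norm_fourierInv_L2 (γ : L2R) : ‖(𝓕⁻ γ : L2R)‖ = ‖γ‖ :=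
  (Lp.fourierTransformₗᵢ ℝ ℂ).symm.norm_map γ

theorem inner_fourierInv_left (β γ : L2R) : ⟪(𝓕⁻ β : L2R), γ⟫ = ⟪β, (𝓕 γ : L2R)⟫ := by
  rw [← Lp.inner_fourier_eq, FourierTransform.fourier_fourierInv_eq]

theorem inner_fourier_left (β γ : L2R) : ⟪(𝓕 β : L2R), γ⟫ = ⟪β, (𝓕⁻ γ : L2R)⟫ := by
  rw [← Lp.inner_fourier_eq β, FourierTransform.fourier_fourierInv_eq]

section Symbol

variable {r : ℝ → ℂ} (h2 : MemLp r 2) {B : ℝ} (hB : ∀ ξ, ‖r ξ‖ ≤ B)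

/-- The Hankel operator with symbol `r`. -/
noncomputable def hankelOp : L2R →L[ℂ] L2R :=
  fourierInvOp ∘L mulOp r h2.1 B hB ∘L fourierInvOp

theorem hankelOp_apply (γ : L2R) :
    hankelOp h2 hB γ = 𝓕⁻ (mulOp r h2.1 B hB (𝓕⁻ γ : L2R)) := rfl

theorem adjoint_hankelOp_apply (γ : L2R) :
    ContinuousLinearMap.adjoint (hankelOp h2 hB) γ
      = 𝓕 (mulOp (fun ξ => conj (r ξ)) (memLp_conj h2).1 B (by simpa using hB) (𝓕 γ : L2R)) := by
  apply ext_inner_left ℂ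
  intro β
  rw [ContinuousLinearMap.adjoint_inner_right, hankelOp_apply, inner_fourierInv_left,
    ← inner_conj_symm β, inner_fourier_left, inner_conj_symm, L2.inner_def, L2.inner_def]
  apply integral_congr_ae
  filter_upwards [coeFn_mulOp r h2.1 B hB (𝓕⁻ β : L2R),
    coeFn_mulOp (fun ξ => conj (r ξ)) (memLp_conj h2).1 B (by simpa using hB) (𝓕 γ : L2R)]
    with ξ e1 e2
  rw [e1, e2]
  simp only [RCLike.inner_apply, map_mul]
  ring

theorem isHankel_hankelOp (h1 : Integrable r) :
    IsHankel (𝓕 ((memLp_conj h2).toLp _) : L2R) (hankelOp h2 hB) := by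
  intro γ
  set g : L2R := 𝓕⁻ γ with hg
  have hp2 : MemLp (fun ξ => r ξ * g ξ) 2 :=
    (Lp.memLp (mulOp r h2.1 B hB g)).ae_eq (coeFn_mulOp r h2.1 B hB g)
  have hp1 : Integrable fun ξ => r ξ * g ξ := h2.integrable_mul (Lp.memLp g)
  have e : mulOp r h2.1 B hB g = hp2.toLp _ := by
    apply Lp.ext
    filter_upwards [coeFn_mulOp r h2.1 B hB g, hp2.coeFn_toLp] with ξ e1 e2
    rw [e1, e2]
  rw [hankelOp_apply, ← hg, e]
  filter_upwards [Lp_fourierInv_ae_eq hp2 hp1] with s hs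
  have hw := memLp_wave_mul (memLp_conj h2) (-s)
  rw [hs, shift_fourier_toLp (memLp_conj h2) (memLp_one_iff_integrable.mp
    (memLp_conj (memLp_one_iff_integrable.mpr h1))) s hw, inner_fourier_left, ← hg, L2.inner_def,
    fourierInv_eq_integral_wave]
  apply integral_congr_ae
  filter_upwards [hw.coeFn_toLp] with ξ e1
  rw [e1]
  simp only [RCLike.inner_apply, map_mul, conj_wave, neg_neg, RCLike.conj_conj]
  ring

theorem isHankel_adjoint_hankelOp (h1 : Integrable r) :
    IsHankel (𝓕⁻ (h2.toLp r) : L2R) (ContinuousLinearMap.adjoint (hankelOp h2 hB)) := by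
  intro γ
  have hB' : ∀ ξ, ‖conj (r ξ)‖ ≤ B := by simpa using hB
  set g : L2R := 𝓕 γ with hg
  have hp2 : MemLp (fun ξ => conj (r ξ) * g ξ) 2 :=
    (Lp.memLp (mulOp _ (memLp_conj h2).1 B hB' g)).ae_eq (coeFn_mulOp _ _ B hB' g)
  have hp1 : Integrable fun ξ => conj (r ξ) * g ξ := (memLp_conj h2).integrable_mul (Lp.memLp g)
  have e : mulOp _ (memLp_conj h2).1 B hB' g = hp2.toLp _ := by
    apply Lp.ext
    filter_upwards [coeFn_mulOp _ (memLp_conj h2).1 B hB' g, hp2.coeFn_toLp] with ξ e1 e2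
    rw [e1, e2]
  rw [adjoint_hankelOp_apply, ← hg, e]
  filter_upwards [Lp_fourier_ae_eq hp2 hp1] with s hs
  have hw := memLp_wave_mul h2 s
  rw [hs, shift_fourierInv_toLp h2 h1 s hw, inner_fourierInv_left, ← hg, L2.inner_def,
    fourier_eq_integral_wave]
  apply integral_congr_ae
  filter_upwards [hw.coeFn_toLp] with ξ e1
  rw [e1]
  simp only [RCLike.inner_apply, map_mul, conj_wave]
  ring

theorem norm_sq_adjoint_hankelOp (γ : L2R) :
    ‖ContinuousLinearMap.adjoint (hankelOp h2 hB) γ‖ ^ 2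
      = ∫ ξ, ‖r ξ‖ ^ 2 * ‖(𝓕 γ : L2R) ξ‖ ^ 2 := by
  rw [adjoint_hankelOp_apply, Lp.norm_fourier_eq, norm_sq_eq_integral]
  apply integral_congr_ae
  filter_upwards [coeFn_mulOp (fun ξ => conj (r ξ)) (memLp_conj h2).1 B (by simpa using hB)
    (𝓕 γ : L2R)] with ξ e1
  rw [e1, norm_mul, RCLike.norm_conj, mul_pow]

end Symbol

theorem fourier_conj_toLp {r : ℝ → ℂ} (h2 : MemLp r 2) (h1 : Integrable r) :
    (𝓕 ((memLp_conj h2).toLp _) : L2R) = star (𝓕⁻ (h2.toLp r) : L2R) := by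
  apply Lp.ext
  filter_upwards [Lp_fourier_ae_eq (memLp_conj h2) (memLp_one_iff_integrable.mp
    (memLp_conj (memLp_one_iff_integrable.mpr h1))), Lp_fourierInv_ae_eq h2 h1,
    Lp.coeFn_star (𝓕⁻ (h2.toLp r) : L2R)] with y e1 e2 e3
  rw [e1, e3, Pi.star_apply, e2, fourier_conj]
  rfl

theorem norm_star_L2R (f : L2R) : ‖star f‖ = ‖f‖ := by
  rw [Lp.norm_def, Lp.norm_def, eLpNorm_congr_ae (Lp.coeFn_star f), eLpNorm_star]

theorem star_sub_L2R (f g : L2R) : star (f - g) = star f - star g := by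
  apply Lp.ext
  filter_upwards [Lp.coeFn_star (f - g), Lp.coeFn_star f, Lp.coeFn_star g,
    Lp.coeFn_sub f g, Lp.coeFn_sub (star f) (star g)] with y e1 e2 e3 e4 e5
  rw [e1, e5, Pi.star_apply, e4, Pi.sub_apply, Pi.sub_apply, e2, e3, star_sub]
  rfl

theorem shift_star (h : ℝ) (f : L2R) : shift h (star f) = star (shift h f) := by
  apply Lp.ext
  filter_upwards [coeFn_shift h (star f), Lp.coeFn_star (shift h f), coeFn_shift h f,
    ae_comp_add h (Lp.coeFn_star f)] with y e1 e2 e3 e4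
  rw [e1, e2, e4, Pi.star_apply, Pi.star_apply, e3]

theorem norm_toLp_le_of_forall {f g : ℝ → ℂ} (hf : MemLp f 2) (hg : MemLp g 2) {c : ℝ}
    (h : ∀ ξ, ‖f ξ‖ ≤ c * ‖g ξ‖) : ‖hf.toLp f‖ ≤ c * ‖hg.toLp g‖ := by
  apply Lp.norm_le_mul_norm_of_ae_le_mul
  filter_upwards [hf.coeFn_toLp, hg.coeFn_toLp] with ξ e1 e2
  rw [e1, e2]
  exact h ξ

/-- Translates of an inverse Fourier transform. -/
theorem shift_fourierInv_sub {r : ℝ → ℂ} (h2 : MemLp r 2) (h1 : Integrable r) (h : ℝ)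
    (h2' : MemLp (fun ξ => (wave h ξ - 1) * r ξ) 2) :
    shift h (𝓕⁻ (h2.toLp r) : L2R) - 𝓕⁻ (h2.toLp r) = 𝓕⁻ (h2'.toLp _) := by
  have hw := memLp_wave_mul h2 h
  rw [shift_fourierInv_toLp h2 h1 h hw, ← fourierInvOp_apply, ← fourierInvOp_apply, ← map_sub,
    ← MemLp.toLp_sub, fourierInvOp_apply]
  congr 1
  apply (MemLp.toLp_eq_toLp_iff _ _).mpr
  exact ae_of_all _ fun ξ => by simp [sub_mul]

theorem memLp_wave_sub_one_mul {r : ℝ → ℂ} {p : ℝ≥0∞} (h : MemLp r p) (y : ℝ) :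
    MemLp (fun ξ => (wave y ξ - 1) * r ξ) p := by
  have := (memLp_wave_mul h y).sub h
  refine this.ae_eq (ae_of_all _ fun ξ => ?_)
  simp [sub_mul]

theorem norm_shift_fourierInv_sub_le {r : ℝ → ℂ} (h2 : MemLp r 2) (h1 : Integrable r)
    (hw : MemLp (fun ξ : ℝ => (ξ : ℂ) * r ξ) 2) (h : ℝ) :
    ‖shift h (𝓕⁻ (h2.toLp r) : L2R) - 𝓕⁻ (h2.toLp r)‖ ≤ 2 * Real.pi * |h| * ‖hw.toLp _‖ := by
  rw [shift_fourierInv_sub h2 h1 h (memLp_wave_sub_one_mul h2 h), norm_fourierInv_L2]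
  refine norm_toLp_le_of_forall _ _ fun ξ => ?_
  rw [norm_mul, norm_mul, ← mul_assoc, norm_real, Real.norm_eq_abs]
  gcongr
  exact norm_wave_sub_one_le h ξ

theorem norm_shift_shift_fourierInv_sub_le {r : ℝ → ℂ} (h2 : MemLp r 2) (h1 : Integrable r)
    (hw : MemLp (fun ξ : ℝ => (ξ : ℂ) ^ 2 * r ξ) 2) (δ h : ℝ) :
    ‖shift δ (shift h (𝓕⁻ (h2.toLp r) : L2R) - 𝓕⁻ (h2.toLp r))
        - (shift h (𝓕⁻ (h2.toLp r) : L2R) - 𝓕⁻ (h2.toLp r))‖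
      ≤ (2 * Real.pi) ^ 2 * ‖hw.toLp _‖ * |δ| * |h| := by
  have h2' := memLp_wave_sub_one_mul h2 h
  have h1' : Integrable fun ξ => (wave h ξ - 1) * r ξ := memLp_one_iff_integrable.mp
    (memLp_wave_sub_one_mul (memLp_one_iff_integrable.mpr h1) h)
  rw [shift_fourierInv_sub h2 h1 h h2',
    shift_fourierInv_sub h2' h1' δ (memLp_wave_sub_one_mul h2' δ), norm_fourierInv_L2]
  refine (norm_toLp_le_of_forall _ hw (c := (2 * Real.pi) ^ 2 * |δ| * |h|) fun ξ => ?_).trans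
    (le_of_eq (by ring))
  rw [norm_mul, norm_mul, norm_mul, norm_pow, norm_real, Real.norm_eq_abs]
  calc _ ≤ (2 * Real.pi * |δ| * |ξ|) * ((2 * Real.pi * |h| * |ξ|) * ‖r ξ‖) := by
        gcongr
        · exact norm_wave_sub_one_le δ ξ
        · exact norm_wave_sub_one_le h ξ
    _ = _ := by ring

/-- A square integrable function with square integrable first moment is integrable. -/
theorem integrable_of_moment {r : ℝ → ℂ} (h2 : MemLp r 2)
    (hw : MemLp (fun ξ : ℝ => (ξ : ℂ) * r ξ) 2) : Integrable r := by
  have hg : MemLp (fun ξ : ℝ => ((1 + |ξ|)⁻¹ : ℝ)) 2 := by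
    rw [memLp_two_iff_integrable_sq_norm (by fun_prop (disch := intros; positivity))]
    refine (integrable_inv_one_add_sq).mono' (by fun_prop (disch := intros; positivity))
      (ae_of_all _ fun ξ => ?_)
    rw [Real.norm_eq_abs, Real.norm_eq_abs, abs_of_nonneg (by positivity),
      abs_of_nonneg (by positivity), inv_pow]
    gcongr
    nlinarith [abs_nonneg ξ, sq_abs ξ]
  have hr : MemLp (fun ξ : ℝ => (1 + |ξ|) * ‖r ξ‖) 2 := by
    have := h2.norm.add hw.norm
    refine this.ae_eq (ae_of_all _ fun ξ => ?_)
    simp [add_mul]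
  have := hg.integrable_mul hr
  refine (integrable_norm_iff h2.1).mp (this.congr (ae_of_all _ fun ξ => ?_))
  have : (1 + |ξ|) ≠ 0 := by positivity
  simp only [Pi.mul_apply]
  field_simp

theorem continuous_fourierInv {r : ℝ → ℂ} (h1 : Integrable r) : Continuous (𝓕⁻ r : ℝ → ℂ) := by
  have : Continuous (𝓕 r : ℝ → ℂ) :=
    VectorFourier.fourierIntegral_continuous Real.continuous_fourierChar
      (by exact (innerSL ℝ).continuous₂) h1
  have e : (𝓕⁻ r : ℝ → ℂ) = fun y => 𝓕 r (-y) := funext fun y => Real.fourierInv_eq_fourier_neg r y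
  rw [e]
  exact this.comp continuous_neg

theorem norm_fourierInv_le (r : ℝ → ℂ) (y : ℝ) : ‖𝓕⁻ r y‖ ≤ ∫ ξ, ‖r ξ‖ := by
  rw [fourierInv_eq_integral_wave]
  refine (norm_integral_le_integral_norm _).trans (le_of_eq ?_)
  simp [norm_wave]

theorem norm_fourierInv_sub_le {r : ℝ → ℂ} (h1 : Integrable r)
    (hw : Integrable fun ξ : ℝ => (ξ : ℂ) * r ξ) (y h : ℝ) :
    ‖𝓕⁻ r (y + h) - 𝓕⁻ r y‖ ≤ (2 * Real.pi * ∫ ξ : ℝ, ‖(ξ : ℂ) * r ξ‖) * |h| := by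
  rw [fourierInv_eq_integral_wave, fourierInv_eq_integral_wave,
    ← integral_sub (integrable_wave_mul h1 _) (integrable_wave_mul h1 _)]
  calc _ ≤ ∫ ξ : ℝ, 2 * Real.pi * |h| * ‖(ξ : ℂ) * r ξ‖ := by
        refine norm_integral_le_of_norm_le (hw.norm.const_mul _) (ae_of_all _ fun ξ => ?_)
        have : wave (y + h) ξ * r ξ - wave y ξ * r ξ = wave y ξ * ((wave h ξ - 1) * r ξ) := by
          rw [wave_add]; ring
        rw [this, norm_mul, norm_wave, one_mul, norm_mul, norm_mul, norm_real, Real.norm_eq_abs,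
          ← mul_assoc]
        gcongr
        exact norm_wave_sub_one_le h ξ
    _ = _ := by rw [integral_const_mul]; ring

/-! ### Kernels with prescribed Fourier transform -/

/-- Weak derivatives can be tested against complex valued functions. -/
theorem HasWeakDeriv.integral_mul_deriv {f g : ℝ → ℂ} (h : HasWeakDeriv f g) {φ : ℝ → ℂ}
    (hφ : ContDiff ℝ ((⊤ : ℕ∞) : WithTop ℕ∞) φ) (hc : HasCompactSupport φ) :
    ∫ x, f x * deriv φ x = -∫ x, g x * φ x := by
  have hd : Differentiable ℝ φ := hφ.differentiable (by simp)
  have hcd : Continuous (deriv φ) := hφ.continuous_deriv (by simp)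
  have hre : ∀ x, deriv (fun t => (φ t).re) x = (deriv φ x).re := fun x =>
    (reCLM.hasFDerivAt.comp_hasDerivAt x (hd x).hasDerivAt).deriv
  have him : ∀ x, deriv (fun t => (φ t).im) x = (deriv φ x).im := fun x =>
    (imCLM.hasFDerivAt.comp_hasDerivAt x (hd x).hasDerivAt).deriv
  have h1 := h.2.2 (fun t => (φ t).re) (reCLM.contDiff.comp hφ) (hc.comp_left zero_re)
  have h2 := h.2.2 (fun t => (φ t).im) (imCLM.contDiff.comp hφ) (hc.comp_left zero_im)
  simp only [hre, him] at h1 h2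
  have hi : ∀ {u : ℝ → ℂ} {v : ℝ → ℝ}, LocallyIntegrable u → Continuous v →
      HasCompactSupport v → Integrable fun x => u x * ((v x : ℝ) : ℂ) := fun {u v} hu hv hvc => by
    have := hu.integrable_smul_right_of_hasCompactSupport (g := fun x => ((v x : ℝ) : ℂ))
      (continuous_ofReal.comp hv) (hvc.comp_left ofReal_zero)
    simpa [smul_eq_mul] using this
  have hcr := hi h.1 (continuous_re.comp hcd) (hc.deriv.comp_left zero_re)
  have hci := hi h.1 (continuous_im.comp hcd) (hc.deriv.comp_left zero_im)
  have hgr := hi h.2.1 (continuous_re.comp hφ.continuous) (hc.comp_left zero_re)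
  have hgi := hi h.2.1 (continuous_im.comp hφ.continuous) (hc.comp_left zero_im)
  simp only [Function.comp_def] at hcr hci hgr hgi
  have e1 : ∫ x, f x * deriv φ x
      = (∫ x, f x * (((deriv φ x).re : ℝ) : ℂ)) + (∫ x, f x * (((deriv φ x).im : ℝ) : ℂ)) * I := by
    rw [← integral_mul_const, ← integral_add hcr (hci.mul_const _)]
    congr 1 with x
    nth_rewrite 1 [← re_add_im (deriv φ x)]
    ring
  have e2 : ∫ x, g x * φ x
      = (∫ x, g x * (((φ x).re : ℝ) : ℂ)) + (∫ x, g x * (((φ x).im : ℝ) : ℂ)) * I := by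
    rw [← integral_mul_const, ← integral_add hgr (hgi.mul_const _)]
    congr 1 with x
    nth_rewrite 1 [← re_add_im (φ x)]
    ring
  rw [e1, e2, h1, h2]
  ring

theorem hasDerivAt_wave (y ξ : ℝ) :
    HasDerivAt (wave y) (2 * Real.pi * I * y * wave y ξ) ξ := by
  have : HasDerivAt (fun t : ℝ => I * ((2 * Real.pi * y * t : ℝ) : ℂ))
      (I * ((2 * Real.pi * y : ℝ) : ℂ)) ξ := by
    have h1 : HasDerivAt (fun t : ℝ => 2 * Real.pi * y * t) (2 * Real.pi * y) ξ := by
      simpa using (hasDerivAt_id ξ).const_mul (2 * Real.pi * y)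
    exact h1.ofReal_comp.const_mul I
  refine this.cexp.congr_deriv ?_
  rw [wave]
  push_cast
  ring

theorem contDiff_wave (y : ℝ) {n : WithTop ℕ∞} : ContDiff ℝ n (wave y) := by
  unfold wave
  have : ContDiff ℝ n fun t : ℝ => ((2 * Real.pi * y * t : ℝ) : ℂ) :=
    ofRealCLM.contDiff.comp (contDiff_const.mul contDiff_id)
  exact (contDiff_const.mul this).cexp

theorem exists_cutoff : ∃ χ : ℕ → ℝ → ℝ,
    (∀ n, ContDiff ℝ ((⊤ : ℕ∞) : WithTop ℕ∞) (χ n)) ∧ (∀ n, HasCompactSupport (χ n)) ∧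
    (∀ n x, |χ n x| ≤ 1) ∧ (∀ x, Tendsto (fun n => χ n x) atTop (𝓝 1)) ∧
    ∃ B : ℝ, ∀ n x, |deriv (χ n) x| ≤ B / (n + 1) := by
  let b : ContDiffBump (0 : ℝ) := ⟨1, 2, one_pos, one_lt_two⟩
  have hb : ContDiff ℝ ((⊤ : ℕ∞) : WithTop ℕ∞) b := b.contDiff
  have hpos : ∀ n : ℕ, (0 : ℝ) < n + 1 := fun n => by positivity
  obtain ⟨B, hB⟩ := b.hasCompactSupport.deriv.exists_bound_of_continuous
    (hb.continuous_deriv (by simp))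
  refine ⟨fun n x => b (((n : ℝ) + 1)⁻¹ * x), fun n => hb.comp (contDiff_const.mul contDiff_id),
    fun n => ?_, fun n x => ?_, fun x => ?_, B, fun n x => ?_⟩
  · exact b.hasCompactSupport.comp_homeomorph
      (Homeomorph.mulLeft₀ (((n : ℝ) + 1)⁻¹) (inv_ne_zero (hpos n).ne'))
  · rw [abs_of_nonneg b.nonneg]
    exact b.le_one
  · have h0 : Tendsto (fun n : ℕ => ((n : ℝ) + 1)⁻¹ * x) atTop (𝓝 0) := by
      simpa using (tendsto_one_div_add_atTop_nhds_zero_nat (𝕜 := ℝ)).mul_const x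
    have : b 0 = 1 := b.one_of_mem_closedBall (by simp [b])
    have h1 := (hb.continuous.tendsto 0).comp h0
    rwa [this] at h1
  · have hd : HasDerivAt (fun x => b (((n : ℝ) + 1)⁻¹ * x))
        (deriv b (((n : ℝ) + 1)⁻¹ * x) * ((n : ℝ) + 1)⁻¹) x := by
      have h1 : HasDerivAt (fun x => ((n : ℝ) + 1)⁻¹ * x) ((n : ℝ) + 1)⁻¹ x := by
        simpa using (hasDerivAt_id x).const_mul ((n : ℝ) + 1)⁻¹
      exact ((hb.differentiable (by simp) _).hasDerivAt).comp x h1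
    rw [hd.deriv, abs_mul, abs_of_pos (inv_pos.mpr (hpos n)), div_eq_mul_inv]
    gcongr
    exact hB _

/-- The inverse Fourier transform of a function with square integrable weak derivative has a
square integrable first moment. -/
theorem memLp_moment_fourierInv {r g : ℝ → ℂ} (h1 : Integrable r) (hg : MemLp g 2)
    (hw : HasWeakDeriv r g) : MemLp (fun y : ℝ => (y : ℂ) * 𝓕⁻ r y) 2 := by
  obtain ⟨χ, hχ, hχc, hχ1, hχl, B, hB⟩ := exists_cutoff
  have hcont : ∀ n, Continuous fun x => ((χ n x : ℝ) : ℂ) := fun n =>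
    continuous_ofReal.comp (hχ n).continuous
  have hχ1' : ∀ n x, ‖((χ n x : ℝ) : ℂ)‖ ≤ 1 := fun n x => by
    rw [norm_real, Real.norm_eq_abs]; exact hχ1 n x
  have hgn : ∀ n, MemLp (fun ξ => g ξ * (χ n ξ : ℂ)) 2 := fun n =>
    hg.of_le (hg.1.mul (hcont n).aestronglyMeasurable) (ae_of_all _ fun ξ => by
      rw [norm_mul]
      exact mul_le_of_le_one_right (norm_nonneg _) (hχ1' n ξ))
  have hgn1 : ∀ n, Integrable fun ξ => g ξ * (χ n ξ : ℂ) := fun n => by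
    have := (hg.locallyIntegrable (by norm_num)).integrable_smul_right_of_hasCompactSupport
      (g := fun x => ((χ n x : ℝ) : ℂ)) (hcont n) ((hχc n).comp_left ofReal_zero)
    simpa [smul_eq_mul] using this
  have hF := continuous_fourierInv h1
  have hid : ∀ n (y : ℝ), 2 * Real.pi * I * y * 𝓕⁻ (fun ξ => r ξ * (χ n ξ : ℂ)) y
      + (∫ ξ, r ξ * (wave y ξ * (deriv (χ n) ξ : ℝ)))
      = -𝓕⁻ (fun ξ => g ξ * (χ n ξ : ℂ)) y := fun n y => by
    have hφ : ContDiff ℝ ((⊤ : ℕ∞) : WithTop ℕ∞) fun ξ => wave y ξ * ((χ n ξ : ℝ) : ℂ) :=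
      (contDiff_wave y).mul (ofRealCLM.contDiff.comp (hχ n))
    have hφc : HasCompactSupport fun ξ => wave y ξ * ((χ n ξ : ℝ) : ℂ) :=
      ((hχc n).comp_left ofReal_zero).mul_left
    have hd : ∀ ξ, deriv (fun ξ => wave y ξ * ((χ n ξ : ℝ) : ℂ)) ξ
        = 2 * Real.pi * I * y * wave y ξ * (χ n ξ : ℂ) + wave y ξ * (deriv (χ n) ξ : ℝ) :=
      fun ξ => ((hasDerivAt_wave y ξ).mul
        (((hχ n).differentiable (by simp) ξ).hasDerivAt.ofReal_comp)).deriv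
    have := hw.integral_mul_deriv hφ hφc
    simp only [hd, mul_add] at this
    rw [integral_add] at this
    · rw [fourierInv_eq_integral_wave, fourierInv_eq_integral_wave, ← integral_const_mul]
      rw [show (fun ξ => r ξ * (2 * Real.pi * I * y * wave y ξ * (χ n ξ : ℂ)))
        = fun ξ => 2 * Real.pi * I * y * (wave y ξ * (r ξ * (χ n ξ : ℂ))) by ext ξ; ring,
        show (fun ξ => g ξ * (wave y ξ * (χ n ξ : ℂ)))
        = fun ξ => wave y ξ * (g ξ * (χ n ξ : ℂ)) by ext ξ; ring] at this
      exact this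
    · refine (h1.norm.const_mul (‖2 * Real.pi * I * (y : ℂ)‖)).mono'
        (h1.1.mul (((continuous_const.mul (continuous_wave_right y)).mul
          (hcont n)).aestronglyMeasurable)) (ae_of_all _ fun ξ => ?_)
      rw [norm_mul, norm_mul, norm_mul, norm_wave, mul_one, mul_comm]
      gcongr
      exact mul_le_of_le_one_right (norm_nonneg _) (hχ1' n ξ)
    · refine (h1.norm.mul_const (B / (n + 1))).mono'
        (h1.1.mul (((continuous_wave_right y).mul (continuous_ofReal.comp
          ((hχ n).continuous_deriv (by simp)))).aestronglyMeasurable)) (ae_of_all _ fun ξ => ?_)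
      rw [norm_mul, norm_mul, norm_wave, one_mul, norm_real, Real.norm_eq_abs]
      gcongr
      exact hB n ξ
  have hlim1 : ∀ y : ℝ, Tendsto (fun n => 𝓕⁻ (fun ξ => r ξ * (χ n ξ : ℂ)) y) atTop
      (𝓝 (𝓕⁻ r y)) := fun y => by
    simp only [fourierInv_eq_integral_wave]
    refine tendsto_integral_of_dominated_convergence (fun ξ => ‖r ξ‖) (fun n => ?_) h1.norm
      (fun n => ae_of_all _ fun ξ => ?_) (ae_of_all _ fun ξ => ?_)
    · exact (continuous_wave_right y).aestronglyMeasurable.mul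
        (h1.1.mul (hcont n).aestronglyMeasurable)
    · rw [norm_mul, norm_wave, one_mul, norm_mul]
      exact mul_le_of_le_one_right (norm_nonneg _) (hχ1' n ξ)
    · have := ((continuous_ofReal.tendsto 1).comp (hχl ξ)).const_mul (r ξ)
      simpa using this.const_mul (wave y ξ)
  have hlim2 : ∀ y : ℝ, Tendsto (fun n => ∫ ξ, r ξ * (wave y ξ * (deriv (χ n) ξ : ℝ))) atTop
      (𝓝 0) := fun y => by
    refine squeeze_zero_norm (a := fun n : ℕ => (∫ ξ, ‖r ξ‖) * (B / (n + 1))) (fun n => ?_) ?_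
    · rw [← integral_mul_const]
      refine norm_integral_le_of_norm_le (h1.norm.mul_const _) (ae_of_all _ fun ξ => ?_)
      rw [norm_mul, norm_mul, norm_wave, one_mul, norm_real, Real.norm_eq_abs]
      gcongr
      exact hB n ξ
    · have := ((tendsto_one_div_add_atTop_nhds_zero_nat (𝕜 := ℝ)).const_mul B).const_mul
        (∫ ξ, ‖r ξ‖)
      simpa [div_eq_mul_inv] using this
  have hlim : ∀ y : ℝ, Tendsto (fun n => -𝓕⁻ (fun ξ => g ξ * (χ n ξ : ℂ)) y) atTop
      (𝓝 (2 * Real.pi * I * y * 𝓕⁻ r y)) := fun y => by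
    have := ((hlim1 y).const_mul (2 * Real.pi * I * y)).add (hlim2 y)
    simpa only [hid, add_zero] using this
  have hnorm : ∀ n, eLpNorm (fun y => -𝓕⁻ (fun ξ => g ξ * (χ n ξ : ℂ)) y) 2 volume
      ≤ eLpNorm g 2 volume := fun n => by
    have e1 : eLpNorm (fun y => -𝓕⁻ (fun ξ => g ξ * (χ n ξ : ℂ)) y) 2 volume
        = eLpNorm (𝓕⁻ (fun ξ => g ξ * (χ n ξ : ℂ))) 2 volume := eLpNorm_neg (f := 𝓕⁻ _) ..
    rw [e1, ← eLpNorm_congr_ae (Lp_fourierInv_ae_eq (hgn n) (hgn1 n)), ← Lp.enorm_def,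
      ← ofReal_norm, norm_fourierInv_L2, ofReal_norm, Lp.enorm_def,
      eLpNorm_congr_ae (hgn n).coeFn_toLp]
    refine eLpNorm_mono_ae (ae_of_all _ fun ξ => ?_)
    rw [norm_mul]
    exact mul_le_of_le_one_right (norm_nonneg _) (hχ1' n ξ)
  have hmem : MemLp (fun y : ℝ => 2 * Real.pi * I * y * 𝓕⁻ r y) 2 := by
    refine ⟨by fun_prop, lt_of_le_of_lt (Lp.eLpNorm_lim_le_liminf_eLpNorm
      (fun n => (continuous_fourierInv (hgn1 n)).neg.aestronglyMeasurable) _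
      (ae_of_all _ hlim)) (lt_of_le_of_lt ?_ hg.2)⟩
    exact (liminf_le_liminf (Eventually.of_forall hnorm)).trans (by simp)
  have := hmem.const_mul ((2 * Real.pi * I)⁻¹ : ℂ)
  refine this.ae_eq (ae_of_all _ fun y => ?_)
  have hpi : (2 * Real.pi * I : ℂ) ≠ 0 := by simp [Real.pi_ne_zero]
  simp only
  rw [mul_assoc (2 * Real.pi * I : ℂ), inv_mul_cancel_left₀ hpi]

theorem memLp_fourierInv {r : ℝ → ℂ} (h2 : MemLp r 2) (h1 : Integrable r) :
    MemLp (𝓕⁻ r) 2 :=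
  (Lp.memLp (𝓕⁻ (h2.toLp r) : L2R)).ae_eq (Lp_fourierInv_ae_eq h2 h1)

theorem fourier_fourierInv_of_integrable {r : ℝ → ℂ} (hc : Continuous r) (h1 : Integrable r)
    (hF : Integrable (𝓕⁻ r)) : 𝓕 (𝓕⁻ r) = r := by
  refine hc.fourier_fourierInv_eq h1 (hF.comp_neg.congr (ae_of_all _ fun y => ?_))
  simp only [Real.fourierInv_eq_fourier_neg, neg_neg]

theorem memLp_comp_mul {f : ℝ → ℂ} (hc : Continuous f) (h2 : MemLp f 2) {c : ℝ} (h0 : c ≠ 0) :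
    MemLp (fun x => f (c * x)) 2 := by
  rw [memLp_two_iff_integrable_sq_norm (by fun_prop)]
  exact ((memLp_two_iff_integrable_sq_norm hc.aestronglyMeasurable).mp h2).comp_mul_left' h0

theorem fourierInv_comp_mul (ρ : ℝ → ℂ) {c : ℝ} (hc : 0 < c) (y : ℝ) :
    𝓕⁻ (fun ξ => ρ (c * ξ)) y = (c⁻¹ : ℝ) • 𝓕⁻ ρ (c⁻¹ * y) := by
  rw [fourierInv_eq_integral_wave, fourierInv_eq_integral_wave]
  have := Measure.integral_comp_mul_left (fun l => wave (c⁻¹ * y) l * ρ l) c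
  rw [abs_of_pos (inv_pos.mpr hc)] at this
  rw [← this]
  congr 1 with ξ
  congr 1
  rw [wave, wave]
  congr 3
  field_simp

/-- A continuous function vanishing at infinity with values below `1` is bounded away from `1`. -/
theorem exists_bound_of_tendsto_zero {h : ℝ → ℝ} (hc : Continuous h)
    (hl : Tendsto h (cocompact ℝ) (𝓝 0)) : ∃ m, (∀ x, h x ≤ m) ∧ ((∀ x, h x < 1) → m < 1) := by
  by_cases hz : ∃ x, 0 < h x
  · obtain ⟨x₀, hx₀⟩ := hz
    obtain ⟨x, hx⟩ := hc.exists_forall_ge' x₀ ((hl.eventually_lt_const hx₀).mono fun _ => le_of_lt)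
    exact ⟨h x, hx, fun H => H x⟩
  · push Not at hz
    exact ⟨0, hz, fun _ => one_pos⟩

/-- The kernels of the Marchenko system of the reflection coefficients `ρ`. -/
theorem exists_kernelData {ε : ℝ} (hε : ε = 1 ∨ ε = -1) {ρ : Fin 2 → ℝ → ℂ}
    (hc : ∀ k, Continuous (ρ k)) (hρ : ∀ k, MemWeightedH 1 1 (ρ k))
    (hdef : ε = -1 → ∀ l : ℝ, ∑ k, ‖ρ k l‖ ^ 2 < 1) :
    ∃ K : KernelData, K.ε = ε ∧ (∀ k, MemLp (K.F k) 2) ∧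
      (∀ k, MemLp (fun y : ℝ => (y : ℂ) * K.F k y) 2) ∧
      (∀ k, 𝓕 (K.F k) = fun ξ => ρ k (Real.pi * ξ)) ∧
      ((∀ k, MemWeightedH 0 2 (ρ k)) → ∃ C₂, K.Smooth C₂) := by
  have hpi := Real.pi_pos
  set r : Fin 2 → ℝ → ℂ := fun k ξ => ρ k (Real.pi * ξ) with hr
  have hrc : ∀ k, Continuous (r k) := fun k => (hc k).comp (continuous_const.mul continuous_id)
  have hρ2 : ∀ k, MemLp (ρ k) 2 := fun k => (hρ k).1.1
  have hρ1 : ∀ k, Integrable (ρ k) := fun k =>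
    integrable_of_moment (hρ2 k) (by simpa using (hρ k).2)
  have hr2 : ∀ k, MemLp (r k) 2 := fun k => memLp_comp_mul (hc k) (hρ2 k) hpi.ne'
  have hscale : ∀ k (n : ℕ), MemLp (fun x : ℝ => (x : ℂ) ^ n * ρ k x) 2 →
      MemLp (fun ξ : ℝ => (ξ : ℂ) ^ n * r k ξ) 2 := fun k n h => by
    have h1 := memLp_comp_mul (f := fun x : ℝ => (x : ℂ) ^ n * ρ k x)
      ((continuous_ofReal.pow n).mul (hc k)) h hpi.ne'
    refine (h1.const_mul ((Real.pi : ℂ) ^ n)⁻¹).ae_eq (ae_of_all _ fun ξ => ?_)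
    have : (Real.pi : ℂ) ≠ 0 := ofReal_ne_zero.mpr hpi.ne'
    simp only [hr]
    push_cast
    rw [mul_pow]
    field_simp
  have hrw : ∀ k, MemLp (fun ξ : ℝ => (ξ : ℂ) * r k ξ) 2 := fun k => by
    simpa using hscale k 1 (hρ k).2
  have hr1 : ∀ k, Integrable (r k) := fun k => integrable_of_moment (hr2 k) (hrw k)
  have hF2 : ∀ k, MemLp (𝓕⁻ (r k)) 2 := fun k => memLp_fourierInv (hr2 k) (hr1 k)
  have hFw : ∀ k, MemLp (fun y : ℝ => (y : ℂ) * 𝓕⁻ (r k) y) 2 := fun k => by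
    obtain ⟨g, hg, hg2⟩ := (hρ k).1.2
    have h1 := memLp_moment_fourierInv (hρ1 k) hg2 hg
    have h2 := memLp_comp_mul (f := fun y : ℝ => (y : ℂ) * 𝓕⁻ (ρ k) y)
      (continuous_ofReal.mul (continuous_fourierInv (hρ1 k))) h1 (inv_ne_zero hpi.ne')
    refine h2.ae_eq (ae_of_all _ fun y => ?_)
    simp only [hr]
    rw [fourierInv_comp_mul _ hpi, real_smul]
    push_cast
    ring
  have hF1 : ∀ k, Integrable (𝓕⁻ (r k)) := fun k => integrable_of_moment (hF2 k) (hFw k)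
  have hFr : ∀ k, 𝓕 (𝓕⁻ (r k)) = r k := fun k =>
    fourier_fourierInv_of_integrable (hrc k) (hr1 k) (hF1 k)
  have hr0 : ∀ k, Tendsto (r k) (cocompact ℝ) (𝓝 0) := fun k => by
    rw [← hFr k]
    exact Real.zero_at_infty_fourier _
  obtain ⟨m, hm, hm1⟩ := exists_bound_of_tendsto_zero (h := fun ξ => ∑ k, ‖r k ξ‖ ^ 2)
    (continuous_finsetSum _ fun k _ => ((hrc k).norm.pow 2))
    (by
      have := tendsto_finsetSum (Finset.univ : Finset (Fin 2)) fun k _ => (hr0 k).norm.pow 2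
      rwa [norm_zero, zero_pow two_ne_zero, Finset.sum_const_zero] at this)
  have hB : ∀ k ξ, ‖r k ξ‖ ≤ √m := fun k ξ => Real.le_sqrt_of_sq_le
    ((Finset.single_le_sum (f := fun k => ‖r k ξ‖ ^ 2) (fun _ _ => by positivity)
      (Finset.mem_univ k)).trans (hm ξ))
  set f : Fin 2 → L2R := fun k => 𝓕⁻ ((hr2 k).toLp (r k)) with hf
  have hstar : ∀ k, (𝓕 ((memLp_conj (hr2 k)).toLp _) : L2R) = star (f k) := fun k =>
    fourier_conj_toLp (hr2 k) (hr1 k)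
  have hlip_star : ∀ k h, shift h (star (f k)) - star (f k) = star (shift h (f k) - f k) :=
    fun k h => by rw [shift_star, star_sub_L2R]
  have hex : ∀ k, ∃ c : ℝ, (∀ y, ‖𝓕⁻ (r k) y‖ ≤ c) ∧ ‖f k‖ ≤ c ∧
      ∀ h, ‖shift h (f k) - f k‖ ≤ c * |h| := fun k => by
    refine ⟨max (∫ ξ, ‖r k ξ‖) (max ‖f k‖ (2 * Real.pi * ‖(hrw k).toLp _‖)),
      fun y => (norm_fourierInv_le _ y).trans (le_max_left _ _),
      (le_max_left _ _).trans (le_max_right _ _), fun h => ?_⟩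
    refine (norm_shift_fourierInv_sub_le (hr2 k) (hr1 k) (hrw k) h).trans ?_
    rw [mul_right_comm]
    gcongr
    exact (le_max_right _ _).trans (le_max_right _ _)
  choose c hc1 hc2 hc3 using hex
  have hc0 : ∀ k, 0 ≤ c k := fun k => (norm_nonneg _).trans (hc2 k)
  have hcs : ∀ k, c k ≤ ∑ k, c k := fun k =>
    Finset.single_le_sum (fun k _ => hc0 k) (Finset.mem_univ k)
  have hlip : ∀ k h, ‖shift h (f k) - f k‖ ≤ (∑ k, c k) * |h| := fun k h =>
    (hc3 k h).trans (by gcongr; exact hcs k)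
  let K : KernelData :=
    { ε := ε
      m := m
      f := f
      fb := fun k => star (f k)
      Γ := fun k => hankelOp (hr2 k) (hB k)
      hankel := fun k => by
        rw [← hstar k]
        exact isHankel_hankelOp (hr2 k) (hB k) (hr1 k)
      hankel_adj := fun k => isHankel_adjoint_hankelOp (hr2 k) (hB k) (hr1 k)
      bound := fun β => by
        have hi : ∀ k, Integrable fun ξ => ‖r k ξ‖ ^ 2 * ‖(𝓕 β : L2R) ξ‖ ^ 2 := fun k =>
          ((integrable_norm_sq (𝓕 β : L2R)).const_mul m).mono'
            (((hrc k).norm.pow 2).aestronglyMeasurable.mul (integrable_norm_sq _).1)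
            (ae_of_all _ fun ξ => by
              rw [Real.norm_eq_abs, abs_of_nonneg (by positivity)]
              gcongr
              exact (Finset.single_le_sum (f := fun k => ‖r k ξ‖ ^ 2)
                (fun _ _ => by positivity) (Finset.mem_univ k)).trans (hm ξ))
        simp_rw [norm_sq_adjoint_hankelOp]
        rw [← integral_finsetSum _ fun k _ => hi k, ← Lp.norm_fourier_eq β, norm_sq_eq_integral,
          ← integral_const_mul]
        refine integral_mono (integrable_finsetSum _ fun k _ => hi k)
          ((integrable_norm_sq _).const_mul m) fun ξ => ?_
        simp only
        rw [← Finset.sum_mul]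
        gcongr
        exact hm ξ
      sign := hε.imp_right fun h => ⟨h, hm1 fun ξ => hdef h _⟩
      F := fun k => 𝓕⁻ (r k)
      cont := fun k => continuous_fourierInv (hr1 k)
      f_ae := fun k => Lp_fourierInv_ae_eq (hr2 k) (hr1 k)
      fb_ae := fun k => by
        filter_upwards [Lp.coeFn_star (f k), Lp_fourierInv_ae_eq (hr2 k) (hr1 k)] with y e1 e2
        rw [e1, Pi.star_apply, e2]
        rfl
      C := ∑ k, c k
      bdd := fun k y => (hc1 k y).trans (hcs k)
      norm_f := fun k => (hc2 k).trans (hcs k)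
      norm_fb := fun k => by
        rw [norm_star_L2R]
        exact (hc2 k).trans (hcs k)
      lip_f := hlip
      lip_fb := fun k h => by
        rw [hlip_star, norm_star_L2R]
        exact hlip k h }
  refine ⟨K, rfl, hF2, hFw, hFr, fun h2 => ?_⟩
  have hrw2 : ∀ k, MemLp (fun ξ : ℝ => (ξ : ℂ) ^ 2 * r k ξ) 2 := fun k => hscale k 2 (h2 k).2
  have hrw1 : ∀ k, Integrable fun ξ : ℝ => (ξ : ℂ) * r k ξ := fun k =>
    integrable_of_moment (hrw k) ((hrw2 k).ae_eq (ae_of_all _ fun ξ => by ring))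
  have hd : ∀ k, ∃ d : ℝ, 0 ≤ d ∧ (∀ y h, ‖𝓕⁻ (r k) (y + h) - 𝓕⁻ (r k) y‖ ≤ d * |h|) ∧
      ∀ δ h, ‖shift δ (shift h (f k) - f k) - (shift h (f k) - f k)‖ ≤ d * |δ| * |h| := fun k => by
    refine ⟨max (2 * Real.pi * ∫ ξ : ℝ, ‖(ξ : ℂ) * r k ξ‖)
      ((2 * Real.pi) ^ 2 * ‖(hrw2 k).toLp _‖), le_max_of_le_right (by positivity),
      fun y h => (norm_fourierInv_sub_le (hr1 k) (hrw1 k) y h).trans (by gcongr; exact le_max_left _ _),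
      fun δ h => (norm_shift_shift_fourierInv_sub_le (hr2 k) (hr1 k) (hrw2 k) δ h).trans
        (by gcongr; exact le_max_right _ _)⟩
  choose d hd0 hd1 hd2 using hd
  have hds : ∀ k, d k ≤ ∑ k, d k := fun k =>
    Finset.single_le_sum (fun k _ => hd0 k) (Finset.mem_univ k)
  have hlip2 : ∀ k δ h, ‖shift δ (shift h (f k) - f k) - (shift h (f k) - f k)‖
      ≤ (∑ k, d k) * |δ| * |h| := fun k δ h => (hd2 k δ h).trans (by gcongr; exact hds k)
  refine ⟨∑ k, d k, Finset.sum_nonneg fun k _ => hd0 k,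
    fun k y h => (hd1 k y h).trans (by gcongr; exact hds k), hlip2, fun k δ h => ?_⟩
  change ‖shift δ (shift h (star (f k)) - star (f k)) - (shift h (star (f k)) - star (f k))‖ ≤ _
  rw [hlip_star, shift_star, ← star_sub_L2R, norm_star_L2R]
  exact hlip2 k δ h

/-! ### One-sided Fourier transforms in the half-planes -/

/-- The one-sided transform `∫_{s > 0} h(s) e^{-2izs} ds`, for `Im z ≤ 0`. -/
noncomputable def halfTransform (h : ℝ → ℂ) (z : ℂ) : ℂ :=
  ∫ s in Set.Ioi (0 : ℝ), h s * exp (-2 * I * z * s)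

theorem norm_exp_kernel (z : ℂ) (s : ℝ) : ‖exp (-2 * I * z * s)‖ = Real.exp (2 * z.im * s) := by
  rw [norm_exp]
  simp

theorem norm_exp_kernel_le_one {z : ℂ} (hz : z.im ≤ 0) {s : ℝ} (hs : 0 ≤ s) :
    ‖exp (-2 * I * z * s)‖ ≤ 1 := by
  rw [norm_exp_kernel]
  exact Real.exp_le_one_iff.mpr (by nlinarith)

theorem continuous_exp_kernel (z : ℂ) : Continuous fun s : ℝ => exp (-2 * I * z * s) := by
  fun_prop

section

variable {h : ℝ → ℂ}

theorem integrableOn_kernel (hi : Integrable h) {z : ℂ} (hz : z.im ≤ 0) :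
    IntegrableOn (fun s : ℝ => h s * exp (-2 * I * z * s)) (Set.Ioi 0) := by
  refine hi.integrableOn.norm.mono'
    (hi.1.restrict.mul (continuous_exp_kernel z).aestronglyMeasurable)
    ((ae_restrict_mem measurableSet_Ioi).mono fun s hs => ?_)
  rw [norm_mul]
  exact mul_le_of_le_one_right (norm_nonneg _) (norm_exp_kernel_le_one hz (le_of_lt hs))

theorem continuousOn_halfTransform (hi : Integrable h) :
    ContinuousOn (halfTransform h) {z : ℂ | z.im ≤ 0} := by
  refine continuousOn_of_dominated (bound := fun s => ‖h s‖) (fun z hz => ?_) (fun z hz => ?_)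
    hi.norm.integrableOn (ae_of_all _ fun s => by fun_prop)
  · exact (integrableOn_kernel hi hz).1
  · refine (ae_restrict_mem measurableSet_Ioi).mono fun s hs => ?_
    rw [norm_mul]
    exact mul_le_of_le_one_right (norm_nonneg _) (norm_exp_kernel_le_one hz (le_of_lt hs))

theorem differentiableAt_halfTransform (hi : Integrable h) {z : ℂ} (hz : z.im < 0) :
    DifferentiableAt ℂ (halfTransform h) z := by
  set η := -z.im / 2 with hη
  have hη0 : 0 < η := by rw [hη]; linarith
  have him : ∀ w ∈ Metric.ball z η, w.im ≤ -η := fun w hw => by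
    have h1 : |(w - z).im| < η := (abs_im_le_norm _).trans_lt (by simpa [dist_eq] using hw)
    rw [sub_im] at h1
    have := (abs_lt.mp h1).2
    linarith
  refine (hasDerivAt_integral_of_dominated_loc_of_deriv_le (μ := volume.restrict (Set.Ioi 0))
    (F := fun (z : ℂ) (s : ℝ) => h s * exp (-2 * I * z * s))
    (F' := fun (z : ℂ) (s : ℝ) => h s * (exp (-2 * I * z * s) * (-2 * I * s)))
    (bound := fun s => ‖h s‖ * η⁻¹) (Metric.ball_mem_nhds z hη0) ?_
    (integrableOn_kernel hi hz.le) ?_ ?_ ?_ ?_).2.differentiableAt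
  · exact Eventually.of_forall fun w =>
      hi.1.restrict.mul (continuous_exp_kernel w).aestronglyMeasurable
  · exact hi.1.restrict.mul (by fun_prop)
  · refine (ae_restrict_mem measurableSet_Ioi).mono fun s hs w hw => ?_
    have hs0 : (0 : ℝ) < s := hs
    rw [norm_mul, norm_mul, norm_exp_kernel]
    have e : ‖(-2 * I * s : ℂ)‖ = 2 * s := by
      simp [abs_of_pos hs0]
    rw [e]
    gcongr
    have h1 : Real.exp (2 * w.im * s) ≤ Real.exp (-(2 * η * s)) :=
      Real.exp_le_exp.mpr (by nlinarith [him w hw])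
    have h2 : 2 * η * s * Real.exp (-(2 * η * s)) ≤ 1 := by
      rw [Real.exp_neg, ← div_eq_mul_inv, div_le_one (Real.exp_pos _)]
      linarith [Real.add_one_le_exp (2 * η * s)]
    rw [← one_div, le_div_iff₀ hη0]
    calc Real.exp (2 * w.im * s) * (2 * s) * η
        ≤ Real.exp (-(2 * η * s)) * (2 * s) * η := by gcongr
      _ = 2 * η * s * Real.exp (-(2 * η * s)) := by ring
      _ ≤ 1 := h2
  · exact hi.norm.integrableOn.mul_const _
  · refine ae_of_all _ fun s w _ => ?_
    have : HasDerivAt (fun w : ℂ => -2 * I * w * s) (-2 * I * s) w := by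
      simpa using ((hasDerivAt_id w).const_mul (-2 * I)).mul_const (s : ℂ)
    exact this.cexp.const_mul _

theorem integral_exp_kernel {η : ℝ} (hη : 0 < η) :
    ∫ s in Set.Ioi (0 : ℝ), Real.exp (-(2 * η) * s) = (2 * η)⁻¹ := by
  have := integral_exp_mul_Ioi (a := -(2 * η)) (by linarith) 0
  rw [this]
  simp [neg_div_neg_eq]

theorem integrableOn_exp_kernel {η : ℝ} (hη : 0 < η) :
    IntegrableOn (fun s => Real.exp (-(2 * η) * s)) (Set.Ioi (0 : ℝ)) :=
  integrableOn_exp_mul_Ioi (by linarith) 0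

theorem norm_halfTransform_le {B : ℝ} (hB : ∀ s, ‖h s‖ ≤ B) {z : ℂ} (hz : z.im < 0) :
    ‖halfTransform h z‖ ≤ B * (2 * -z.im)⁻¹ := by
  have hη : 0 < -z.im := by linarith
  rw [← integral_exp_kernel hη, ← integral_const_mul]
  refine norm_integral_le_of_norm_le ((integrableOn_exp_kernel hη).const_mul B)
    (ae_of_all _ fun s => ?_)
  rw [norm_mul, norm_exp_kernel]
  have : 2 * z.im * s = -(2 * -z.im) * s := by ring
  rw [this]
  gcongr
  exact hB s

/-- Translation is continuous in `L¹`. -/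
theorem tendsto_integral_norm_sub_comp_add {H : ℝ → ℂ} (hH : Integrable H) :
    Tendsto (fun τ : ℝ => ∫ s, ‖H (s + τ) - H s‖) (𝓝 0) (𝓝 0) := by
  have h1 : MemLp H 1 := memLp_one_iff_integrable.mpr hH
  let g : C(ℝ, C(ℝ, ℝ)) := (ContinuousMap.mk (fun a : ℝ × ℝ => a.2 + a.1) (by fun_prop)).curry
  have hcont : Continuous fun τ : ℝ => Lp.compMeasurePreserving (fun s : ℝ => s + τ)
      (measurePreserving_add_right volume τ) (h1.toLp H) :=
    (continuous_const (y := h1.toLp H)).compMeasurePreservingLp g.continuous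
      (fun τ => measurePreserving_add_right volume τ) (by norm_num)
  have hn : ∀ τ, ‖Lp.compMeasurePreserving (fun s : ℝ => s + τ)
      (measurePreserving_add_right volume τ) (h1.toLp H) - h1.toLp H‖
      = ∫ s, ‖H (s + τ) - H s‖ := fun τ => by
    rw [L1.norm_eq_integral_norm]
    apply integral_congr_ae
    filter_upwards [Lp.coeFn_sub (Lp.compMeasurePreserving (fun s : ℝ => s + τ)
      (measurePreserving_add_right volume τ) (h1.toLp H)) (h1.toLp H),
      Lp.coeFn_compMeasurePreserving (h1.toLp H) (measurePreserving_add_right volume τ),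
      h1.coeFn_toLp, ae_comp_add τ h1.coeFn_toLp] with s e1 e2 e3 e4
    rw [e1, Pi.sub_apply, e2, Function.comp_apply, e3, e4]
  have h2 := ((hcont.sub continuous_const).norm).tendsto 0 (f := fun τ =>
    ‖Lp.compMeasurePreserving (fun s : ℝ => s + τ)
      (measurePreserving_add_right volume τ) (h1.toLp H) - h1.toLp H‖)
  rw [hn 0] at h2
  simp only [hn] at h2
  simpa using h2

theorem norm_halfTransform_le_translate (hi : Integrable h) {z : ℂ} (hz : z.im ≤ 0)
    {τ : ℝ} (hτ : 0 ≤ τ) (h1 : 2 * |z.re| * τ = Real.pi) :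
    ‖halfTransform h z‖ ≤ ∫ s, ‖(Set.Ioi 0).indicator h (s + τ) - (Set.Ioi 0).indicator h s‖ := by
  set H := (Set.Ioi (0 : ℝ)).indicator h with hH
  have hHi : Integrable H := hi.indicator measurableSet_Ioi
  set E : ℝ → ℂ := fun s => exp (-2 * I * z * s) with hE
  have hHE : Integrable fun s => H s * E s := by
    have := (integrableOn_kernel hi hz).integrable_indicator measurableSet_Ioi
    refine this.congr (ae_of_all _ fun s => ?_)
    by_cases hs : s ∈ Set.Ioi (0 : ℝ) <;> simp [hH, hE, hs]
  have e1 : halfTransform h z = ∫ s, H s * E s := by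
    rw [halfTransform, ← integral_indicator measurableSet_Ioi]
    congr 1 with s
    by_cases hs : s ∈ Set.Ioi (0 : ℝ) <;> simp [hH, hE, hs]
  have hEadd : ∀ s, E (s + τ) = E s * E τ := fun s => by
    simp only [hE]
    rw [← Complex.exp_add]
    push_cast
    ring_nf
  have hEn : ∀ s, ‖E s‖ = Real.exp (2 * z.im * s) := norm_exp_kernel z
  set q := Real.exp (2 * z.im * τ) with hq
  have hq0 : 0 < q := Real.exp_pos _
  have hEτ : E τ = -(q : ℂ) := by
    have h2 : (-2 * I * z * τ : ℂ) = ((2 * z.im * τ : ℝ) : ℂ) + ((-(2 * z.re * τ) : ℝ) : ℂ) * I := by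
      nth_rewrite 1 [← re_add_im z]
      push_cast
      linear_combination (-2 * (z.im : ℂ) * τ) * I_sq
    simp only [hE]
    rw [h2, Complex.exp_add, ← ofReal_exp, ← hq]
    rcases abs_cases z.re with ⟨h3, -⟩ | ⟨h3, -⟩ <;> rw [h3] at h1
    · rw [h1, ofReal_neg, neg_mul, Complex.exp_neg, exp_pi_mul_I]
      norm_num
    · have : -(2 * z.re * τ) = Real.pi := by linarith
      rw [this, exp_pi_mul_I]
      ring
  have hHE' : Integrable fun s => H (s + τ) * E s := by
    have := (hHE.comp_add_right τ).mul_const (E τ)⁻¹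
    refine this.congr (ae_of_all _ fun s => ?_)
    have hne : E τ ≠ 0 := by rw [hEτ]; simp [hq0.ne']
    simp only [hEadd]
    field_simp
  have e2 : ∫ s, H (s + τ) * E s = -(q⁻¹ : ℂ) * halfTransform h z := by
    have h3 := integral_add_right_eq_self (μ := volume) (fun s => H s * E s) τ
    rw [e1, ← h3, ← integral_const_mul]
    congr 1 with s
    rw [hEadd, hEτ]
    have : (q : ℂ) ≠ 0 := ofReal_ne_zero.mpr hq0.ne'
    field_simp
  have e3 : (1 + (q⁻¹ : ℂ)) * halfTransform h z = -∫ s, (H (s + τ) - H s) * E s := by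
    simp_rw [sub_mul]
    rw [integral_sub hHE' hHE, e2, ← e1]
    ring
  have hbound : ‖∫ s, (H (s + τ) - H s) * E s‖ ≤ q⁻¹ * ∫ s, ‖H (s + τ) - H s‖ := by
    rw [← integral_const_mul]
    refine norm_integral_le_of_norm_le (((hHi.comp_add_right τ).sub hHi).norm.const_mul _)
      (ae_of_all _ fun s => ?_)
    by_cases hs : -τ < s
    · rw [norm_mul, mul_comm, hEn, hq, ← Real.exp_neg]
      gcongr
      nlinarith
    · have h4 : H (s + τ) = 0 := Set.indicator_of_notMem (by simp; linarith) _
      have h5 : H s = 0 := Set.indicator_of_notMem (by simp; linarith) _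
      simp [h4, h5]
  have e4 : ‖(1 + (q⁻¹ : ℂ))‖ = 1 + q⁻¹ := by
    rw [← ofReal_inv, ← ofReal_one, ← ofReal_add, norm_real, Real.norm_eq_abs,
      abs_of_pos (by positivity)]
  have e5 := congrArg norm e3
  rw [norm_mul, norm_neg, e4] at e5
  have h6 := e5.le.trans hbound
  have hN := norm_nonneg (halfTransform h z)
  have hqi : 0 < q⁻¹ := inv_pos.mpr hq0
  have : q⁻¹ * ‖halfTransform h z‖ ≤ q⁻¹ * ∫ s, ‖H (s + τ) - H s‖ := by nlinarith
  exact le_of_mul_le_mul_left this hqi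

theorem tendsto_halfTransform (hi : Integrable h) {B : ℝ} (hB : ∀ s, ‖h s‖ ≤ B) :
    Tendsto (halfTransform h) (cobounded ℂ ⊓ 𝓟 {z : ℂ | z.im < 0}) (𝓝 0) := by
  rw [Metric.tendsto_nhds]
  intro e he
  have hB0 : 0 ≤ B := (norm_nonneg _).trans (hB 0)
  have h1 := (tendsto_integral_norm_sub_comp_add (hi.indicator (measurableSet_Ioi (a := (0 : ℝ))))
    ).eventually_lt_const he
  obtain ⟨δ, hδ, hδ'⟩ := Metric.eventually_nhds_iff.mp h1
  rw [eventually_inf_principal]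
  filter_upwards [eventually_cobounded_le_norm (Real.pi / δ + (B + 1) / e)] with z hz him
  have him' : z.im < 0 := him
  have hpi := Real.pi_pos
  rw [dist_zero_right]
  by_cases hre : Real.pi / δ ≤ |z.re|
  · have hre0 : 0 < |z.re| := lt_of_lt_of_le (by positivity) hre
    have hτ : 0 < Real.pi / (2 * |z.re|) := by positivity
    refine (norm_halfTransform_le_translate hi him'.le hτ.le (by field_simp)).trans_lt (hδ' ?_)
    rw [dist_zero_right, Real.norm_eq_abs, abs_of_pos hτ, div_lt_iff₀ (by positivity)]
    rw [div_le_iff₀ hδ] at hre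
    nlinarith
  · push Not at hre
    have h2 : (B + 1) / e < -z.im := by
      have := norm_le_abs_re_add_abs_im z
      rw [abs_of_neg him'] at this
      linarith
    refine (norm_halfTransform_le hB him').trans_lt ?_
    rw [div_lt_iff₀ he] at h2
    rw [← div_eq_mul_inv, div_lt_iff₀ (by linarith)]
    nlinarith

theorem norm_le_of_sector {c : ℝ} (hc : 0 < c) {z : ℂ} (hz : c * |z.re| ≤ |z.im|) :
    ‖z‖ ≤ (c⁻¹ + 1) * |z.im| := by
  have h1 : |z.re| ≤ c⁻¹ * |z.im| := by
    rw [inv_mul_eq_div, le_div_iff₀ hc]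
    linarith
  linarith [norm_le_abs_re_add_abs_im z]

/-- The leading term of the one-sided transform at infinity. -/
theorem tendsto_mul_halfTransform (hc : Continuous h) (hi : Integrable h) {B : ℝ}
    (hB : ∀ s, ‖h s‖ ≤ B) {c : ℝ} (hc0 : 0 < c) :
    Tendsto (fun z => 2 * I * (z * halfTransform h z)) (sectorAtInfty c {z : ℂ | z.im < 0})
      (𝓝 (h 0)) := by
  set J : ℝ → ℝ := fun η => ∫ t in Set.Ioi (0 : ℝ), Real.exp (-2 * t) * ‖h (η⁻¹ * t) - h 0‖ with hJ
  have hJl : Tendsto J atTop (𝓝 0) := by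
    have h1 : Tendsto J atTop (𝓝 (∫ t in Set.Ioi (0 : ℝ), (0 : ℝ))) := by
      refine tendsto_integral_filter_of_dominated_convergence
        (fun t => Real.exp (-(2 * 1) * t) * (B + B)) ?_ ?_
        ((integrableOn_exp_kernel one_pos).mul_const _) ?_
      · exact Eventually.of_forall fun η => by fun_prop
      · refine Eventually.of_forall fun η => ae_of_all _ fun t => ?_
        rw [norm_mul, norm_norm, Real.norm_eq_abs, Real.abs_exp, mul_one]
        gcongr
        exact (norm_sub_le _ _).trans (add_le_add (hB _) (hB _))
      · refine ae_of_all _ fun t => ?_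
        have h2 : Tendsto (fun η : ℝ => h (η⁻¹ * t)) atTop (𝓝 (h 0)) := by
          refine (hc.tendsto 0).comp ?_
          simpa using tendsto_inv_atTop_zero.mul_const t
        have h3 := ((h2.sub_const (h 0)).norm).const_mul (Real.exp (-2 * t))
        simpa using h3
    simpa using h1
  have key : ∀ z : ℂ, z.im < 0 → c * |z.re| ≤ |z.im| →
      ‖2 * I * (z * halfTransform h z) - h 0‖ ≤ 2 * (c⁻¹ + 1) * J (-z.im) := fun z hz hs => by
    set η := -z.im with hη
    have hη0 : 0 < η := by rw [hη]; linarith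
    have hz0 : z ≠ 0 := fun h0 => by rw [h0] at hz; simp at hz
    have hnE : ∀ s : ℝ, ‖exp (-2 * I * z * s)‖ = Real.exp (-(2 * η) * s) := fun s => by
      rw [norm_exp_kernel, hη]; ring_nf
    have hEi : IntegrableOn (fun s : ℝ => exp (-2 * I * z * s)) (Set.Ioi 0) :=
      (integrableOn_exp_kernel hη0).mono' (continuous_exp_kernel z).aestronglyMeasurable
        (ae_of_all _ fun s => (hnE s).le)
    have hE : ∫ s in Set.Ioi (0 : ℝ), exp (-2 * I * z * s) = (2 * I * z)⁻¹ := by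
      have := integral_exp_mul_complex_Ioi (a := -2 * I * z) (by simp; linarith) 0
      rw [this]
      simp [neg_div_neg_eq]
    have e1 : 2 * I * (z * halfTransform h z) - h 0
        = 2 * I * z * ∫ s in Set.Ioi (0 : ℝ), (h s - h 0) * exp (-2 * I * z * s) := by
      simp_rw [sub_mul]
      rw [integral_sub (integrableOn_kernel hi hz.le) (hEi.const_mul _), integral_const_mul, hE,
        halfTransform]
      field_simp [I_ne_zero]
    have e2 : ∫ s in Set.Ioi (0 : ℝ), ‖h s - h 0‖ * Real.exp (-(2 * η) * s) = η⁻¹ * J η := by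
      have := integral_comp_mul_left_Ioi
        (fun t => Real.exp (-2 * t) * ‖h (η⁻¹ * t) - h 0‖) 0 hη0
      rw [mul_zero, smul_eq_mul] at this
      rw [hJ, ← this]
      congr 1 with s
      rw [inv_mul_cancel_left₀ hη0.ne']
      ring_nf
    rw [e1, norm_mul, norm_mul, norm_mul, norm_I, mul_one, RCLike.norm_ofNat]
    have e3 : ‖∫ s in Set.Ioi (0 : ℝ), (h s - h 0) * exp (-2 * I * z * s)‖ ≤ η⁻¹ * J η := by
      rw [← e2]
      refine norm_integral_le_of_norm_le ?_ (ae_of_all _ fun s => ?_)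
      · refine ((integrableOn_exp_kernel hη0).const_mul (B + B)).mono'
          (by fun_prop) (ae_of_all _ fun s => ?_)
        rw [norm_mul, norm_norm, Real.norm_eq_abs, Real.abs_exp]
        gcongr
        exact (norm_sub_le _ _).trans (add_le_add (hB _) (hB _))
      · rw [norm_mul, hnE]
    have hz' := norm_le_of_sector hc0 hs
    rw [abs_of_neg hz, ← hη] at hz'
    have hJ0 : 0 ≤ η⁻¹ * J η := (norm_nonneg _).trans e3
    calc 2 * ‖z‖ * _ ≤ 2 * ((c⁻¹ + 1) * η) * (η⁻¹ * J η) := by gcongr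
      _ = _ := by field_simp
  rw [tendsto_iff_norm_sub_tendsto_zero]
  have him : Tendsto (fun z : ℂ => -z.im) (sectorAtInfty c {z : ℂ | z.im < 0}) atTop := by
    rw [tendsto_atTop]
    intro b
    rw [sectorAtInfty, eventually_inf_principal]
    filter_upwards [eventually_cobounded_le_norm ((c⁻¹ + 1) * b)] with z hz hs
    have h1 := norm_le_of_sector hc0 hs.2
    rw [abs_of_neg hs.1] at h1
    exact le_of_mul_le_mul_left (hz.trans h1) (by positivity)
  refine squeeze_zero' (Eventually.of_forall fun _ => norm_nonneg _)
    (g := fun z => 2 * (c⁻¹ + 1) * J (-z.im)) ?_ ?_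
  · rw [sectorAtInfty, eventually_inf_principal]
    exact Eventually.of_forall fun z hz => key z hz.1 hz.2
  · simpa using (hJl.comp him).const_mul (2 * (c⁻¹ + 1))

/-- The function on `ℂ ∖ ℝ`, analytic and decaying, whose jump across the real line is
`∫ h(s) e^{-2iλs} ds`. -/
noncomputable def cauchyTransform (h : ℝ → ℂ) (z : ℂ) : ℂ :=
  if z.im < 0 then -halfTransform h z else halfTransform (fun s => h (-s)) (-z)

theorem cauchyTransform_of_neg {z : ℂ} (hz : z.im < 0) :
    cauchyTransform h z = -halfTransform h z := if_pos hz

theorem cauchyTransform_of_pos {z : ℂ} (hz : 0 < z.im) :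
    cauchyTransform h z = halfTransform (fun s => h (-s)) (-z) := if_neg hz.not_gt

theorem differentiableOn_cauchyTransform (hi : Integrable h) :
    DifferentiableOn ℂ (cauchyTransform h) {z : ℂ | z.im ≠ 0} := by
  intro z hz
  apply DifferentiableAt.differentiableWithinAt
  rcases lt_or_gt_of_ne hz with h1 | h1
  · refine (differentiableAt_halfTransform hi h1).neg.congr_of_eventuallyEq ?_
    filter_upwards [(isOpen_lt continuous_im continuous_const).mem_nhds h1] with w hw
    exact cauchyTransform_of_neg hw
  · have h2 : (-z).im < 0 := by simpa using h1
    refine ((differentiableAt_halfTransform hi.comp_neg h2).comp z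
      differentiable_neg.differentiableAt).congr_of_eventuallyEq ?_
    filter_upwards [(isOpen_lt continuous_const continuous_im).mem_nhds h1] with w hw
    exact cauchyTransform_of_pos hw

theorem tendsto_cauchyTransform (hi : Integrable h) {B : ℝ} (hB : ∀ s, ‖h s‖ ≤ B) :
    Tendsto (cauchyTransform h) (cobounded ℂ ⊓ 𝓟 {z : ℂ | z.im ≠ 0}) (𝓝 0) := by
  have hset : {z : ℂ | z.im ≠ 0} = {z : ℂ | z.im < 0} ∪ {z : ℂ | 0 < z.im} := by
    ext z
    exact lt_or_lt_iff_ne.symm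
  rw [hset, ← sup_principal, inf_sup_left]
  refine Tendsto.sup ?_ ?_
  · have := (tendsto_halfTransform hi hB).neg
    rw [neg_zero] at this
    refine this.congr' ?_
    filter_upwards [mem_inf_of_right (mem_principal_self _)] with z hz
    exact (cauchyTransform_of_neg hz).symm
  · have hn : Tendsto (fun z : ℂ => -z) (cobounded ℂ ⊓ 𝓟 {z : ℂ | 0 < z.im})
        (cobounded ℂ ⊓ 𝓟 {z : ℂ | z.im < 0}) :=
      tendsto_neg_cobounded.inf (tendsto_principal_principal.mpr fun z hz => by simpa using hz)
    refine ((tendsto_halfTransform hi.comp_neg (fun s => hB (-s))).comp hn).congr' ?_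
    filter_upwards [mem_inf_of_right (mem_principal_self _)] with z hz
    exact (cauchyTransform_of_pos hz).symm

theorem isBigO_cauchyTransform {B : ℝ} (hB : ∀ s, ‖h s‖ ≤ B) {c : ℝ} (hc : 0 < c) :
    cauchyTransform h =O[sectorAtInfty c {z : ℂ | z.im ≠ 0}] (fun z => z⁻¹) := by
  have hB0 : 0 ≤ B := (norm_nonneg _).trans (hB 0)
  refine Asymptotics.IsBigO.of_bound (B * (c⁻¹ + 1)) ?_
  rw [sectorAtInfty, eventually_inf_principal]
  refine Eventually.of_forall fun z hz => ?_
  have him : 0 < |z.im| := abs_pos.mpr hz.1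
  have hz0 : 0 < ‖z‖ := him.trans_le (abs_im_le_norm z)
  have h1 : ‖cauchyTransform h z‖ ≤ B * (2 * |z.im|)⁻¹ := by
    rcases lt_or_gt_of_ne hz.1 with h1 | h1
    · rw [cauchyTransform_of_neg h1, norm_neg, abs_of_neg h1]
      exact norm_halfTransform_le hB h1
    · rw [cauchyTransform_of_pos h1, abs_of_pos h1]
      have := norm_halfTransform_le (h := fun s => h (-s)) (fun s => hB (-s)) (z := -z)
        (by simpa using h1)
      simpa using this
  refine h1.trans ?_
  rw [mul_assoc, norm_inv]
  gcongr
  rw [inv_le_iff_one_le_mul₀ (by positivity)]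
  have h2 := norm_le_of_sector hc hz.2
  have h3 : 1 ≤ (c⁻¹ + 1) * |z.im| * ‖z‖⁻¹ := by
    rw [← div_eq_mul_inv, le_div_iff₀ hz0]
    linarith
  nlinarith

theorem tendsto_cauchyTransform_lower (hi : Integrable h) (l : ℝ) :
    Tendsto (cauchyTransform h) (𝓝[{z : ℂ | z.im < 0}] (l : ℂ)) (𝓝 (-halfTransform h l)) := by
  have h1 := ((continuousOn_halfTransform hi).continuousWithinAt (x := (l : ℂ)) (by simp)).mono
    (show {z : ℂ | z.im < 0} ⊆ {z : ℂ | z.im ≤ 0} from fun z hz => le_of_lt (Set.mem_ofPred.mp hz))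
  refine h1.neg.congr' ?_
  filter_upwards [self_mem_nhdsWithin] with z hz
  exact (cauchyTransform_of_neg hz).symm

theorem tendsto_cauchyTransform_upper (hi : Integrable h) (l : ℝ) :
    Tendsto (cauchyTransform h) (𝓝[{z : ℂ | 0 < z.im}] (l : ℂ))
      (𝓝 (halfTransform (fun s => h (-s)) (-l))) := by
  have h1 := ((continuousOn_halfTransform hi.comp_neg).continuousWithinAt (x := (-l : ℂ))
    (by simp)).mono
    (show {z : ℂ | z.im < 0} ⊆ {z : ℂ | z.im ≤ 0} from fun z hz => le_of_lt (Set.mem_ofPred.mp hz))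
  have hn : Tendsto (fun z : ℂ => -z) (𝓝[{z : ℂ | 0 < z.im}] (l : ℂ))
      (𝓝[{z : ℂ | z.im < 0}] (-l : ℂ)) :=
    (continuous_neg.continuousWithinAt).tendsto_nhdsWithin fun z hz => by simpa using hz
  refine (h1.tendsto.comp hn).congr' ?_
  filter_upwards [self_mem_nhdsWithin] with z hz
  exact (cauchyTransform_of_pos hz).symm

theorem continuous_halfTransform_ofReal (hi : Integrable h) :
    Continuous fun l : ℝ => halfTransform h l :=
  (continuousOn_halfTransform hi).comp_continuous continuous_ofReal fun l => by simp

theorem halfTransform_add_halfTransform (hi : Integrable h) (l : ℝ) :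
    halfTransform (fun s => h (-s)) (-l) + halfTransform h l
      = ∫ s, h s * exp (-2 * I * l * s) := by
  have hint : Integrable fun s : ℝ => h s * exp (-2 * I * l * s) := by
    refine hi.norm.mono' (hi.1.mul (continuous_exp_kernel l).aestronglyMeasurable)
      (ae_of_all _ fun s => ?_)
    rw [norm_mul, norm_exp_kernel]
    simp
  have e : halfTransform (fun s => h (-s)) (-l)
      = ∫ s in Set.Iic (0 : ℝ), h s * exp (-2 * I * l * s) := by
    have := integral_comp_neg_Ioi 0 fun s : ℝ => h s * exp (-2 * I * l * s)
    rw [neg_zero] at this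
    rw [← this, halfTransform]
    congr 1 with s
    push_cast
    ring_nf
  rw [e, halfTransform, ← Set.compl_Iic, integral_add_compl measurableSet_Iic hint]

end

/-! ### Integrability of the solutions -/

theorem memLp_weight {φ : ℝ → ℂ} (hc : Continuous φ) (h2 : MemLp φ 2)
    (hw : MemLp (fun y : ℝ => (y : ℂ) * φ y) 2) (x : ℝ) :
    MemLp (fun u => (1 + |u|) * ‖φ (x + u)‖) 2 := by
  have h1 : MemLp (fun y : ℝ => (1 + |x|) * (‖φ y‖ + ‖(y : ℂ) * φ y‖)) 2 :=
    (h2.norm.add hw.norm).const_mul _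
  have h3 := h1.comp_measurePreserving (measurePreserving_add_left volume x)
  refine h3.of_le (by fun_prop) (ae_of_all _ fun u => ?_)
  simp only [Function.comp_apply]
  rw [Real.norm_of_nonneg (by positivity), Real.norm_of_nonneg (by positivity), norm_mul,
    norm_real, Real.norm_eq_abs]
  have h4 : |u| ≤ |x + u| + |x| := by
    have := abs_sub (x + u) x
    simpa using this
  have : 1 + |u| ≤ (1 + |x|) * (1 + |x + u|) := by
    nlinarith [abs_nonneg x, abs_nonneg (x + u)]
  calc _ ≤ (1 + |x|) * (1 + |x + u|) * ‖φ (x + u)‖ := by gcongr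
    _ = _ := by ring

theorem inner_shift_eq_integral {f : L2R} {φ : ℝ → ℂ} (hf : f =ᵐ[volume] fun s => conj (φ s))
    (s : ℝ) (γ : L2R) : ⟪shift s f, γ⟫ = ∫ t, φ (s + t) * γ t := by
  rw [L2.inner_def]
  apply integral_congr_ae
  filter_upwards [coeFn_shift s f, ae_comp_add s hf] with t e1 e2
  rw [e1, e2, RCLike.inner_apply, RCLike.conj_conj, mul_comm, add_comm]

section

variable {f : L2R} {φ : ℝ → ℂ} (hf : f =ᵐ[volume] fun s => conj (φ s)) {x : ℝ}
  (hw : MemLp (fun u => (1 + |u|) * ‖φ (x + u)‖) 2)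

include hf hw in
theorem norm_halfProj_shift_le {t : ℝ} (ht : 0 ≤ t) :
    ‖halfProj (shift (x + t) f)‖ ≤ √(∫ u, ((1 + |u|) * ‖φ (x + u)‖) ^ 2) * (1 + t)⁻¹ := by
  have hi : Integrable fun u => ((1 + |u|) * ‖φ (x + u)‖) ^ 2 :=
    ((memLp_two_iff_integrable_sq_norm hw.1).mp hw).congr (ae_of_all _ fun u => by
      simp only
      rw [Real.norm_of_nonneg (by positivity)])
  refine le_of_sq_le_sq ?_ (by positivity)
  rw [norm_sq_halfProj, mul_pow, Real.sq_sqrt (integral_nonneg fun _ => by positivity),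
    ← integral_add_right_eq_self (μ := volume) _ t, ← integral_mul_const]
  have h1 : ∫ s in Set.Ioi 0, ‖shift (x + t) f s‖ ^ 2
      ≤ ∫ s in Set.Ioi 0, ((1 + |s + t|) * ‖φ (x + (s + t))‖) ^ 2 * ((1 + t)⁻¹) ^ 2 := by
    refine setIntegral_mono_on_ae (integrable_norm_sq _).integrableOn
      ((hi.comp_add_right t).mul_const _).integrableOn measurableSet_Ioi ?_
    filter_upwards [coeFn_shift (x + t) f, ae_comp_add (x + t) hf] with s e1 e2 hs
    have hs0 : (0 : ℝ) < s := hs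
    rw [e1, e2, RCLike.norm_conj, ← mul_pow, show s + (x + t) = x + (s + t) by ring]
    gcongr
    rw [mul_right_comm]
    refine le_mul_of_one_le_left (norm_nonneg _) ?_
    rw [← div_eq_mul_inv, le_div_iff₀ (by positivity), abs_of_pos (by positivity)]
    linarith
  refine h1.trans (setIntegral_le_integral ((hi.comp_add_right t).mul_const _)
    (ae_of_all _ fun s => ?_))
  positivity

theorem integral_inv_sq_Ioi {a : ℝ} (ha : 0 < a) :
    IntegrableOn (fun s => ((a + s) ^ 2)⁻¹) (Set.Ioi 0) ∧
      ∫ s in Set.Ioi (0 : ℝ), ((a + s) ^ 2)⁻¹ = a⁻¹ := by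
  have hd : ∀ s ∈ Set.Ici (0 : ℝ), HasDerivAt (fun s => -(a + s)⁻¹) ((a + s) ^ 2)⁻¹ s :=
    fun s hs => by
      have hs0 : (0 : ℝ) ≤ s := hs
      have h1 : HasDerivAt (fun s => a + s) 1 s := (hasDerivAt_id s).const_add a
      refine (h1.inv (by positivity)).neg.congr_deriv ?_
      field_simp
  have ht : Tendsto (fun s : ℝ => -(a + s)⁻¹) atTop (𝓝 0) := by
    simpa using (tendsto_inv_atTop_zero.comp (tendsto_atTop_add_const_left _ a tendsto_id)).neg
  refine ⟨integrableOn_Ioi_deriv_of_nonneg' hd (fun s hs => by positivity) ht, ?_⟩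
  rw [integral_Ioi_of_hasDerivAt_of_nonneg' hd (fun s hs => by positivity) ht]
  simp

include hw in
theorem integral_tail_le (hc : Continuous φ) {t : ℝ} (ht : 0 ≤ t) :
    IntegrableOn (fun s => φ (x + s + t)) (Set.Ioi 0) ∧
      ∫ s in Set.Ioi (0 : ℝ), ‖φ (x + s + t)‖
        ≤ ((∫ u, ((1 + |u|) * ‖φ (x + u)‖) ^ 2) + 1) * (√(1 + t))⁻¹ := by
  have hi : Integrable fun u => ((1 + |u|) * ‖φ (x + u)‖) ^ 2 :=
    ((memLp_two_iff_integrable_sq_norm hw.1).mp hw).congr (ae_of_all _ fun u => by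
      simp only
      rw [Real.norm_of_nonneg (by positivity)])
  obtain ⟨h1, h2⟩ := integral_inv_sq_Ioi (a := 1 + t) (by positivity)
  set q := √(1 + t) with hq
  have hq0 : 0 < q := Real.sqrt_pos.mpr (by positivity)
  have hq2 : q ^ 2 = 1 + t := Real.sq_sqrt (by positivity)
  have hi1 : Integrable fun s => ((1 + |s + t|) * ‖φ (x + (s + t))‖) ^ 2 * q⁻¹ :=
    (hi.comp_add_right t).mul_const _
  have hb : ∀ s ∈ Set.Ioi (0 : ℝ), ‖φ (x + s + t)‖
      ≤ ((1 + |s + t|) * ‖φ (x + (s + t))‖) ^ 2 * q⁻¹ + ((1 + t + s) ^ 2)⁻¹ * q := fun s hs => by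
    have hs0 : (0 : ℝ) < s := hs
    rw [abs_of_pos (by positivity), show x + (s + t) = x + s + t by ring]
    set y := ‖φ (x + s + t)‖ with hy
    have hy0 : 0 ≤ y := norm_nonneg _
    set v := 1 + t + s with hv
    have hv0 : 0 < v := by positivity
    have e : 1 + (s + t) = v := by rw [hv]; ring
    rw [e]
    have h3 : ((v * y) ^ 2 * q⁻¹ + (v ^ 2)⁻¹ * q) - y
        = q⁻¹ * ((v * y - v⁻¹ * q / 2) ^ 2 + 3 / 4 * (v⁻¹ * q) ^ 2) := by
      field_simp
      ring
    have h4 : 0 ≤ q⁻¹ * ((v * y - v⁻¹ * q / 2) ^ 2 + 3 / 4 * (v⁻¹ * q) ^ 2) := by positivity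
    linarith
  have hi2 : IntegrableOn (fun s => ((1 + |s + t|) * ‖φ (x + (s + t))‖) ^ 2 * q⁻¹
      + ((1 + t + s) ^ 2)⁻¹ * q) (Set.Ioi 0) := hi1.integrableOn.add (h1.mul_const q)
  have hi3 : IntegrableOn (fun s => φ (x + s + t)) (Set.Ioi 0) :=
    hi2.mono' (by fun_prop) ((ae_restrict_mem measurableSet_Ioi).mono hb)
  refine ⟨hi3, (setIntegral_mono_on hi3.norm hi2 measurableSet_Ioi hb).trans ?_⟩
  rw [integral_add hi1.integrableOn (h1.mul_const q), integral_mul_const, add_mul, one_mul]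
  refine add_le_add ?_ (le_of_eq ?_)
  · have h3 := setIntegral_le_integral (s := Set.Ioi (0 : ℝ)) hi1
      (ae_of_all _ fun s => by positivity)
    rw [integral_mul_const, integral_mul_const,
      integral_add_right_eq_self (μ := volume) (fun u => ((1 + |u|) * ‖φ (x + u)‖) ^ 2) t] at h3
    exact h3
  · rw [integral_mul_const, h2, ← hq2]
    field_simp

theorem integrableOn_inv_mul_inv_sqrt :
    IntegrableOn (fun t : ℝ => (1 + t)⁻¹ * (√(1 + t))⁻¹) (Set.Ioi 0) := by
  have h := (integrable_one_add_norm (E := ℝ) (μ := volume) (r := 3 / 2) (by norm_num)).integrableOn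
    (s := Set.Ioi (0 : ℝ))
  refine h.congr_fun (fun t ht => ?_) measurableSet_Ioi
  have ht0 : (0 : ℝ) < t := ht
  have h1 : 0 < 1 + t := by positivity
  simp only [Real.norm_of_nonneg ht0.le]
  rw [Real.sqrt_eq_rpow, ← Real.rpow_neg_one, ← Real.rpow_neg h1.le, ← Real.rpow_add h1]
  norm_num

include hf hw in
/-- A Hankel operator with a weighted square integrable kernel maps functions with the decay
of its own values into integrable functions. -/
theorem integrableOn_inner_shift (hc : Continuous φ) {γ : L2R} {g : ℝ → ℝ} (hg : Integrable g)
    {C : ℝ} (hγ : ∀ᵐ t : ℝ, 0 < t → ‖γ t‖ ≤ g t + C * (1 + t)⁻¹) :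
    IntegrableOn (fun s => ⟪shift (x + s) f, halfProj γ⟫) (Set.Ioi 0) := by
  set W := (∫ u, ((1 + |u|) * ‖φ (x + u)‖) ^ 2) + 1 with hW
  have hW0 : 0 ≤ W := add_nonneg (integral_nonneg fun _ => by positivity) zero_le_one
  have e : ∀ s, ⟪shift (x + s) f, halfProj γ⟫ = ∫ t in Set.Ioi 0, φ (x + s + t) * γ t := fun s => by
    rw [inner_shift_eq_integral hf, ← integral_indicator measurableSet_Ioi]
    apply integral_congr_ae
    filter_upwards [coeFn_halfProj γ] with t ht
    rw [ht]
    by_cases h : t ∈ Set.Ioi (0 : ℝ) <;> simp [h]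
  simp_rw [e]
  have hm : AEStronglyMeasurable (fun p : ℝ × ℝ => φ (x + p.1 + p.2) * γ p.2)
      ((volume.restrict (Set.Ioi 0)).prod (volume.restrict (Set.Ioi 0))) :=
    Continuous.aestronglyMeasurable (by fun_prop) |>.mul
      (Lp.aestronglyMeasurable γ).restrict.comp_snd
  have hp : Integrable (fun p : ℝ × ℝ => φ (x + p.1 + p.2) * γ p.2)
      ((volume.restrict (Set.Ioi 0)).prod (volume.restrict (Set.Ioi 0))) := by
    rw [integrable_prod_iff' hm]
    constructor
    · refine (ae_restrict_mem measurableSet_Ioi).mono fun t ht => ?_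
      exact (integral_tail_le hw hc (le_of_lt ht)).1.mul_const (γ t)
    · have hb : IntegrableOn (fun t : ℝ => W * |g t| + |C| * W * ((1 + t)⁻¹ * (√(1 + t))⁻¹))
          (Set.Ioi 0) :=
        (hg.abs.const_mul W).integrableOn.add (integrableOn_inv_mul_inv_sqrt.const_mul _)
      refine hb.mono' hm.norm.prod_swap.integral_prod_right' ?_
      filter_upwards [ae_restrict_mem measurableSet_Ioi, ae_restrict_of_ae hγ] with t ht hγt
      have ht0 : (0 : ℝ) < t := ht
      have h1 := (integral_tail_le hw hc ht0.le).2
      simp_rw [norm_mul]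
      rw [integral_mul_const, Real.norm_of_nonneg (mul_nonneg (integral_nonneg fun _ =>
        norm_nonneg _) (norm_nonneg _))]
      have hq1 : 1 ≤ √(1 + t) := Real.one_le_sqrt.mpr (by linarith)
      have hq0 : 0 < √(1 + t) := by linarith
      have hq2 : (√(1 + t))⁻¹ ≤ 1 := inv_le_one_of_one_le₀ hq1
      calc _ ≤ W * (√(1 + t))⁻¹ * (|g t| + |C| * (1 + t)⁻¹) := by
            gcongr
            refine (hγt ht0).trans (add_le_add (le_abs_self _) ?_)
            gcongr
            exact le_abs_self C
        _ = W * |g t| * (√(1 + t))⁻¹ + |C| * W * ((1 + t)⁻¹ * (√(1 + t))⁻¹) := by ring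
        _ ≤ _ := add_le_add (mul_le_of_le_one_right (by positivity) hq2) le_rfl
  exact hp.integral_prod_left

include hf in
theorem norm_inner_halfProj_le {t : ℝ} (ht : 0 ≤ t) (γ : L2R)
    (hw : MemLp (fun u => (1 + |u|) * ‖φ (x + u)‖) 2) :
    ‖⟪shift (x + t) f, halfProj γ⟫‖
      ≤ √(∫ u, ((1 + |u|) * ‖φ (x + u)‖) ^ 2) * ‖halfProj γ‖ * (1 + t)⁻¹ := by
  rw [← inner_halfProj_halfProj]
  refine (norm_inner_le_norm _ _).trans ?_
  calc _ ≤ √(∫ u, ((1 + |u|) * ‖φ (x + u)‖) ^ 2) * (1 + t)⁻¹ * ‖halfProj γ‖ := by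
        gcongr
        exact norm_halfProj_shift_le hf hw ht
    _ = _ := by ring

include hf in
/-- The Fourier transform of the image of an integrable function under a Hankel operator. -/
theorem integrable_and_fourier_inner_shift (hφ : Integrable φ) {γ : L2R} (hγ : Integrable γ) :
    Integrable (fun s => ⟪shift (x + s) f, γ⟫) ∧
      ∀ w, 𝓕 (fun s => ⟪shift (x + s) f, γ⟫) w = 𝓕⁻ (γ : ℝ → ℂ) w * 𝓕 (fun y => φ (x + y)) w := by
  have hφx : Integrable fun y => φ (x + y) := hφ.comp_add_left x
  have e : (fun s => ⟪shift (x + s) f, γ⟫)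
      = MeasureTheory.convolution (fun t => γ (-t)) (fun y => φ (x + y))
        (ContinuousLinearMap.mul ℂ ℂ) volume := by
    ext s
    rw [inner_shift_eq_integral hf, convolution_def, ← integral_neg_eq_self]
    congr 1 with t
    rw [ContinuousLinearMap.mul_apply', mul_comm, add_assoc, sub_eq_add_neg]
  constructor
  · rw [e]
    exact hγ.comp_neg.integrable_convolution _ hφx
  · intro w
    rw [e, Real.fourier_mul_convolution_eq hγ.comp_neg hφx, Real.fourierInv_eq_fourier_comp_neg]

end

theorem fourier_comp_add_left (φ : ℝ → ℂ) (x w : ℝ) :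
    𝓕 (fun y => φ (x + y)) w = wave x w * 𝓕 φ w := by
  rw [fourier_eq_integral_wave, fourier_eq_integral_wave, ← integral_const_mul,
    ← integral_add_left_eq_self (μ := volume) (fun y => wave x w * (wave (-w) y * φ y)) x]
  congr 1 with y
  have h1 : wave x w = wave w x := by
    unfold wave
    congr 3
    ring
  have h2 : wave (-w) (x + y) = wave (-w) x * wave (-w) y := by
    unfold wave
    rw [← Complex.exp_add]
    push_cast
    ring_nf
  have h3 : wave w x * wave (-w) x = 1 := by
    rw [← wave_add, add_neg_cancel]
    simp [wave]
  rw [h1, h2, ← mul_assoc, ← mul_assoc, h3, one_mul]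

theorem integrable_halfProj_of_integrableOn {γ : L2R} {u : ℝ → ℂ} (hγ : γ =ᵐ[volume] u)
    (hu : IntegrableOn u (Set.Ioi 0)) : Integrable (halfProj γ) := by
  refine (hu.integrable_indicator measurableSet_Ioi).congr ?_
  filter_upwards [coeFn_halfProj γ, hγ] with s e1 e2
  rw [e1]
  by_cases h : s ∈ Set.Ioi (0 : ℝ) <;> simp [h, e2]

theorem wave_neg_eq_exp (l s : ℝ) : wave (-(l / Real.pi)) s = exp (-2 * I * l * s) := by
  have : (Real.pi : ℂ) ≠ 0 := ofReal_ne_zero.mpr Real.pi_ne_zero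
  rw [wave]
  push_cast
  congr 1
  field_simp

theorem fourier_eq_integral_exp (h : ℝ → ℂ) (l : ℝ) :
    ∫ s, h s * exp (-2 * I * l * s) = 𝓕 h (l / Real.pi) := by
  rw [fourier_eq_integral_wave]
  congr 1 with s
  rw [wave_neg_eq_exp, mul_comm]

theorem fourier_halfProj {γ : L2R} {u : ℝ → ℂ} (hγ : γ =ᵐ[volume] u) (l : ℝ) :
    𝓕 (halfProj γ : ℝ → ℂ) (l / Real.pi) = halfTransform u l := by
  rw [← fourier_eq_integral_exp, halfTransform, ← integral_indicator measurableSet_Ioi]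
  apply integral_congr_ae
  filter_upwards [coeFn_halfProj γ, hγ] with s e1 e2
  rw [e1]
  by_cases h : s ∈ Set.Ioi (0 : ℝ) <;> simp [h, e2]

namespace KernelData

variable {K : KernelData} (hF : ∀ k, MemLp (K.F k) 2)
  (hFw : ∀ k, MemLp (fun y : ℝ => (y : ℂ) * K.F k y) 2)

theorem f_ae_conj (k : Fin 2) : K.f k =ᵐ[volume] fun s => conj (conj (K.F k s)) := by
  simpa using K.f_ae k

include hF hFw in
theorem integrable_halfProj_sol (a : ℂ) (c : Fin 2 → ℂ) (x : ℝ) :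
    Integrable (halfProj (K.A a c x)) ∧ ∀ k, Integrable (halfProj (K.D a c x k)) := by
  have hF1 : ∀ k, Integrable (K.F k) := fun k => integrable_of_moment (hF k) (hFw k)
  have hF1x : ∀ k, Integrable fun s => K.F k (x + s) := fun k => (hF1 k).comp_add_left x
  have hw : ∀ k, MemLp (fun u => (1 + |u|) * ‖K.F k (x + u)‖) 2 := fun k =>
    memLp_weight (K.cont k) (hF k) (hFw k) x
  have hwc : ∀ k, MemLp (fun u => (1 + |u|) * ‖conj (K.F k (x + u))‖) 2 := fun k => by
    simpa using hw k
  have hFc : ∀ k, Continuous fun s => conj (K.F k s) := fun k => continuous_conj.comp (K.cont k)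
  set N : Fin 2 → ℝ := fun k => √(∫ u, ((1 + |u|) * ‖K.F k (x + u)‖) ^ 2) with hN
  have hA : ∀ t, 0 < t → ‖K.Aval a c x t‖ ≤ (∑ k, ‖c k‖ * ‖K.F k (x + t)‖)
      + (∑ k, N k * ‖halfProj (K.D a c x k)‖) * (1 + t)⁻¹ := fun t ht => by
    rw [Aval, norm_neg, Finset.sum_mul]
    refine (norm_add_le _ _).trans (add_le_add ?_ ?_)
    · refine (norm_sum_le _ _).trans (le_of_eq ?_)
      simp_rw [norm_mul]
    · refine (norm_sum_le _ _).trans (Finset.sum_le_sum fun k _ => ?_)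
      exact norm_inner_halfProj_le (K.fb_ae k) ht.le _ (hw k)
  have hD : ∀ k t, 0 < t → ‖K.Dval a c x k t‖ ≤ ‖a‖ * ‖K.F k (x + t)‖
      + N k * ‖halfProj (K.A a c x)‖ * (1 + t)⁻¹ := fun k t ht => by
    rw [Dval, norm_mul, norm_real, Real.norm_eq_abs, K.abs_eps, one_mul]
    refine (norm_add_le _ _).trans (add_le_add (le_of_eq ?_) ?_)
    · rw [norm_mul, RCLike.norm_conj]
    · have := norm_inner_halfProj_le (K.f_ae_conj k) ht.le (K.A a c x) (hwc k)
      simpa only [RCLike.norm_conj] using this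
  constructor
  · refine integrable_halfProj_of_integrableOn (K.A_ae a c x) ?_
    refine ((integrable_finsetSum _ fun k _ => (hF1x k).const_mul (c k)).integrableOn.add
      (integrable_finsetSum _ fun k _ => ?_)).neg
    refine integrableOn_inner_shift (C := N k * ‖halfProj (K.A a c x)‖) (K.fb_ae k) (hw k)
      (K.cont k) ((hF1x k).norm.const_mul ‖a‖) ?_
    filter_upwards [K.D_ae a c x k] with t ht h0
    rw [ht]
    exact hD k t h0
  · intro k
    refine integrable_halfProj_of_integrableOn (K.D_ae a c x k) ?_
    refine (Integrable.add ?_ ?_).const_mul _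
    · exact (memLp_one_iff_integrable.mp (memLp_conj (memLp_one_iff_integrable.mpr
        (hF1x k)))).integrableOn.const_mul a
    refine integrableOn_inner_shift (C := ∑ k, N k * ‖halfProj (K.D a c x k)‖) (K.f_ae_conj k)
      (hwc k) (hFc k) (integrable_finsetSum Finset.univ fun k _ => (hF1x k).norm.const_mul ‖c k‖) ?_
    filter_upwards [K.A_ae a c x] with t ht h0
    rw [ht]
    exact hA t h0

include hF hFw in
theorem integrable_Aval (a : ℂ) (c : Fin 2 → ℂ) (x : ℝ) : Integrable (K.Aval a c x) := by
  have hF1 : ∀ k, Integrable (K.F k) := fun k => integrable_of_moment (hF k) (hFw k)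
  refine ((integrable_finsetSum _ fun k _ => ((hF1 k).comp_add_left x).const_mul (c k)).add
    (integrable_finsetSum _ fun k _ => ?_)).neg
  exact (integrable_and_fourier_inner_shift (K.fb_ae k) (hF1 k)
    ((K.integrable_halfProj_sol hF hFw a c x).2 k)).1

include hF hFw in
theorem integrable_Dval (a : ℂ) (c : Fin 2 → ℂ) (x : ℝ) (k : Fin 2) :
    Integrable (K.Dval a c x k) := by
  have hF1 : ∀ k, Integrable (K.F k) := fun k => integrable_of_moment (hF k) (hFw k)
  have hFc : ∀ k, Integrable fun s => conj (K.F k s) := fun k =>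
    memLp_one_iff_integrable.mp (memLp_conj (memLp_one_iff_integrable.mpr (hF1 k)))
  refine (Integrable.add (((hFc k).comp_add_left x).const_mul a) ?_).const_mul _
  exact (integrable_and_fourier_inner_shift (K.f_ae_conj k) (hFc k)
    (K.integrable_halfProj_sol hF hFw a c x).1).1

include hF hFw in
theorem fourier_Aval (a : ℂ) (c : Fin 2 → ℂ) (x l : ℝ) :
    ∫ s, -K.Aval a c x s * exp (-2 * I * l * s)
      = ∑ k, (c k + halfTransform (K.Dval a c x k) (-l))
        * (exp (2 * I * l * x) * 𝓕 (K.F k) (l / Real.pi)) := by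
  have hF1 : ∀ k, Integrable (K.F k) := fun k => integrable_of_moment (hF k) (hFw k)
  have hF1x : ∀ k, Integrable fun s => K.F k (x + s) := fun k => (hF1 k).comp_add_left x
  have hD := (K.integrable_halfProj_sol hF hFw a c x).2
  have hq := fun k => integrable_and_fourier_inner_shift (x := x) (K.fb_ae k) (hF1 k) (hD k)
  have hE : ∀ {u : ℝ → ℂ}, Integrable u → Integrable fun s => u s * exp (-2 * I * l * s) :=
    fun {u} hu => by
      have := integrable_wave_mul hu (-(l / Real.pi))
      simpa only [wave_neg_eq_exp, mul_comm (exp _)] using this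
  have hwx : wave x (l / Real.pi) = exp (2 * I * l * x) := by
    have : (Real.pi : ℂ) ≠ 0 := ofReal_ne_zero.mpr Real.pi_ne_zero
    rw [wave]
    push_cast
    congr 1
    field_simp
  have hb : ∀ k, ∫ s, K.F k (x + s) * exp (-2 * I * l * s)
      = exp (2 * I * l * x) * 𝓕 (K.F k) (l / Real.pi) := fun k => by
    rw [fourier_eq_integral_exp, fourier_comp_add_left, hwx]
  have hq2 : ∀ k, ∫ s, ⟪shift (x + s) (K.fb k), halfProj (K.D a c x k)⟫ * exp (-2 * I * l * s)
      = halfTransform (K.Dval a c x k) (-l)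
        * (exp (2 * I * l * x) * 𝓕 (K.F k) (l / Real.pi)) := fun k => by
    rw [fourier_eq_integral_exp, (hq k).2, fourier_comp_add_left, hwx,
      Real.fourierInv_eq_fourier_neg, ← neg_div, fourier_halfProj (K.D_ae a c x k), ofReal_neg]
  have e : ∀ s, -K.Aval a c x s * exp (-2 * I * l * s)
      = ∑ k, (c k * (K.F k (x + s) * exp (-2 * I * l * s))
        + ⟪shift (x + s) (K.fb k), halfProj (K.D a c x k)⟫ * exp (-2 * I * l * s)) := fun s => by
    rw [Aval, neg_neg, Finset.sum_add_distrib, add_mul, Finset.sum_mul, Finset.sum_mul]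
    simp_rw [mul_assoc]
  simp_rw [e]
  have hi : ∀ k, Integrable fun s => c k * (K.F k (x + s) * exp (-2 * I * l * s))
      + ⟪shift (x + s) (K.fb k), halfProj (K.D a c x k)⟫ * exp (-2 * I * l * s) := fun k =>
    ((hE (hF1x k)).const_mul (c k)).add (hE (hq k).1)
  rw [integral_finsetSum _ fun k _ => hi k]
  refine Finset.sum_congr rfl fun k _ => ?_
  rw [integral_add ((hE (hF1x k)).const_mul (c k)) (hE (hq k).1), integral_const_mul, hb, hq2]
  ring

include hF hFw in
theorem fourier_Dval (a : ℂ) (c : Fin 2 → ℂ) (x l : ℝ) (k : Fin 2) :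
    ∫ s, K.Dval a c x k (-s) * exp (-2 * I * l * s)
      = K.ε * (a + halfTransform (K.Aval a c x) l)
        * conj (exp (2 * I * l * x) * 𝓕 (K.F k) (l / Real.pi)) := by
  have hF1 : ∀ k, Integrable (K.F k) := fun k => integrable_of_moment (hF k) (hFw k)
  have hFc : ∀ k, Integrable fun s => conj (K.F k s) := fun k =>
    memLp_one_iff_integrable.mp (memLp_conj (memLp_one_iff_integrable.mpr (hF1 k)))
  have hFcx : ∀ k, Integrable fun s => conj (K.F k (x + s)) := fun k => (hFc k).comp_add_left x
  have hA := (K.integrable_halfProj_sol hF hFw a c x).1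
  have hq := integrable_and_fourier_inner_shift (x := x) (K.f_ae_conj k) (hFc k) hA
  have hwx : wave x (-l / Real.pi) = conj (exp (2 * I * l * x)) := by
    have : (Real.pi : ℂ) ≠ 0 := ofReal_ne_zero.mpr Real.pi_ne_zero
    rw [wave, ← Complex.exp_conj]
    simp only [map_mul, conj_I, conj_ofReal, map_ofNat]
    push_cast
    congr 1
    field_simp
  have hcF : 𝓕 (fun s => conj (K.F k s)) (-l / Real.pi) = conj (𝓕 (K.F k) (l / Real.pi)) := by
    rw [fourier_conj, Real.fourierInv_eq_fourier_neg, neg_div, neg_neg]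
  have hE : ∀ {u : ℝ → ℂ}, Integrable u →
      Integrable fun s => u s * exp (-2 * I * ((-l : ℝ) : ℂ) * s) :=
    fun {u} hu => by
      have := integrable_wave_mul hu (-(-l / Real.pi))
      simpa only [wave_neg_eq_exp, mul_comm (exp _)] using this
  have e0 : ∫ s, K.Dval a c x k (-s) * exp (-2 * I * l * s)
      = ∫ s, K.Dval a c x k s * exp (-2 * I * ((-l : ℝ) : ℂ) * s) := by
    rw [← integral_neg_eq_self]
    congr 1 with s
    rw [neg_neg]
    push_cast
    ring_nf
  have e : ∀ s : ℝ, K.Dval a c x k s * exp (-2 * I * ((-l : ℝ) : ℂ) * s)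
      = K.ε * (a * (conj (K.F k (x + s)) * exp (-2 * I * ((-l : ℝ) : ℂ) * s))
        + ⟪shift (x + s) (K.f k), halfProj (K.A a c x)⟫ * exp (-2 * I * ((-l : ℝ) : ℂ) * s)) :=
    fun s => by
      rw [Dval]
      ring
  rw [e0]
  simp_rw [e]
  rw [integral_const_mul, integral_add ((hE (hFcx k)).const_mul a) (hE hq.1), integral_const_mul,
    fourier_eq_integral_exp, fourier_eq_integral_exp, hq.2,
    fourier_comp_add_left (fun s => conj (K.F k s)), hwx, hcF,
    Real.fourierInv_eq_fourier_neg, ← neg_div, neg_neg, fourier_halfProj (K.A_ae a c x), map_mul]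
  ring

end KernelData

/-! ### Uniqueness for the Riemann-Hilbert problem -/

/-- A continuous function which is holomorphic off the real line is entire. -/
theorem differentiable_of_differentiableOn_im_ne_zero {f : ℂ → ℂ} (hc : Continuous f)
    (hd : DifferentiableOn ℂ f {z : ℂ | z.im ≠ 0}) : Differentiable ℂ f := by
  have half : ∀ a b s t : ℝ, (0 : ℝ) ∉ Set.Ioo (min s t) (max s t) →
      (∫ x : ℝ in a..b, f (x + s * I)) - (∫ x : ℝ in a..b, f (x + t * I)) +
      I • (∫ y : ℝ in s..t, f (b + y * I)) - I • (∫ y : ℝ in s..t, f (a + y * I)) = 0 := by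
    intro a b s t h0
    have := integral_boundary_rect_eq_zero_of_continuousOn_of_differentiableOn f ⟨a, s⟩ ⟨b, t⟩
      hc.continuousOn (hd.mono fun z hz => by
        intro h
        rw [mem_reProdIm, h] at hz
        exact h0 hz.2)
    simpa using this
  rw [← differentiableOn_univ]
  refine (IsConservativeOn.isExactOn_univ hc fun z w _ => ?_).differentiableOn isOpen_univ
  rw [← add_eq_zero_iff_eq_neg, wedgeIntegral_add_wedgeIntegral_eq]
  have h1 := half z.re w.re z.im 0 fun h => by
    rcases le_total z.im 0 with h2 | h2 <;> simp [h2] at h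
  have h2 := half z.re w.re 0 w.im fun h => by
    rcases le_total w.im 0 with h2 | h2 <;> simp [h2] at h
  have hi : ∀ a s t : ℝ, IntervalIntegrable (fun y : ℝ => f (a + y * I)) volume s t :=
    fun a s t => (hc.comp (by fun_prop)).intervalIntegrable _ _
  rw [← intervalIntegral.integral_add_adjacent_intervals (hi w.re z.im 0) (hi w.re 0 w.im),
    ← intervalIntegral.integral_add_adjacent_intervals (hi z.re z.im 0) (hi z.re 0 w.im)]
  simp only [smul_add] at h1 h2 ⊢
  linear_combination h1 + h2

/-- A function holomorphic off the real line without jump across it, and with a limit at infinity,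
is constant. -/
theorem eq_of_no_jump {f : ℂ → ℂ} {g : ℝ → ℂ} {c : ℂ}
    (hd : DifferentiableOn ℂ f {z : ℂ | z.im ≠ 0})
    (hl : Tendsto f (cobounded ℂ ⊓ 𝓟 {z : ℂ | z.im ≠ 0}) (𝓝 c)) (hg : Continuous g)
    (hp : ∀ l : ℝ, Tendsto f (𝓝[{z : ℂ | 0 < z.im}] (l : ℂ)) (𝓝 (g l)))
    (hm : ∀ l : ℝ, Tendsto f (𝓝[{z : ℂ | z.im < 0}] (l : ℂ)) (𝓝 (g l)))
    {z : ℂ} (hz : z.im ≠ 0) : f z = c := by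
  classical
  set F : ℂ → ℂ := fun z => if z.im = 0 then g z.re else f z with hF
  have hFf : ∀ z : ℂ, z.im ≠ 0 → F z = f z := fun z hz => if_neg hz
  have hFg : ∀ z : ℂ, z.im = 0 → F z = g z.re := fun z hz => if_pos hz
  have hopen : IsOpen {z : ℂ | z.im ≠ 0} := isOpen_ne_fun continuous_im continuous_const
  have hFd : DifferentiableOn ℂ F {z : ℂ | z.im ≠ 0} := hd.congr fun z hz => hFf z hz
  have hFc : Continuous F := by
    rw [continuous_iff_continuousAt]
    intro z
    by_cases hz : z.im = 0
    · obtain ⟨l, rfl⟩ : ∃ l : ℝ, (l : ℂ) = z := ⟨z.re, by apply Complex.ext <;> simp [hz]⟩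
      have hFl : F l = g l := by simpa using hFg l (ofReal_im l)
      rw [ContinuousAt, hFl, ← nhdsWithin_univ]
      have hu : (Set.univ : Set ℂ) = {z : ℂ | z.im = 0} ∪ ({z : ℂ | 0 < z.im} ∪ {z : ℂ | z.im < 0}) := by
        ext z
        rcases lt_trichotomy z.im 0 with h | h | h <;> simp [h]
      rw [hu, nhdsWithin_union, nhdsWithin_union]
      refine Tendsto.sup ?_ (Tendsto.sup ?_ ?_)
      · have h1 : Tendsto (fun z : ℂ => g z.re) (𝓝 (l : ℂ)) (𝓝 (g l)) := by
          have := (hg.comp continuous_re).tendsto (l : ℂ)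
          simpa [Function.comp_def] using this
        refine (h1.mono_left nhdsWithin_le_nhds).congr' ?_
        filter_upwards [self_mem_nhdsWithin] with w hw
        exact (hFg w hw).symm
      · refine (hp l).congr' ?_
        filter_upwards [self_mem_nhdsWithin] with w hw
        exact (hFf w (ne_of_gt hw)).symm
      · refine (hm l).congr' ?_
        filter_upwards [self_mem_nhdsWithin] with w hw
        exact (hFf w (ne_of_lt hw)).symm
    · exact (hFd.differentiableAt (hopen.mem_nhds hz)).continuousAt
  have hFl : Tendsto F (cocompact ℂ) (𝓝 c) := by
    rw [← Metric.cobounded_eq_cocompact, Metric.nhds_basis_closedBall.tendsto_right_iff]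
    intro e he
    have h1 := Metric.nhds_basis_closedBall.tendsto_right_iff.mp hl e he
    rw [eventually_inf_principal, ← comap_norm_atTop, eventually_comap] at h1
    obtain ⟨R, hR⟩ := eventually_atTop.mp h1
    have h2 : ∀ z : ℂ, R ≤ ‖z‖ → z.im ≠ 0 → F z ∈ Metric.closedBall c e := fun z hz hz' => by
      rw [hFf z hz']
      exact hR ‖z‖ hz z rfl hz'
    filter_upwards [eventually_cobounded_le_norm (R + 1)] with z hz
    by_cases hz' : z.im = 0
    · refine Metric.isClosed_closedBall.mem_of_frequently_of_tendsto ?_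
        (hFc.continuousAt.tendsto.mono_left (nhdsWithin_le_nhds (s := {w : ℂ | w.im ≠ 0})))
        (b := 𝓝[{w : ℂ | w.im ≠ 0}] z)
      have hne : (𝓝[{w : ℂ | w.im ≠ 0}] z).NeBot := by
        rw [← mem_closure_iff_nhdsWithin_neBot]
        have : Tendsto (fun n : ℕ => z + ((1 / ((n : ℝ) + 1) : ℝ) : ℂ) * I) atTop (𝓝 z) := by
          have h3 := ((continuous_ofReal.tendsto 0).comp
            (tendsto_one_div_add_atTop_nhds_zero_nat (𝕜 := ℝ))).mul_const I
          simpa using h3.const_add z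
        refine mem_closure_of_tendsto this (Eventually.of_forall fun n => ?_)
        have : (0 : ℝ) < 1 / ((n : ℝ) + 1) := by positivity
        have e : (z + ((1 / ((n : ℝ) + 1) : ℝ) : ℂ) * I).im = 1 / ((n : ℝ) + 1) := by
          rw [add_im, hz', zero_add, im_ofReal_mul, I_im, mul_one]
        exact ne_of_gt (by rw [e]; exact this)
      refine Eventually.frequently ?_
      have hn : ∀ᶠ w in 𝓝[{w : ℂ | w.im ≠ 0}] z, R ≤ ‖w‖ :=
        nhdsWithin_le_nhds ((continuous_norm.tendsto z).eventually
          (eventually_ge_nhds (by linarith)))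
      filter_upwards [hn, self_mem_nhdsWithin] with w h3 h4
      exact h2 w h3 h4
    · exact h2 z (by linarith) hz'
  rw [← hFf z hz]
  exact (differentiable_of_differentiableOn_im_ne_zero hFc hFd).apply_eq_of_tendsto_cocompact z hFl

theorem det_adConj_jumpV (ε : ℝ) (r₁ r₂ : ℂ) (x l : ℝ) : (adConj x l (jumpV ε r₁ r₂)).det = 1 := by
  have h1 : exp (-2 * I * l * x) * exp (2 * I * l * x) = 1 := by
    rw [← Complex.exp_add]
    simp
  have h2 : ∀ r : ℂ, (‖r‖ : ℂ) ^ 2 = star r * r := fun r => (conj_mul' r).symm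
  rw [det_fin_three]
  simp [adConj, jumpV, h2]
  simp only [neg_mul] at h1
  linear_combination (-(ε : ℂ) * (conj r₁ * r₁ + conj r₂ * r₂)) * h1

theorem differentiableOn_mul_adjugate {M N : ℂ → Matrix (Fin 3) (Fin 3) ℂ} {S : Set ℂ}
    (hM : ∀ i j, DifferentiableOn ℂ (fun z => M z i j) S)
    (hN : ∀ i j, DifferentiableOn ℂ (fun z => N z i j) S) (i j : Fin 3) :
    DifferentiableOn ℂ (fun z => (N z * (M z).adjugate) i j) S := by
  have hadj : ∀ i j, DifferentiableOn ℂ (fun z => (M z).adjugate i j) S := fun i j => by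
    simp only [adjugate_fin_three]
    fin_cases i <;> fin_cases j <;> first
      | exact ((hM _ _).mul (hM _ _)).sub ((hM _ _).mul (hM _ _))
      | exact ((hM _ _).mul (hM _ _)).neg.add ((hM _ _).mul (hM _ _))
  simp only [Matrix.mul_apply]
  exact DifferentiableOn.fun_sum fun k _ => (hN i k).mul (hadj k j)

theorem Filter.Tendsto.mul_adjugate_apply {α : Type*} {l : Filter α}
    {M N : α → Matrix (Fin 3) (Fin 3) ℂ} {A B : Matrix (Fin 3) (Fin 3) ℂ}
    (hN : Tendsto N l (𝓝 A)) (hM : Tendsto M l (𝓝 B)) (i j : Fin 3) :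
    Tendsto (fun z => (N z * (M z).adjugate) i j) l (𝓝 ((A * B.adjugate) i j)) := by
  have hc : Continuous fun A : Matrix (Fin 3) (Fin 3) ℂ => A.adjugate :=
    continuous_id.matrix_adjugate
  have h := hN.mul ((hc.tendsto B).comp hM)
  have he : Continuous fun A : Matrix (Fin 3) (Fin 3) ℂ => A i j := continuous_id.matrix_elem i j
  have h2 := (he.tendsto _).comp h
  simp only [Function.comp_def] at h2
  exact h2

namespace IsRHPSolution

variable {ε : ℝ} {ρ₁ ρ₂ : ℝ → ℂ} {x : ℝ} {M N : ℂ → Matrix (Fin 3) (Fin 3) ℂ}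

theorem mul_adjugate_eq_one (hM : IsRHPSolution ε ρ₁ ρ₂ x M) (hN : IsRHPSolution ε ρ₁ ρ₂ x N)
    {z : ℂ} (hz : z.im ≠ 0) : N z * (M z).adjugate = 1 := by
  obtain ⟨Mp, Mm, -, hMm, hMp', hMm', hMj⟩ := hM.jump
  obtain ⟨Np, Nm, -, hNm, hNp', hNm', hNj⟩ := hN.jump
  have hj : ∀ l, Np l * (Mp l).adjugate = Nm l * (Mm l).adjugate := fun l => by
    rw [hMj, hNj, adjugate_mul_distrib, Matrix.mul_assoc, ← Matrix.mul_assoc _ (adjugate _),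
      mul_adjugate, det_adConj_jumpV, one_smul, Matrix.one_mul]
  ext i j
  refine eq_of_no_jump (g := fun l => (Nm l * (Mm l).adjugate) i j)
    (differentiableOn_mul_adjugate hM.analytic hN.analytic i j) ?_ ?_ (fun l => ?_)
    (fun l => (hNm' l).mul_adjugate_apply (hMm' l) i j) hz
  · have := hN.tendsto_one.mul_adjugate_apply hM.tendsto_one i j
    rwa [adjugate_one, Matrix.mul_one] at this
  · exact (hNm.matrix_mul hMm.matrix_adjugate).matrix_elem i j
  · rw [← hj]
    exact (hNp' l).mul_adjugate_apply (hMp' l) i j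

/-- Solutions of the Riemann-Hilbert problem are unique. -/
theorem unique (hM : IsRHPSolution ε ρ₁ ρ₂ x M) (hN : IsRHPSolution ε ρ₁ ρ₂ x N)
    {z : ℂ} (hz : z.im ≠ 0) : N z = M z := by
  have h1 := hM.mul_adjugate_eq_one hN hz
  have h2 := hM.mul_adjugate_eq_one hM hz
  rw [mul_adjugate] at h2
  have h3 : (M z).adjugate * M z = 1 := by rw [adjugate_mul, h2]
  calc N z = N z * ((M z).adjugate * M z) := by rw [h3, Matrix.mul_one]
    _ = M z := by rw [← Matrix.mul_assoc, h1, Matrix.one_mul]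

end IsRHPSolution

/-! ### Solution of the Riemann-Hilbert problem -/

namespace KernelData

variable (K : KernelData)

/-- The kernels of the row with value `(a, c)` at infinity. -/
noncomputable def rowKernel (a : ℂ) (c : Fin 2 → ℂ) (x : ℝ) : Fin 3 → ℝ → ℂ :=
  ![fun s => -K.Aval a c x s, fun s => K.Dval a c x 0 (-s), fun s => K.Dval a c x 1 (-s)]

/-- The kernels of the solution of the Riemann-Hilbert problem. -/
noncomputable def rhpKernel (x : ℝ) (i : Fin 3) : Fin 3 → ℝ → ℂ :=
  K.rowKernel ((1 : Matrix (Fin 3) (Fin 3) ℂ) i 0)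
    ![(1 : Matrix (Fin 3) (Fin 3) ℂ) i 1, (1 : Matrix (Fin 3) (Fin 3) ℂ) i 2] x

/-- The solution of the Riemann-Hilbert problem. -/
noncomputable def rhp (x : ℝ) (z : ℂ) : Matrix (Fin 3) (Fin 3) ℂ :=
  1 + Matrix.of fun i j => cauchyTransform (K.rhpKernel x i j) z

theorem rhp_apply (x : ℝ) (z : ℂ) (i j : Fin 3) :
    K.rhp x z i j = (1 : Matrix (Fin 3) (Fin 3) ℂ) i j + cauchyTransform (K.rhpKernel x i j) z :=
  rfl

theorem continuous_rhpKernel (x : ℝ) (i j : Fin 3) : Continuous (K.rhpKernel x i j) := by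
  fin_cases j
  · exact (K.continuous_Aval _ _ x).neg
  · exact (K.continuous_Dval _ _ x 0).comp continuous_neg
  · exact (K.continuous_Dval _ _ x 1).comp continuous_neg

theorem exists_bound_rhpKernel (x : ℝ) (i j : Fin 3) : ∃ B, ∀ s, ‖K.rhpKernel x i j s‖ ≤ B := by
  fin_cases j
  · exact ⟨_, fun s => (norm_neg _).trans_le (K.norm_Aval_le _ _ x s)⟩
  · exact ⟨_, fun s => K.norm_Dval_le _ _ x 0 (-s)⟩
  · exact ⟨_, fun s => K.norm_Dval_le _ _ x 1 (-s)⟩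

variable {K} (hF : ∀ k, MemLp (K.F k) 2)
  (hFw : ∀ k, MemLp (fun y : ℝ => (y : ℂ) * K.F k y) 2)

include hF hFw in
theorem integrable_rhpKernel (x : ℝ) (i j : Fin 3) : Integrable (K.rhpKernel x i j) := by
  fin_cases j
  · exact (K.integrable_Aval hF hFw _ _ x).neg
  · exact (K.integrable_Dval hF hFw _ _ x 0).comp_neg
  · exact (K.integrable_Dval hF hFw _ _ x 1).comp_neg

include hF hFw in
theorem isRHPSolution_rhp {ρ : Fin 2 → ℝ → ℂ}
    (hρ : ∀ k, 𝓕 (K.F k) = fun ξ => ρ k (Real.pi * ξ)) (x : ℝ) :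
    IsRHPSolution K.ε (ρ 0) (ρ 1) x (K.rhp x) := by
  have hi := K.integrable_rhpKernel hF hFw x
  have hb := K.exists_bound_rhpKernel x
  refine ⟨fun i j => ?_, ?_, fun c hc i j => ?_, ?_⟩
  · exact (differentiableOn_const _).add (differentiableOn_cauchyTransform (hi i j))
  · refine tendsto_pi_nhds.mpr fun i => tendsto_pi_nhds.mpr fun j => ?_
    obtain ⟨B, hB⟩ := hb i j
    have := (tendsto_cauchyTransform (hi i j) hB).const_add ((1 : Matrix (Fin 3) (Fin 3) ℂ) i j)
    rwa [add_zero] at this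
  · obtain ⟨B, hB⟩ := hb i j
    simpa only [rhp_apply, add_sub_cancel_left] using isBigO_cauchyTransform hB hc
  · refine ⟨fun l => 1 + Matrix.of fun i j => halfTransform (fun s => K.rhpKernel x i j (-s)) (-l),
      fun l => 1 + Matrix.of fun i j => -halfTransform (K.rhpKernel x i j) l, ?_, ?_,
      fun l => ?_, fun l => ?_, fun l => ?_⟩
    · refine continuous_const.add (continuous_matrix fun i j => ?_)
      have := (continuous_halfTransform_ofReal (hi i j).comp_neg).comp continuous_neg
      simpa [Function.comp_def] using this
    · exact continuous_const.add
        (continuous_matrix fun i j => (continuous_halfTransform_ofReal (hi i j)).neg)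
    · exact tendsto_pi_nhds.mpr fun i => tendsto_pi_nhds.mpr fun j =>
        (tendsto_cauchyTransform_upper (hi i j) l).const_add _
    · exact tendsto_pi_nhds.mpr fun i => tendsto_pi_nhds.mpr fun j =>
        (tendsto_cauchyTransform_lower (hi i j) l).const_add _
    · have hr : ∀ k, 𝓕 (K.F k) (l / Real.pi) = ρ k l := fun k => by
        rw [hρ k]
        field_simp
      have hsq : ∀ k, ((‖ρ k l‖ : ℝ) : ℂ) ^ 2 = conj (ρ k l) * ρ k l := fun k =>
        (conj_mul' (ρ k l)).symm
      have hE : exp (-2 * I * l * x) * exp (2 * I * l * x) = 1 := by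
        rw [← Complex.exp_add]
        simp
      have hEc : conj (exp (2 * I * l * x)) = exp (-2 * I * l * x) := by
        rw [← Complex.exp_conj]
        simp only [map_mul, conj_I, conj_ofReal, map_ofNat]
        ring_nf
      ext i j
      set a := (1 : Matrix (Fin 3) (Fin 3) ℂ) i 0 with ha
      set c : Fin 2 → ℂ := ![(1 : Matrix (Fin 3) (Fin 3) ℂ) i 1,
        (1 : Matrix (Fin 3) (Fin 3) ℂ) i 2] with hcdef
      have k0 : K.rhpKernel x i 0 = fun s => -K.Aval a c x s := rfl
      have k1 : K.rhpKernel x i 1 = fun s => K.Dval a c x 0 (-s) := rfl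
      have k2 : K.rhpKernel x i 2 = fun s => K.Dval a c x 1 (-s) := rfl
      have j0 := halfTransform_add_halfTransform (hi i 0) l
      have j1 := halfTransform_add_halfTransform (hi i 1) l
      have j2 := halfTransform_add_halfTransform (hi i 2) l
      have n0 : halfTransform (K.rhpKernel x i 0) l = -halfTransform (K.Aval a c x) l := by
        rw [k0, halfTransform, halfTransform, ← integral_neg]
        simp_rw [neg_mul]
      have p1 : halfTransform (fun s => K.rhpKernel x i 1 (-s)) (-l)
          = halfTransform (K.Dval a c x 0) (-l) := by simp only [k1, neg_neg]
      have p2 : halfTransform (fun s => K.rhpKernel x i 2 (-s)) (-l)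
          = halfTransform (K.Dval a c x 1) (-l) := by simp only [k2, neg_neg]
      have f0 : ∫ s, K.rhpKernel x i 0 s * exp (-2 * I * l * s) = _ :=
        K.fourier_Aval hF hFw a c x l
      have f1 : ∫ s, K.rhpKernel x i 1 s * exp (-2 * I * l * s) = _ :=
        K.fourier_Dval hF hFw a c x l 0
      have f2 : ∫ s, K.rhpKernel x i 2 s * exp (-2 * I * l * s) = _ :=
        K.fourier_Dval hF hFw a c x l 1
      rw [f0, Fin.sum_univ_two, hr, hr, ← p1, ← p2] at j0
      rw [f1, hr, map_mul, hEc, ← neg_eq_iff_eq_neg.mpr n0] at j1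
      rw [f2, hr, map_mul, hEc, ← neg_eq_iff_eq_neg.mpr n0] at j2
      have c0 : c 0 = (1 : Matrix (Fin 3) (Fin 3) ℂ) i 1 := rfl
      have c1 : c 1 = (1 : Matrix (Fin 3) (Fin 3) ℂ) i 2 := rfl
      rw [Matrix.mul_apply, Fin.sum_univ_three]
      simp only [Matrix.add_apply, Matrix.of_apply]
      rw [← ha, ← c0, ← c1]
      fin_cases j
      · change a + _ = _
        simp [adConj, jumpV, hsq]
        linear_combination j0 + exp (2 * I * l * x) * ρ 0 l * j1 + exp (2 * I * l * x) * ρ 1 l * j2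
          + K.ε * (a - halfTransform (K.rhpKernel x i 0) l)
            * (conj (ρ 0 l) * ρ 0 l + conj (ρ 1 l) * ρ 1 l) * hE
      · change c 0 + _ = _
        simp [adConj, jumpV]
        simp only [neg_mul] at j1
        linear_combination j1
      · change c 1 + _ = _
        simp [adConj, jumpV]
        simp only [neg_mul] at j2
        linear_combination j2

theorem isReconstructed_rhp (hF : ∀ k, MemLp (K.F k) 2)
    (hFw : ∀ k, MemLp (fun y : ℝ => (y : ℂ) * K.F k y) 2) (x : ℝ) :
    IsReconstructed (K.rhp x) (K.pot 0 x) (K.pot 1 x) := by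
  intro c hc
  have key : ∀ i : Fin 3, (1 : Matrix (Fin 3) (Fin 3) ℂ) i 0 = 0 →
      Tendsto (fun z => -2 * I * (z * K.rhp x z i 0)) (sectorAtInfty c {z : ℂ | z.im < 0})
        (𝓝 (K.rhpKernel x i 0 0)) := fun i hi0 => by
    obtain ⟨B, hB⟩ := K.exists_bound_rhpKernel x i 0
    refine (tendsto_mul_halfTransform (K.continuous_rhpKernel x i 0)
      (K.integrable_rhpKernel hF hFw x i 0) hB hc).congr' ?_
    rw [EventuallyEq, sectorAtInfty, eventually_inf_principal]
    refine Eventually.of_forall fun z hz => ?_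
    rw [rhp_apply, hi0, zero_add, cauchyTransform_of_neg hz.1]
    ring
  have e0 : K.rhpKernel x 1 0 0 = K.pot 0 x := by
    have : (![(1 : Matrix (Fin 3) (Fin 3) ℂ) 1 1, (1 : Matrix (Fin 3) (Fin 3) ℂ) 1 2])
        = (Pi.single 0 1 : Fin 2 → ℂ) := by
      ext k
      fin_cases k <;> simp
    simp [rhpKernel, rowKernel, pot, ← this]
  have e1 : K.rhpKernel x 2 0 0 = K.pot 1 x := by
    have : (![(1 : Matrix (Fin 3) (Fin 3) ℂ) 2 1, (1 : Matrix (Fin 3) (Fin 3) ℂ) 2 2])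
        = (Pi.single 1 1 : Fin 2 → ℂ) := by
      ext k
      fin_cases k <;> simp
    simp [rhpKernel, rowKernel, pot, ← this]
  exact ⟨e0 ▸ key 1 (by simp), e1 ▸ key 2 (by simp)⟩

end KernelData

theorem proposition3p7 (ε : ℝ) (hε : ε = 1 ∨ ε = -1) (ρ₁ ρ₂ : ℝ → ℂ)
    (hc₁ : Continuous ρ₁) (hc₂ : Continuous ρ₂)
    (hρ₁ : MemWeightedH 1 1 ρ₁) (hρ₂ : MemWeightedH 1 1 ρ₂)
    (hdefocusing : ε = -1 → ∀ l : ℝ, ‖ρ₁ l‖ ^ 2 + ‖ρ₂ l‖ ^ 2 < 1) :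
    ∃ M : ℝ → ℂ → Matrix (Fin 3) (Fin 3) ℂ,
      (∀ x, IsRHPSolution ε ρ₁ ρ₂ x (M x)) ∧
      (∀ x N, IsRHPSolution ε ρ₁ ρ₂ x N → ∀ z : ℂ, z.im ≠ 0 → N z = M x z) ∧
      ∃ u v : ℝ → ℂ,
        (∀ x, IsReconstructed (M x) (u x) (v x)) ∧
        (MemH 1 u ∧ MemH 1 v) ∧
        (MemWeightedH 0 2 ρ₁ → MemWeightedH 0 2 ρ₂ → MemH 2 u ∧ MemH 2 v) := by
  obtain ⟨K, hKε, hF, hFw, hFρ, hS⟩ := exists_kernelData hε (ρ := ![ρ₁, ρ₂])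
    (Fin.forall_fin_two.mpr ⟨hc₁, hc₂⟩) (Fin.forall_fin_two.mpr ⟨hρ₁, hρ₂⟩)
    (by simpa [Fin.sum_univ_two] using hdefocusing)
  have hsol : ∀ x, IsRHPSolution ε ρ₁ ρ₂ x (K.rhp x) := fun x =>
    hKε ▸ KernelData.isRHPSolution_rhp hF hFw hFρ x
  refine ⟨K.rhp, hsol, fun x N hN z hz => (hsol x).unique hN hz, K.pot 0, K.pot 1,
    KernelData.isReconstructed_rhp hF hFw, ⟨K.memH_one_pot 0, K.memH_one_pot 1⟩, fun h₁ h₂ => ?_⟩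
  obtain ⟨C₂, hK⟩ := hS (Fin.forall_fin_two.mpr ⟨h₁, h₂⟩)
  exact ⟨hK.memH_two_pot 0, hK.memH_two_pot 1⟩
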